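/- **Setting.** Let $\mathcal U,\mathcal V,\mathcal X,\mathcal Y,\mathcal Z$ be finite alphabets with $0\in\mathcal X$, let $P_{UV},Q_{UV}$ be pmfs on $\mathcal U\times\mathcal V$ with $P_{UV}(u,v)=0$ whenever $Q_{UV}(u,v)=0$, and let $\Gamma_{YZ|X}$ be a discrete memoryless channel (DMC) such that (i) for every pmf $\psi$ on $\mathcal X\setminus\{0\}$, $\sum_{x\neq0}\psi(x)\Gamma_{Z|X}(\cdot|x)\neq\Gamma_{Z|X}(\cdot|0)$; (ii) for all $x$, $\mathrm{Supp}\,\Gamma_{Z|X}(\cdot|x)\subseteq\mathrm{Supp}\,\Gamma_{Z|X}(\cdot|0)$ and $\mathrm{Supp}\,\Gamma_{Y|X}(\cdot|x)\subseteq\mathrm{Supp}\,\Gamma_{Y|X}(\cdot|0)$. Under $\mathcal H=0$ the pairs $(U_i,V_i)$, $i=1,\dots,n$, are i.i.d. $P_{UV}$; under $\mathcal H=1$ they are i.i.d. $Q_{UV}$. A key $S$, uniform on a set of $K_n\ge1$ elements (the sizes $K_n$ are arbitrary) and independent of the sources, is known to the sensor and to the decision center. The sensor sends $X^n=f^{(n)}(U^n,S)$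 over $n$ uses of the DMC; the decision center observes $Y^n$ and declares $\hat{\mathcal H}=g^{(n)}(V^n,Y^n,S)\in\{0,1\}$; a warden observes $Z^n$. Put $\alpha_n=\Pr[\hat{\mathcal H}=1|\mathcal H=0]$, $\beta_n=\Pr[\hat{\mathcal H}=0|\mathcal H=1]$ and $d_n=D\big(P_{Z^n|\mathcal H=0}\,\big\|\,\Gamma_{Z|X}(\cdot|0)^{\otimes n}\big)$, where $D$ is the Kullback–Leibler divergence with natural logarithms. For $\epsilon\in[0,1)$, a sequence $\{(f^{(n)},g^{(n)})\}_n$ *achieves* $\theta\ge0$ if $d_n\to0$, $\limsup_n\alpha_n\le\epsilon$ and $\liminf_n-\frac1n\log\beta_n\ge\theta$. The covert Stein exponent $\theta^*_{\rm covert}(\epsilon)$ is the supremum of the $\theta>0$ achieved by some sequence ($0$ if there is none). **Exponents.** Let $$E_1=\min_{\pi_{UV}:\ \pi_U=P_U,\ \pi_V=P_V}D(\pi_{UV}\|Q_{UV}),$$ and for $x_1\in\mathcal X\setminus\{0\}$ let $$\bar{\mathcal P}_U(x_1)=\Big\{\pi_U:\ D(\pi_U\|P_U)\ge\max_{\pi_z}\big[D(\pi_z\|\Gamma_{Z|X}(\cdot|0))-\tfrac32D(\pi_z\|\Gamma_{Z|X}(\cdot|x_1))\big]\Big\}$$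 (the maximum is over the pmfs $\pi_z$ on $\mathcal Z$ with $D(\pi_z\|\Gamma_{Z|X}(\cdot|x_1))<\infty$), $$E_2(x_1)=\inf_{\pi_{UV}:\ \pi_V=P_V,\ \pi_U\notin\bar{\mathcal P}_U(x_1)}D(\pi_{UV}\|Q_{UV}),$$ $$E_3(x_1)=\inf_{\pi_{UV}:\ \pi_V=P_V,\ \pi_U\in\bar{\mathcal P}_U(x_1)}D(\pi_{UV}\|Q_{UV})+D\big(\Gamma_{Y|X}(\cdot|0)\big\|\Gamma_{Y|X}(\cdot|x_1)\big),$$ with the infimum of the empty set equal to $+\infty$. **Theorem 1.** Fix $\epsilon\in[0,1)$. 1. Suppose that there are $\hat x\in\mathcal X\setminus\{0\}$ and $y^*\in\mathcal Y$ with $\Gamma_{Y|X}(y^*|0)>0$ and $\Gamma_{Y|X}(y^*|\hat x)=0$. Then, for all key sizes, $\theta^*_{\rm covert}(\epsilon)=E_1$. Moreover, $E_1$ is achieved without using the key and with $d_n$ vanishing arbitrarily close to exponentially fast: for every real sequence $r_n$ with $r_n/n\to0$ there is a sequence of encoding and decision functions that do not depend on the key, that achieves $E_1$, and for which $d_n\le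 e^{-r_n}$ for all large $n$. 2. Otherwise, for all key sizes and every $x_1\in\mathcal X\setminus\{0\}$, $\theta^*_{\rm covert}(\epsilon)\ge\min\{E_2(x_1),E_3(x_1)\}$; that is, $\theta^*_{\rm covert}(\epsilon)\ge\max_{x_1\ne0}\min\{E_2(x_1),E_3(x_1)\}$ when $\mathcal X\ne\{0\}$. Moreover, $\min\{E_2(x_1),E_3(x_1)\}$ is achieved by a sequence of encoding and decision functions that do not depend on the key and for which $d_n$ vanishes exponentially fast: $d_n\le e^{-an}$ for some $a>0$ and all large $n$. -/

import Mathlib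

open Filter Topology
open scoped ENNReal NNReal

noncomputable section

namespace CovertDHT

/-- Kullback-Leibler divergence (natural logarithm) of two pmfs on a finite alphabet:
`∑ p log (p / q)` if `p ≪ q`, and `+∞` otherwise. -/
def klDiv {A : Type*} [Fintype A] (p q : A → ℝ) : ℝ≥0∞ :=
  open Classical in
  if ∀ a, q a = 0 → p a = 0 then ENNReal.ofReal (∑ a, p a * Real.log (p a / q a)) else ⊤

/-- First marginal of a function on a product alphabet. -/
def fstMarg {A B : Type*} [Fintype B] (p : A × B → ℝ) (a : A) : ℝ := ∑ b, p (a, b)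

/-- Second marginal of a function on a product alphabet. -/
def sndMarg {A B : Type*} [Fintype A] (p : A × B → ℝ) (b : B) : ℝ := ∑ a, p (a, b)

section Model

variable {U V X Y Z : Type*} [Fintype U] [Fintype V] [Fintype X] [Fintype Y] [Fintype Z] [Zero X]

/-- The receiver's marginal channel `Γ_{Y|X}` of the channel `Γ_{YZ|X}`. -/
def chanY (Γ : X → Y × Z → ℝ) (x : X) : Y → ℝ := fstMarg (Γ x)

/-- The warden's marginal channel `Γ_{Z|X}` of the channel `Γ_{YZ|X}`. -/
def chanZ (Γ : X → Y × Z → ℝ) (x : X) : Z → ℝ := sndMarg (Γ x)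

/-- An encoding function and a decision function of blocklength `n`, with a key from a set of `K`
elements that is known to the sensor and to the decision center. -/
structure Code (U V X Y : Type*) (n K : ℕ) where
  /-- the encoding function, `x^n = f(u^n, s)` -/
  enc : (Fin n → U) → Fin K → (Fin n → X)
  /-- the decision function; the value `j` means that the hypothesis `j` is declared -/
  dec : (Fin n → V) → (Fin n → Y) → Fin K → Fin 2

/-- The code makes no use of the key. -/
def Code.KeyFree {n K : ℕ} (c : Code U V X Y n K) : Prop :=
  (∀ u s s', c.enc u s = c.enc u s') ∧ (∀ v y s s', c.dec v y s = c.dec v y s')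

/-- Probability that the decision center declares `j` when `(U^n, V^n)` is i.i.d. `W`, the key is
uniform and independent of the sources, and the channel is memoryless with law `Γ`. -/
def guessProb (W : U × V → ℝ) (Γ : X → Y × Z → ℝ) {n K : ℕ} (c : Code U V X Y n K)
    (j : Fin 2) : ℝ :=
  (1 / (K : ℝ)) * ∑ s : Fin K, ∑ u : Fin n → U, ∑ v : Fin n → V, (∏ i, W (u i, v i)) *
    ∑ y : Fin n → Y, (∏ i, chanY Γ (c.enc u s i) (y i)) * (if c.dec v y s = j then 1 else 0)

/-- Type-I error probability. -/
def typeI (P : U × V → ℝ) (Γ : X → Y × Z → ℝ) {n K : ℕ} (c : Code U V X Y n K) : ℝ :=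
  guessProb P Γ c 1

/-- Type-II error probability. -/
def typeII (Q : U × V → ℝ) (Γ : X → Y × Z → ℝ) {n K : ℕ} (c : Code U V X Y n K) : ℝ :=
  guessProb Q Γ c 0

/-- `-(1/n) log β`, with value `+∞` if `β = 0`. -/
def decayRate (n : ℕ) (β : ℝ) : EReal :=
  open Classical in if β = 0 then ⊤ else ((-(1 / (n : ℝ)) * Real.log β : ℝ) : EReal)

/-- The law of the warden's observations `Z^n` under the null hypothesis. -/
def wardenLaw (P : U × V → ℝ) (Γ : X → Y × Z → ℝ) {n K : ℕ} (c : Code U V X Y n K)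
    (z : Fin n → Z) : ℝ :=
  (1 / (K : ℝ)) * ∑ s : Fin K, ∑ u : Fin n → U,
    (∏ i, fstMarg P (u i)) * ∏ i, chanZ Γ (c.enc u s i) (z i)

/-- The covertness measure `d_n`. -/
def wardenDiv (P : U × V → ℝ) (Γ : X → Y × Z → ℝ) {n K : ℕ} (c : Code U V X Y n K) : ℝ≥0∞ :=
  klDiv (wardenLaw P Γ c) (fun z : Fin n → Z => ∏ i, chanZ Γ 0 (z i))

/-- The sequence of codes is covert (`d_n → 0`), has asymptotic type-I error at most `ε`, and has
type-II error exponent at least `θ`. -/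
def Achieves (P Q : U × V → ℝ) (Γ : X → Y × Z → ℝ) {κ : ℕ → ℕ} (ε : ℝ)
    (c : (n : ℕ) → Code U V X Y n (κ n)) (θ : ℝ≥0∞) : Prop :=
  Tendsto (fun n => wardenDiv P Γ (c n)) atTop (𝓝 0) ∧
  limsup (fun n => typeI P Γ (c n)) atTop ≤ ε ∧
  (θ : EReal) ≤ liminf (fun n => decayRate n (typeII Q Γ (c n))) atTop

/-- The covert Stein exponent for key sizes `κ n`: the supremum of the achievable exponents
`θ > 0` (equal to `0` if there is none). -/
def covertStein (P Q : U × V → ℝ) (Γ : X → Y × Z → ℝ) (κ : ℕ → ℕ) (ε : ℝ) : ℝ≥0∞ :=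
  ⨆ θ ∈ {θ : ℝ≥0 | 0 < θ ∧
    ∃ c : (n : ℕ) → Code U V X Y n (κ n), Achieves P Q Γ ε c (θ : ℝ≥0∞)}, (θ : ℝ≥0∞)

/-- The exponent `E₁`. -/
def E1 (P Q : U × V → ℝ) : ℝ≥0∞ :=
  ⨅ π ∈ {π : U × V → ℝ | π ∈ stdSimplex ℝ (U × V) ∧
    fstMarg π = fstMarg P ∧ sndMarg π = sndMarg P}, klDiv π Q

/-- The set of pmfs `π_U` with
`D(π_U‖P_U) ≥ max_{π_z} [D(π_z‖Γ_{Z|X}(·|0)) - (3/2) D(π_z‖Γ_{Z|X}(·|x₁))]`.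
The subtracted divergence is moved to the other side of the inequality, so that a `π_z` for which
it is infinite imposes no condition. -/
def barP (P : U × V → ℝ) (Γ : X → Y × Z → ℝ) (x₁ : X) : Set (U → ℝ) :=
  {πU | πU ∈ stdSimplex ℝ U ∧ ∀ πz ∈ stdSimplex ℝ Z,
    klDiv πz (chanZ Γ 0) ≤ klDiv πU (fstMarg P) + (3 / 2) * klDiv πz (chanZ Γ x₁)}

/-- The exponent `E₂`, as a function of the nonzero input symbol `x₁`. -/
def E2 (P Q : U × V → ℝ) (Γ : X → Y × Z → ℝ) (x₁ : X) : ℝ≥0∞ :=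
  ⨅ π ∈ {π : U × V → ℝ | π ∈ stdSimplex ℝ (U × V) ∧
    sndMarg π = sndMarg P ∧ fstMarg π ∉ barP P Γ x₁}, klDiv π Q

/-- The exponent `E₃`, as a function of the nonzero input symbol `x₁`. -/
def E3 (P Q : U × V → ℝ) (Γ : X → Y × Z → ℝ) (x₁ : X) : ℝ≥0∞ :=
  (⨅ π ∈ {π : U × V → ℝ | π ∈ stdSimplex ℝ (U × V) ∧
    sndMarg π = sndMarg P ∧ fstMarg π ∈ barP P Γ x₁}, klDiv π Q) +
  klDiv (chanY Γ 0) (chanY Γ x₁)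

/-- Some nonzero input `x̂` cannot produce an output `y*` that the input `0` can produce. -/
def PartiallyConnected (Γ : X → Y × Z → ℝ) : Prop :=
  ∃ x : X, x ≠ 0 ∧ ∃ y : Y, 0 < chanY Γ 0 y ∧ chanY Γ x y = 0

end Model

end CovertDHT

end

/-! The sensor and the decision center can only cooperate through the channel, and covertness
leaves almost nothing of it: since `d_n → 0`, the expected empirical law at the warden is close to
`Γ_{Z|X}(·|0)`, and as no mixture of the nonzero inputs simulates the input `0`, the input word has a
vanishing fraction of nonzero symbols with high probability (`abs_avgType_output_sub_le`,
`exists_concentration`). There are only `exp (o(n))` such words.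

*Upper bound.* Given the key, the input word and the output word, the null hypothesis is accepted on
a rectangle `S × T` of source words. As there are few input words, the rectangles of probability at
least `exp (-o(n))` under `P^n` carry most of the acceptance probability (`guessProb_zero_le`), and
what is needed is the zero-rate converse `exists_rect_converse`: such a rectangle has probability at
least `exp (-n (E₁ + o(1)))` under `Q^n`. No positivity of `Q` is available for a blowing-up
argument, which would leave the support. Instead, the rectangle is shown to be likely under every
coupling `π` of the marginals of `P`. Two laws with equal marginals arise from the same tokens, the
letters of `V` being permuted by some `σ` in one of them (`exchangeable_of_marginals`). The matrix
`I - S` of a cyclic shift has rank `L - 1` although its diagonal is full, and its tensor powers show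
that a dense set contains many pairs of words that differ by an application of `σ` at a random set
of positions of positive density (`sq_card_le_zero_one_pairs`, `exists_rotation`). If both words of
such a pair lie in the preimage of `S × T`, then so does the word that has the `U`-letters of the
first and the `V`-letters of the second, because `S × T` is a rectangle. This moves the law a fixed
proportion of the way from `P` to `π` at the cost of a constant factor in the exponent
(`exists_mix_step`), and finitely many iterations lead arbitrarily close to `π` (`exists_mix_near`).
A change of measure from `π` to `Q` finishes the argument.

*Lower bound.* The code `twoWordCode` sends the constant word of the symbol `x₁` as an alarm if the
source word looks unusual, and the zero word otherwise. The divergence at the warden is at most the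
probability of the alarm times a linear term (`wardenDiv_twoWordCode_le`). If `x₁` excludes an output
`y` that the input `0` produces, then every occurrence of `y` refutes the alarm, and an alarm on
every source word outside of a slowly shrinking neighbourhood of `P_U` yields `E₁`
(`exists_achieves_E1`). Otherwise the alarm is given on the types in `barP`, whose divergence
from `P_U` is bounded away from zero, and the two ways to miss the alternative have the exponents
`E₂` and `E₃` (`exists_achieves_min_E2_E3`). The exponents come from the method of types, and from semicontinuity
of the divergence on the simplex. -/

namespace CovertDHT

/-! ### Product measures -/

section Mean

variable {A B : Type*} [Fintype A] [Fintype B] {n : ℕ}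

/-- The expectation of `h` under the `n`-fold product of the weight function `p`. -/
noncomputable def mean (p : A → ℝ) (h : (Fin n → A) → ℝ) : ℝ := ∑ w, (∏ i, p (w i)) * h w

/-- The probability of `S` under the `n`-fold product of the weight function `p`. -/
noncomputable def prob (p : A → ℝ) (S : Set (Fin n → A)) : ℝ := mean p (S.indicator 1)

lemma mean_mono {p : A → ℝ} (hp : ∀ a, 0 ≤ p a) {h h' : (Fin n → A) → ℝ}
    (hh : ∀ w, h w ≤ h' w) : mean p h ≤ mean p h' :=
  Finset.sum_le_sum fun w _ =>
    mul_le_mul_of_nonneg_left (hh w) (Finset.prod_nonneg fun _ _ => hp _)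

lemma mean_nonneg {p : A → ℝ} (hp : ∀ a, 0 ≤ p a) {h : (Fin n → A) → ℝ}
    (hh : ∀ w, 0 ≤ h w) : 0 ≤ mean p h :=
  Finset.sum_nonneg fun w _ => mul_nonneg (Finset.prod_nonneg fun _ _ => hp _) (hh w)

lemma sum_prod_pow (p : A → ℝ) : ∑ w : Fin n → A, ∏ i, p (w i) = (∑ a, p a) ^ n := by
  classical
  rw [← Fintype.piFinset_univ, ← Finset.prod_univ_sum]
  simp

lemma sum_prod_eq_one {p : A → ℝ} (hp : ∑ a, p a = 1) :
    ∑ w : Fin n → A, ∏ i, p (w i) = 1 := by rw [sum_prod_pow, hp, one_pow]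

lemma mean_const {p : A → ℝ} (hp : ∑ a, p a = 1) (c : ℝ) :
    mean p (fun _ : Fin n → A => c) = c := by
  rw [mean, ← Finset.sum_mul, sum_prod_eq_one hp, one_mul]

lemma mean_add (p : A → ℝ) (h h' : (Fin n → A) → ℝ) :
    mean p (fun w => h w + h' w) = mean p h + mean p h' := by
  simp only [mean, mul_add, Finset.sum_add_distrib]

lemma mean_mul_left (p : A → ℝ) (c : ℝ) (h : (Fin n → A) → ℝ) :
    mean p (fun w => c * h w) = c * mean p h := by
  simp only [mean, Finset.mul_sum]
  exact Finset.sum_congr rfl fun w _ => by ring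

lemma mean_sum {ι : Type*} (s : Finset ι) (p : A → ℝ) (h : ι → (Fin n → A) → ℝ) :
    mean p (fun w => ∑ j ∈ s, h j w) = ∑ j ∈ s, mean p (h j) := by
  simp only [mean, Finset.mul_sum]
  exact Finset.sum_comm

lemma prob_nonneg {p : A → ℝ} (hp : ∀ a, 0 ≤ p a) (S : Set (Fin n → A)) : 0 ≤ prob p S :=
  mean_nonneg hp fun _ => Set.indicator_nonneg (fun _ _ => zero_le_one) _

lemma prob_mono {p : A → ℝ} (hp : ∀ a, 0 ≤ p a) {S T : Set (Fin n → A)} (h : S ⊆ T) :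
    prob p S ≤ prob p T :=
  mean_mono hp fun _ => Set.indicator_le_indicator_of_subset h (fun _ => zero_le_one) _

lemma prob_univ {p : A → ℝ} (hp : ∑ a, p a = 1) : prob p (Set.univ : Set (Fin n → A)) = 1 := by
  rw [prob, Set.indicator_univ]
  exact mean_const hp 1

lemma prob_le_one {p : A → ℝ} (hp : p ∈ stdSimplex ℝ A) (S : Set (Fin n → A)) :
    prob p S ≤ 1 :=
  (prob_mono hp.1 (Set.subset_univ S)).trans (prob_univ hp.2).le

/-- The image of a product law under a map acting letter by letter is a product law. -/
lemma mean_map [DecidableEq B] (F : A → B) (p : A → ℝ) (h : (Fin n → B) → ℝ) :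
    mean p (fun w => h (F ∘ w)) = mean (fun b => ∑ a, if F a = b then p a else 0) h := by
  classical
  have key : ∀ b : Fin n → B, ∏ i, (∑ a, if F a = b i then p a else 0)
      = ∑ w : Fin n → A, if F ∘ w = b then ∏ i, p (w i) else 0 := by
    intro b
    rw [Finset.prod_univ_sum, Fintype.piFinset_univ]
    refine Finset.sum_congr rfl fun w _ => ?_
    rw [Finset.prod_ite_zero]
    simp [funext_iff]
  simp only [mean, key, Finset.sum_mul]
  rw [Finset.sum_comm]
  refine Finset.sum_congr rfl fun w _ => ?_
  simp

lemma sum_pair (F : (Fin n → A) → (Fin n → B) → ℝ) :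
    ∑ u, ∑ v, F u v = ∑ w : Fin n → A × B, F (fun i => (w i).1) (fun i => (w i).2) := by
  rw [← Fintype.sum_prod_type']
  exact (Fintype.sum_equiv (Equiv.arrowProdEquivProdArrow (Fin n) (fun _ => A) (fun _ => B))
    _ _ fun w => rfl).symm

lemma mean_fst (p : A × B → ℝ) (h : (Fin n → A) → ℝ) :
    mean p (fun w => h (fun i => (w i).1)) = mean (fstMarg p) h := by
  classical
  rw [show (fun w : Fin n → A × B => h (fun i => (w i).1)) = fun w => h (Prod.fst ∘ w) from rfl,
    mean_map]
  congr 1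
  funext a
  simp only [fstMarg, Fintype.sum_prod_type]
  rw [Finset.sum_eq_single a] <;> simp +contextual

lemma mean_snd (p : A × B → ℝ) (h : (Fin n → B) → ℝ) :
    mean p (fun w => h (fun i => (w i).2)) = mean (sndMarg p) h := by
  classical
  rw [show (fun w : Fin n → A × B => h (fun i => (w i).2)) = fun w => h (Prod.snd ∘ w) from rfl,
    mean_map]
  congr 1
  funext b
  simp only [sndMarg, Fintype.sum_prod_type]
  refine Finset.sum_congr rfl fun a _ => ?_
  rw [Finset.sum_eq_single b] <;> simp +contextual

lemma fstMarg_mem {p : A × B → ℝ} (hp : p ∈ stdSimplex ℝ (A × B)) :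
    fstMarg p ∈ stdSimplex ℝ A :=
  ⟨fun a => Finset.sum_nonneg fun b _ => hp.1 _, by
    rw [← hp.2, Fintype.sum_prod_type]; rfl⟩

lemma sndMarg_mem {p : A × B → ℝ} (hp : p ∈ stdSimplex ℝ (A × B)) :
    sndMarg p ∈ stdSimplex ℝ B :=
  ⟨fun a => Finset.sum_nonneg fun b _ => hp.1 _, by
    rw [← hp.2, Fintype.sum_prod_type_right]; rfl⟩

/-- Pointwise domination of one-letter weights passes to product weights at exponential cost. -/
lemma mean_le_of_le_mul {p q : A → ℝ} {c : ℝ} (hp : ∀ a, 0 ≤ p a) (hpq : ∀ a, p a ≤ c * q a)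
    {h : (Fin n → A) → ℝ} (hh : ∀ w, 0 ≤ h w) : mean p h ≤ c ^ n * mean q h := by
  rw [mean, mean, Finset.mul_sum]
  refine Finset.sum_le_sum fun w _ => ?_
  rw [← mul_assoc]
  refine mul_le_mul_of_nonneg_right ?_ (hh w)
  calc ∏ i, p (w i) ≤ ∏ i, c * q (w i) := Finset.prod_le_prod (fun i _ => hp _) fun i _ => hpq _
    _ = c ^ n * ∏ i, q (w i) := by simp [Finset.prod_mul_distrib]

end Mean

/-! ### Weights with equal marginals as permuted tokens -/

section Exchange

variable {A : Type*}

lemma exists_mem_periodicPts [Finite A] [Nonempty A] (F : A → A) :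
    ∃ x, x ∈ Function.periodicPts F := by
  obtain ⟨x⟩ := ‹Nonempty A›
  obtain ⟨i, j, hij, h⟩ := Finite.exists_ne_map_eq_of_infinite fun k : ℕ => F^[k] x
  wlog hlt : i < j generalizing i j
  · exact this j i hij.symm h.symm (lt_of_le_of_ne (not_lt.mp hlt) hij.symm)
  refine ⟨F^[i] x, Function.mk_mem_periodicPts (n := j - i) (by omega) ?_⟩
  change F^[j - i] (F^[i] x) = F^[i] x
  rw [← Function.iterate_add_apply, Nat.sub_add_cancel hlt.le]
  exact h.symm

lemma exists_pos_of_sum_pos {ι : Type*} [Fintype ι] {f : ι → ℝ} (h : 0 < ∑ i, f i) :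
    ∃ i, 0 < f i := by
  by_contra! hc
  exact absurd h (not_lt.mpr (Finset.sum_nonpos fun i _ => hc i))

/-- The weight that `ν` induces on pairs of letters. -/
noncomputable def pairLaw {E U V : Type*} [Fintype E] (ν : E → ℝ) (φ : E → U) (ψ : E → V)
    (w : U × V) : ℝ := open Classical in ∑ e, if (φ e, ψ e) = w then ν e else 0

/-- Two weights `a` and `b` on `U × V` are *exchangeable* if there are finitely many tokens, each
carrying a letter of `U`, a letter of `V` and a weight, such that the tokens themselves produce `a`,
and `b` is produced when the letters of `V` are permuted among tokens of equal weight. -/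
def Exchangeable {U : Type*} {V : Type*} (a b : U × V → ℝ) : Prop :=
  ∃ (k : ℕ) (ν : Fin k → ℝ) (φ : Fin k → U) (ψ : Fin k → V) (σ : Equiv.Perm (Fin k)),
    (∀ e, 0 ≤ ν e) ∧ (∀ e, ν (σ e) = ν e) ∧ a = pairLaw ν φ ψ ∧
      b = pairLaw ν φ (fun e => ψ (σ e))

variable {E U V : Type*} [Fintype E]

lemma pairLaw_equiv {E' : Type*} [Fintype E'] (θ : E' ≃ E) (ν : E → ℝ) (φ : E → U) (ψ : E → V) :
    pairLaw (ν ∘ θ) (φ ∘ θ) (ψ ∘ θ) = pairLaw ν φ ψ := by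
  classical
  funext w
  exact Fintype.sum_equiv θ _ _ fun e => rfl

lemma exchangeable_pairLaw (ν : E → ℝ) (φ : E → U) (ψ : E → V) (σ : Equiv.Perm E)
    (h0 : ∀ e, 0 ≤ ν e) (hσ : ∀ e, ν (σ e) = ν e) :
    Exchangeable (pairLaw ν φ ψ) (pairLaw ν φ (fun e => ψ (σ e))) := by
  let θ := (Fintype.equivFin E).symm
  refine ⟨Fintype.card E, ν ∘ θ, φ ∘ θ, ψ ∘ θ, (θ.trans σ).trans θ.symm, fun e => h0 _,
    fun e => by simp [hσ], (pairLaw_equiv θ ν φ ψ).symm, ?_⟩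
  rw [← pairLaw_equiv θ ν φ]
  congr 1
  funext e
  simp

lemma Exchangeable.add {a b a' b' : U × V → ℝ} (h : Exchangeable a b) (h' : Exchangeable a' b') :
    Exchangeable (a + a') (b + b') := by
  classical
  obtain ⟨k, ν, φ, ψ, σ, h0, hσ, rfl, rfl⟩ := h
  obtain ⟨k', ν', φ', ψ', σ', h0', hσ', rfl, rfl⟩ := h'
  have := exchangeable_pairLaw (Sum.elim ν ν') (Sum.elim φ φ') (Sum.elim ψ ψ')
    (Equiv.sumCongr σ σ') (by rintro (e | e) <;> simp [h0, h0'])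
    (by rintro (e | e) <;> simp [hσ, hσ'])
  convert this using 1
  · funext w
    simp [pairLaw, Fintype.sum_sum_type]
    congr!
  · funext w
    simp [pairLaw, Fintype.sum_sum_type]
    congr!

/-- If the letters of `U` are distinct, tokens of weight `c` can be taken out of a weight `a` that
is at least `c` at each of them. -/
lemma pairLaw_const_le {a : U × V → ℝ} (h0 : ∀ w, 0 ≤ a w) {c : ℝ} {φ : E → U} {ψ : E → V}
    (hφ : Function.Injective φ) (hc : ∀ e, c ≤ a (φ e, ψ e)) (w : U × V) :
    pairLaw (fun _ => c) φ ψ w ≤ a w := by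
  classical
  by_cases h : ∃ e, (φ e, ψ e) = w
  · obtain ⟨e, rfl⟩ := h
    rw [pairLaw, Finset.sum_eq_single e]
    · simpa using hc e
    · intro e' _ hne
      rw [if_neg]
      intro h
      exact hne (hφ (Prod.ext_iff.mp h).1)
    · simp
  · push Not at h
    simpa [pairLaw, h] using h0 w

lemma pairLaw_const_apply {c : ℝ} {φ : E → U} {ψ : E → V} (hφ : Function.Injective φ) (e : E) :
    pairLaw (fun _ => c) φ ψ (φ e, ψ e) = c := by
  classical
  rw [pairLaw, Finset.sum_eq_single e]
  · simp
  · intro e' _ hne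
    rw [if_neg]
    intro h
    exact hne (hφ (Prod.ext_iff.mp h).1)
  · simp

lemma pairLaw_const_nonneg {c : ℝ} (hc : 0 ≤ c) (φ : E → U) (ψ : E → V) (w : U × V) :
    0 ≤ pairLaw (fun _ => c) φ ψ w := by
  classical
  exact Finset.sum_nonneg fun e _ => by split_ifs <;> simp [hc]

lemma fstMarg_pairLaw [Fintype V] [DecidableEq U] (ν : E → ℝ) (φ : E → U) (ψ : E → V) (u : U) :
    fstMarg (pairLaw ν φ ψ) u = ∑ e, if φ e = u then ν e else 0 := by
  classical
  simp only [fstMarg, pairLaw]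
  rw [Finset.sum_comm]
  refine Finset.sum_congr rfl fun e _ => ?_
  by_cases h : φ e = u <;> simp [h, Prod.ext_iff]

lemma sndMarg_pairLaw [Fintype U] [DecidableEq V] (ν : E → ℝ) (φ : E → U) (ψ : E → V) (v : V) :
    sndMarg (pairLaw ν φ ψ) v = ∑ e, if ψ e = v then ν e else 0 := by
  classical
  simp only [sndMarg, pairLaw]
  rw [Finset.sum_comm]
  refine Finset.sum_congr rfl fun e _ => ?_
  by_cases h : ψ e = v <;> simp [h, Prod.ext_iff]

lemma sndMarg_pairLaw_perm [Fintype U] (ν : E → ℝ) (φ : E → U) (ψ : E → V) (σ : Equiv.Perm E)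
    (hσ : ∀ e, ν (σ e) = ν e) :
    sndMarg (pairLaw ν φ (fun e => ψ (σ e))) = sndMarg (pairLaw ν φ ψ) := by
  classical
  funext v
  rw [sndMarg_pairLaw, sndMarg_pairLaw]
  exact Fintype.sum_equiv σ _ _ fun e => by rw [hσ]

/-- Weights with equal marginals are exchangeable. Walking from `u` to a letter `v` with
`a (u, v) > 0` and on to a letter `u'` with `b (u', v) > 0` is possible for ever, hence has cycles;
rotating along the cycles removes a point of the support of `a` or `b`. -/
theorem exchangeable_of_marginals [Fintype U] [Fintype V] (a b : U × V → ℝ)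
    (ha : ∀ w, 0 ≤ a w) (hb : ∀ w, 0 ≤ b w) (h1 : fstMarg a = fstMarg b)
    (h2 : sndMarg a = sndMarg b) : Exchangeable a b := by
  classical
  generalize hN : (Finset.univ.filter fun w => a w ≠ 0).card +
    (Finset.univ.filter fun w => b w ≠ 0).card = N
  induction N using Nat.strong_induction_on generalizing a b with
  | _ N ih =>
  by_cases hS : ∃ u, 0 < fstMarg a u
  swap
  · have hz : ∀ a : U × V → ℝ, (∀ w, 0 ≤ a w) → (¬ ∃ u, 0 < fstMarg a u) → a = 0 := by
      intro a ha h
      push Not at h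
      funext ⟨u, v⟩
      have : fstMarg a u = 0 := le_antisymm (h u) (Finset.sum_nonneg fun v _ => ha _)
      exact (Finset.sum_eq_zero_iff_of_nonneg fun v _ => ha _).mp this v (Finset.mem_univ v)
    rw [hz a ha hS, hz b hb (h1 ▸ hS)]
    have := exchangeable_pairLaw (E := Empty) (U := U) (V := V) (fun _ => 0) Empty.elim
      Empty.elim (Equiv.refl _) (fun _ => le_rfl) (fun _ => rfl)
    convert this using 1 <;> · funext w; simp [pairLaw]
  let S := {u : U // 0 < fstMarg a u}
  have : Nonempty S := nonempty_subtype.mpr hS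
  have hstep : ∀ u : S, ∃ (v : V) (u' : S), 0 < a (u.1, v) ∧ 0 < b (u'.1, v) := by
    rintro ⟨u, hu⟩
    obtain ⟨v, hv⟩ := exists_pos_of_sum_pos hu
    have hv' : 0 < sndMarg b v := by
      rw [← h2]
      exact lt_of_lt_of_le hv (Finset.single_le_sum (f := fun u => a (u, v))
        (fun u _ => ha _) (Finset.mem_univ u))
    obtain ⟨u', hu'⟩ := exists_pos_of_sum_pos hv'
    refine ⟨v, ⟨u', ?_⟩, hv, hu'⟩
    rw [h1]
    exact lt_of_lt_of_le hu' (Finset.single_le_sum (f := fun v => b (u', v))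
        (fun u _ => hb _) (Finset.mem_univ v))
  choose v F hav hbF using hstep
  -- the tokens are the periodic points, on which the walk `F` is a permutation
  let R := Function.periodicPts F
  let τ : R ≃ R := Set.BijOn.equiv F (Function.bijOn_periodicPts F)
  have hτ : ∀ e : R, ((τ e : R) : S) = F e := fun e => rfl
  let φ : R → U := fun e => e.1.1
  let ψ : R → V := fun e => v e.1
  let σ : Equiv.Perm R := τ.symm
  have hφ : Function.Injective φ := fun e e' h => Subtype.ext (Subtype.ext h)
  have hRne : Nonempty R := by
    obtain ⟨x, hx⟩ := exists_mem_periodicPts F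
    exact ⟨⟨x, hx⟩⟩
  have hbσ : ∀ e : R, 0 < b (φ e, ψ (σ e)) := by
    intro e
    have := hbF (σ e).1
    rwa [← hτ (σ e), Equiv.apply_symm_apply] at this
  obtain ⟨e0, -, he0⟩ := Finset.exists_min_image Finset.univ
    (fun e : R => min (a (φ e, ψ e)) (b (φ e, ψ (σ e)))) Finset.univ_nonempty
  -- with this weight, one of the supports loses a point when the tokens are taken out
  set c := min (a (φ e0, ψ e0)) (b (φ e0, ψ (σ e0))) with hc
  have hcpos : 0 < c := lt_min (hav _) (hbσ _)
  have hca : ∀ e, c ≤ a (φ e, ψ e) := fun e => (he0 e (Finset.mem_univ e)).trans (min_le_left _ _)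
  have hcb : ∀ e, c ≤ b (φ e, ψ (σ e)) :=
    fun e => (he0 e (Finset.mem_univ e)).trans (min_le_right _ _)
  set pa := pairLaw (fun _ => c) φ ψ with hpa
  set pb := pairLaw (fun _ => c) φ (fun e => ψ (σ e)) with hpb
  have hale := pairLaw_const_le ha hφ hca
  have hble := pairLaw_const_le (ψ := fun e => ψ (σ e)) hb hφ hcb
  have hsub : ∀ (a p : U × V → ℝ), (∀ w, 0 ≤ p w) → (∀ w, p w ≤ a w) →
      (Finset.univ.filter fun w => (a - p) w ≠ 0) ⊆ (Finset.univ.filter fun w => a w ≠ 0) := by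
    intro a p hp hle w hw
    simp only [Finset.mem_filter, Finset.mem_univ, true_and, Pi.sub_apply] at hw ⊢
    intro h
    have h1 := hle w
    have h2 := hp w
    exact hw (by linarith)
  have hsa := hsub a pa (pairLaw_const_nonneg hcpos.le _ _) hale
  have hsb := hsub b pb (pairLaw_const_nonneg hcpos.le _ _) hble
  have hlt : (Finset.univ.filter fun w => (a - pa) w ≠ 0).card +
      (Finset.univ.filter fun w => (b - pb) w ≠ 0).card < N := by
    rw [← hN]
    rcases min_choice (a (φ e0, ψ e0)) (b (φ e0, ψ (σ e0))) with h | h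
    · refine add_lt_add_of_lt_of_le (Finset.card_lt_card ⟨hsa, fun hh => ?_⟩)
        (Finset.card_le_card hsb)
      have := @hh (φ e0, ψ e0) (Finset.mem_filter.mpr ⟨Finset.mem_univ _, (hav _).ne'⟩)
      simp only [Finset.mem_filter, Pi.sub_apply] at this
      apply this.2
      rw [hpa, pairLaw_const_apply hφ, hc, h, sub_self]
    · refine add_lt_add_of_le_of_lt (Finset.card_le_card hsa)
        (Finset.card_lt_card ⟨hsb, fun hh => ?_⟩)
      have := @hh (φ e0, ψ (σ e0)) (Finset.mem_filter.mpr ⟨Finset.mem_univ _, (hbσ _).ne'⟩)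
      simp only [Finset.mem_filter, Pi.sub_apply] at this
      apply this.2
      rw [hpb, pairLaw_const_apply (ψ := fun e => ψ (σ e)) hφ, hc, h, sub_self]
  have hm1 : fstMarg (a - pa) = fstMarg (b - pb) := by
    funext u
    have hp : fstMarg pa u = fstMarg pb u := by rw [hpa, hpb, fstMarg_pairLaw, fstMarg_pairLaw]
    have := congrFun h1 u
    simp only [fstMarg, Pi.sub_apply, Finset.sum_sub_distrib] at *
    rw [this, hp]
  have hm2 : sndMarg (a - pa) = sndMarg (b - pb) := by
    funext u
    have hp : sndMarg pa u = sndMarg pb u := by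
      rw [hpa, hpb, sndMarg_pairLaw_perm _ _ _ _ fun _ => rfl]
    have := congrFun h2 u
    simp only [sndMarg, Pi.sub_apply, Finset.sum_sub_distrib] at *
    rw [this, hp]
  have := (ih _ hlt (a - pa) (b - pb) (fun w => sub_nonneg.mpr (hale w))
    (fun w => sub_nonneg.mpr (hble w)) hm1 hm2 rfl).add
    (exchangeable_pairLaw (fun _ : R => c) φ ψ σ (fun _ => hcpos.le) fun _ => rfl)
  rwa [← hpa, ← hpb, sub_add_cancel, sub_add_cancel] at this

end Exchange

/-! ### The tensor rank of a cyclic shift -/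

section Rank

/-- `(tr X)² ≤ rank X · ‖X‖_F²`, with `X` given by its columns and the rank replaced by the dimension
of a subspace that contains the columns. -/
lemma sq_trace_le {ι : Type*} [Fintype ι] (X : ι → EuclideanSpace ℝ ι)
    (R : Submodule ℝ (EuclideanSpace ℝ ι)) (hX : ∀ z, X z ∈ R) :
    (∑ z, X z z) ^ 2 ≤ Module.finrank ℝ R * ∑ z, ∑ z', (X z z') ^ 2 := by
  let b := stdOrthonormalBasis ℝ R
  let x : ι → R := fun z => ⟨X z, hX z⟩
  have hrepr : ∀ z, X z z = ∑ j, inner ℝ (b j) (x z) * (b j : EuclideanSpace ℝ ι) z := by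
    intro z
    have h := congrArg (Subtype.val) (b.sum_repr' (x z))
    have h2 := congrArg (fun v : EuclideanSpace ℝ ι => v z) h
    simp only [Submodule.coe_sum, Submodule.coe_smul] at h2
    rw [WithLp.ofLp_sum, Finset.sum_apply] at h2
    rw [show X z z = (x z : EuclideanSpace ℝ ι) z from rfl, ← h2]
    exact Finset.sum_congr rfl fun j _ => by simp
  have hb : ∀ j, ∑ z, ((b j : EuclideanSpace ℝ ι) z) ^ 2 = 1 := by
    intro j
    have h1 : ‖(b j : EuclideanSpace ℝ ι)‖ = 1 := by
      rw [Submodule.norm_coe]; exact b.orthonormal.1 j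
    have h2 := EuclideanSpace.real_norm_sq_eq (b j : EuclideanSpace ℝ ι)
    rw [← h2, h1, one_pow]
  have hx : ∀ z, ∑ j, (inner ℝ (b j) (x z)) ^ 2 = ∑ z', (X z z') ^ 2 := by
    intro z
    have h1 := b.sum_sq_norm_inner_right (x z)
    simp only [Real.norm_eq_abs, sq_abs] at h1
    rw [h1, ← Submodule.norm_coe, EuclideanSpace.real_norm_sq_eq]
  calc (∑ z, X z z) ^ 2
      = (∑ p : ι × Fin (Module.finrank ℝ R),
          inner ℝ (b p.2) (x p.1) * (b p.2 : EuclideanSpace ℝ ι) p.1) ^ 2 := by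
        rw [Fintype.sum_prod_type]; simp only [hrepr]
    _ ≤ (∑ p : ι × Fin (Module.finrank ℝ R), (inner ℝ (b p.2) (x p.1)) ^ 2) *
          ∑ p : ι × Fin (Module.finrank ℝ R), ((b p.2 : EuclideanSpace ℝ ι) p.1) ^ 2 :=
        Finset.sum_mul_sq_le_sq_mul_sq _ _ _
    _ = _ := by
        rw [Fintype.sum_prod_type, Fintype.sum_prod_type_right]
        simp only [hx, hb]
        simp [mul_comm]

variable {L : ℕ}

/-- The matrix `I - S` of the cyclic shift `S` on `ZMod L`. -/
def shiftMatrix (L : ℕ) (z z' : ZMod L) : ℝ :=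
  (if z' = z then 1 else 0) - (if z' = z + 1 then 1 else 0)

lemma shiftMatrix_factor [NeZero L] (z z' : ZMod L) :
    shiftMatrix L z z' = ∑ k : {k : ZMod L // k ≠ 0},
      shiftMatrix L z k * ((if z' = k then 1 else 0) - (if z' = 0 then 1 else 0)) := by
  have h0 : ∑ k, shiftMatrix L z k = 0 := by
    simp [shiftMatrix]
  have h1 : ∑ k : {k : ZMod L // k ≠ 0}, shiftMatrix L z k = - shiftMatrix L z 0 := by
    rw [← Fintype.sum_subtype_add_sum_subtype (fun k : ZMod L => k ≠ 0)] at h0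
    have : ∑ k : {k : ZMod L // ¬ k ≠ 0}, shiftMatrix L z k = shiftMatrix L z 0 := by
      rw [Fintype.sum_eq_single ⟨0, by simp⟩]
      rintro ⟨k, hk⟩ hne
      exact absurd (Subtype.ext (not_not.mp hk)) hne
    linarith
  simp only [mul_sub, Finset.sum_sub_distrib, ← Finset.sum_mul, h1]
  by_cases hz : z' = 0
  · subst hz
    have : ∀ k : {k : ZMod L // k ≠ 0}, (0 : ZMod L) ≠ k := fun k h => k.2 h.symm
    simp [this]
  · rw [Fintype.sum_eq_single (⟨z', hz⟩ : {k : ZMod L // k ≠ 0})]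
    · simp [hz]
    · rintro ⟨k, hk⟩ hne
      have : z' ≠ k := fun h => hne (Subtype.ext h.symm)
      simp [this]

/-- A dense subset of a cyclic group power contains many pairs that differ by a `0`-`1`-vector: the
matrix `I - S` has ones on the diagonal, is supported on `S^0 + S^1`, and has rank `L - 1`, so that
its tensor power, restricted to the set, has large trace and small rank. -/
theorem sq_card_le_zero_one_pairs (hL : 2 ≤ L) [NeZero L] {m : ℕ} (f : (Fin m → ZMod L) → ℝ)
    (hf : ∀ z, f z = 0 ∨ f z = 1) :
    (∑ z, f z) ^ 2 ≤ ((L : ℝ) - 1) ^ m *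
      ∑ z, ∑ w : Fin m → Bool, f z * f (fun i => z i + if w i then 1 else 0) := by
  classical
  have hL1 : (1 : ZMod L) ≠ 0 := by
    have : Fact (1 < L) := ⟨hL⟩
    exact one_ne_zero
  -- the rows of `I - S` sum to zero, so that the columns of nonzero index span its range
  let K := {k : ZMod L // k ≠ 0}
  let X : (Fin m → ZMod L) → EuclideanSpace ℝ (Fin m → ZMod L) := fun z' =>
    WithLp.toLp 2 fun z => f z * f z' * ∏ i, shiftMatrix L (z i) (z' i)
  let g : (Fin m → K) → EuclideanSpace ℝ (Fin m → ZMod L) := fun κ =>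
    WithLp.toLp 2 fun z => f z * ∏ i, shiftMatrix L (z i) (κ i)
  have hff : ∀ z, f z * f z = f z := fun z => by rcases hf z with h | h <;> simp [h]
  have hmem : ∀ z', X z' ∈ Submodule.span ℝ (Set.range g) := by
    intro z'
    have : X z' = ∑ κ : Fin m → K, (f z' * ∏ i, ((if z' i = κ i then 1 else 0) -
        (if z' i = 0 then 1 else 0))) • g κ := by
      ext z
      rw [WithLp.ofLp_sum, Finset.sum_apply]
      simp only [X, g, WithLp.ofLp_smul, Pi.smul_apply, smul_eq_mul]
      simp_rw [shiftMatrix_factor (z _) (z' _)]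
      rw [Finset.prod_univ_sum, Fintype.piFinset_univ, Finset.mul_sum]
      refine Finset.sum_congr rfl fun κ _ => ?_
      rw [Finset.prod_mul_distrib]
      ring
    rw [this]
    exact Submodule.sum_mem _ fun κ _ => Submodule.smul_mem _ _
      (Submodule.subset_span (Set.mem_range_self κ))
  have hrank : (Module.finrank ℝ (Submodule.span ℝ (Set.range g)) : ℝ) ≤ ((L : ℝ) - 1) ^ m := by
    have h1 : Module.finrank ℝ (Submodule.span ℝ (Set.range g)) ≤ Fintype.card (Fin m → K) :=
      finrank_range_le_card g
    have h2 : Fintype.card K = L - 1 := by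
      rw [Fintype.card_subtype_compl, ZMod.card]
      simp
    rw [Fintype.card_fun, Fintype.card_fin, h2] at h1
    calc (Module.finrank ℝ (Submodule.span ℝ (Set.range g)) : ℝ) ≤ ((L - 1) ^ m : ℕ) := by
          exact_mod_cast h1
      _ = _ := by rw [Nat.cast_pow, Nat.cast_sub (by omega), Nat.cast_one]
  have htr : ∑ z, X z z = ∑ z, f z := by
    refine Finset.sum_congr rfl fun z _ => ?_
    have : ∀ i, shiftMatrix L (z i) (z i) = 1 := fun i => by
      simp [shiftMatrix, hL1]
    simp [X, this, hff]
  have hsq : ∀ z z', shiftMatrix L z z' ^ 2 =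
      ∑ b : Bool, if z' = z + (if b then 1 else 0) then 1 else 0 := by
    intro z z'
    rw [Fintype.sum_bool, shiftMatrix]
    by_cases h1 : z' = z
    · subst h1; simp [hL1]
    · by_cases h2 : z' = z + 1 <;> simp [h1, h2, hL1]
  have hfrob : ∑ z', ∑ z, (X z' z) ^ 2 =
      ∑ z, ∑ w : Fin m → Bool, f z * f (fun i => z i + if w i then 1 else 0) := by
    rw [Finset.sum_comm]
    refine Finset.sum_congr rfl fun z _ => ?_
    have : ∀ z', (X z' z) ^ 2 = ∑ w : Fin m → Bool,
        if z' = (fun i => z i + if w i then 1 else 0) then f z * f z' else 0 := by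
      intro z'
      have e1 : (X z' z) ^ 2 = (f z * f z) * (f z' * f z') *
          ∏ i, shiftMatrix L (z i) (z' i) ^ 2 := by
        simp only [X, Finset.prod_pow]; ring
      rw [e1, hff, hff]
      simp only [hsq]
      rw [Finset.prod_univ_sum, Fintype.piFinset_univ, Finset.mul_sum]
      refine Finset.sum_congr rfl fun w _ => ?_
      rw [Finset.prod_ite_zero]
      simp [funext_iff]
    simp only [this]
    rw [Finset.sum_comm]
    refine Finset.sum_congr rfl fun w _ => ?_
    simp
  rw [← htr, ← hfrob]
  refine (sq_trace_le X _ hmem).trans ?_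
  exact mul_le_mul_of_nonneg_right hrank
    (Finset.sum_nonneg fun _ _ => Finset.sum_nonneg fun _ _ => sq_nonneg _)

end Rank

/-! ### Rotating a random set of positions -/

section Step

variable {Ω : Type*} [Fintype Ω] {n : ℕ}

lemma mean_perm {ν : Ω → ℝ} (τ : Fin n → Equiv.Perm Ω) (hτ : ∀ i a, ν (τ i a) = ν a)
    (h : (Fin n → Ω) → ℝ) : mean ν (fun e => h (fun i => τ i (e i))) = mean ν h := by
  refine Fintype.sum_equiv (Equiv.piCongrRight τ) _ _ fun e => ?_
  change (∏ i, ν (e i)) * h _ = (∏ i, ν (τ i (e i))) * h _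
  simp only [hτ]
  rfl

lemma sq_mean_le {ν : Ω → ℝ} (hν : ν ∈ stdSimplex ℝ Ω) (h : (Fin n → Ω) → ℝ) :
    mean ν h ^ 2 ≤ mean ν (fun e => h e ^ 2) := by
  set c := mean ν h with hc
  have h1 : 0 ≤ mean ν (fun e => (h e - c) ^ 2) := mean_nonneg hν.1 fun _ => sq_nonneg _
  have h2 : mean ν (fun e => (h e - c) ^ 2) = mean ν (fun e => h e ^ 2) - c ^ 2 := by
    have : (fun e => (h e - c) ^ 2) = fun e => (h e ^ 2 + (-2 * c) * h e) + c ^ 2 := by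
      funext e; ring
    rw [this, mean_add (h := fun e => h e ^ 2 + (-2 * c) * h e), mean_add, mean_mul_left,
      mean_const hν.2, ← hc]
    ring
  linarith

/-- Apply `σ` to the letters at the positions marked by `w`. -/
def rotate (σ : Equiv.Perm Ω) (w : Fin n → Bool) (e : Fin n → Ω) : Fin n → Ω :=
  fun i => if w i then σ (e i) else e i

/-- The weights of a Bernoulli law. -/
def ber (q : ℝ) (b : Bool) : ℝ := if b then q else 1 - q

lemma ber_mem {q : ℝ} (h0 : 0 ≤ q) (h1 : q ≤ 1) : ber q ∈ stdSimplex ℝ Bool :=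
  ⟨fun b => by cases b <;> simp [ber, h0, h1], by simp [ber]⟩

/-- The number of ones of a `0`-`1`-vector. -/
def ones {m : ℕ} (w : Fin m → Bool) : ℝ := ∑ j, if w j then 1 else 0

lemma ones_nonneg {m : ℕ} (w : Fin m → Bool) : 0 ≤ ones w :=
  Finset.sum_nonneg fun j _ => by split_ifs <;> simp

lemma ones_le {m : ℕ} (w : Fin m → Bool) : ones w ≤ m := by
  calc ones w ≤ ∑ j : Fin m, (1 : ℝ) := Finset.sum_le_sum fun j _ => by split_ifs <;> simp
    _ = m := by simp

/-- Averaging the inequality for cyclic group powers over the embeddings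
`z ↦ (i ↦ σ ^ z (b i) (e i))` of `(ZMod L) ^ m`, for a fixed block map `b`. -/
lemma sq_mean_le_rotate {ν : Ω → ℝ} (hν : ν ∈ stdSimplex ℝ Ω) (σ : Equiv.Perm Ω)
    (hσ : ∀ a, ν (σ a) = ν a) {L : ℕ} (hL : 2 ≤ L) (hσL : σ ^ L = 1)
    {f : (Fin n → Ω) → ℝ} (hf : ∀ e, f e = 0 ∨ f e = 1) {m : ℕ} (b : Fin n → Fin m) :
    mean ν f ^ 2 * (L : ℝ) ^ m ≤ ((L : ℝ) - 1) ^ m *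
      ∑ w : Fin m → Bool, mean ν (fun e => f e * f (rotate σ (w ∘ b) e)) := by
  have : NeZero L := ⟨by omega⟩
  have hpow : ∀ (k : ℕ) a, ν ((σ ^ k) a) = ν a := by
    intro k
    induction k with
    | zero => simp
    | succ k ih => intro a; rw [pow_succ', Equiv.Perm.mul_apply, hσ, ih]
  let act : (Fin m → ZMod L) → (Fin n → Ω) → (Fin n → Ω) :=
    fun z e i => (σ ^ (z (b i)).val) (e i)
  have hact : ∀ z (h : (Fin n → Ω) → ℝ), mean ν (fun e => h (act z e)) = mean ν h :=
    fun z h => mean_perm (fun i => σ ^ (z (b i)).val) (fun i a => hpow _ a) h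
  have hadd : ∀ z (w : Fin m → Bool) e,
      act (fun i => z i + if w i then 1 else 0) e = rotate σ (w ∘ b) (act z e) := by
    intro z w e
    funext i
    simp only [act, rotate, Function.comp]
    split_ifs with hw
    · rw [← Equiv.Perm.mul_apply, ← pow_succ', ZMod.val_add]
      congr 1
      rw [pow_eq_pow_mod _ hσL, ZMod.val_one'', Nat.mod_mod, ← pow_eq_pow_mod _ hσL]
      omega
    · simp
  have hLpos : (0 : ℝ) < (L : ℝ) ^ m := by
    have : (0 : ℝ) < L := by exact_mod_cast (by omega : 0 < L)
    positivity
  have h1 : (mean ν f * (L : ℝ) ^ m) ^ 2 ≤ ((L : ℝ) - 1) ^ m * ((L : ℝ) ^ m *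
      ∑ w : Fin m → Bool, mean ν (fun e => f e * f (rotate σ (w ∘ b) e))) := by
    calc (mean ν f * (L : ℝ) ^ m) ^ 2
        = (mean ν fun e => ∑ z, f (act z e)) ^ 2 := by
          rw [mean_sum]
          simp only [hact]
          simp [mul_comm, ZMod.card]
      _ ≤ mean ν fun e => (∑ z, f (act z e)) ^ 2 := sq_mean_le hν _
      _ ≤ mean ν fun e => ((L : ℝ) - 1) ^ m * ∑ z, ∑ w : Fin m → Bool,
            f (act z e) * f (rotate σ (w ∘ b) (act z e)) := by
          refine mean_mono hν.1 fun e => ?_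
          have := sq_card_le_zero_one_pairs hL (fun z => f (act z e)) (fun z => hf _)
          simpa only [hadd] using this
      _ = _ := by
          rw [mean_mul_left, mean_sum]
          congr 1
          simp only [mean_sum]
          rw [Finset.sum_comm, Finset.mul_sum]
          refine Finset.sum_congr rfl fun w _ => ?_
          rw [Finset.sum_congr rfl fun z _ => hact z fun e => f e * f (rotate σ (w ∘ b) e)]
          simp [ZMod.card]
  refine le_of_mul_le_mul_right ?_ hLpos
  calc _ = (mean ν f * (L : ℝ) ^ m) ^ 2 := by ring
    _ ≤ _ := h1
    _ = _ := by ring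

/-- Averaging over uniformly random block maps turns a pattern of the blocks into independent
Bernoulli marks of the positions. -/
lemma mean_block {m : ℕ} (hm : 0 < m) (w : Fin m → Bool) (H : (Fin n → Bool) → ℝ) :
    mean (fun _ : Fin m => 1 / (m : ℝ)) (fun b => H (w ∘ b)) = mean (ber (ones w / m)) H := by
  have hm' : (m : ℝ) ≠ 0 := by exact_mod_cast hm.ne'
  rw [mean_map]
  congr 1
  have h1 : ∑ j, (if w j = true then 1 / (m : ℝ) else 0) = ones w / m := by
    rw [ones, Finset.sum_div]
    exact Finset.sum_congr rfl fun j _ => by split_ifs <;> simp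
  have h2 : ∑ j, (if w j = false then 1 / (m : ℝ) else 0) = 1 - ones w / m := by
    rw [← h1, eq_sub_iff_add_eq, ← Finset.sum_add_distrib]
    rw [Finset.sum_congr rfl (g := fun _ => 1 / (m : ℝ)) fun j _ => by cases w j <;> simp]
    simp [hm']
  funext b
  cases b
  · simpa [ber] using h2
  · simpa [ber] using h1

/-- The number of `0`-`1`-vectors with few ones, by Markov's inequality for `θ ^ ones w`. -/
lemma card_few_ones_le {m : ℕ} {θ τ : ℝ} (hθ0 : 0 < θ) (hθ1 : θ < 1) :
    ((Finset.univ.filter fun w : Fin m → Bool => ones w < τ * m).card : ℝ) ≤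
      Real.exp (m * (Real.log (1 + θ) + τ * -Real.log θ)) := by
  have hlog : Real.log θ < 0 := Real.log_neg hθ0 hθ1
  have hprod : ∀ w : Fin m → Bool, ∏ j, (if w j then θ else 1) = Real.exp (Real.log θ * ones w) := by
    intro w
    rw [ones, Finset.mul_sum, Real.exp_sum]
    refine Finset.prod_congr rfl fun j _ => ?_
    split_ifs <;> simp [Real.exp_log hθ0]
  have hsum : ∑ w : Fin m → Bool, ∏ j, (if w j then θ else 1) = (1 + θ) ^ m := by
    rw [sum_prod_pow (A := Bool) (fun b => if b then θ else 1)]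
    simp [add_comm]
  have h1 : ((Finset.univ.filter fun w : Fin m → Bool => ones w < τ * m).card : ℝ) *
      Real.exp (Real.log θ * (τ * m)) ≤ (1 + θ) ^ m := by
    rw [← hsum, ← nsmul_eq_mul, ← Finset.sum_const]
    refine (Finset.sum_le_sum fun w hw => ?_).trans (Finset.sum_le_sum_of_subset_of_nonneg
      (Finset.filter_subset _ _) fun w _ _ => Finset.prod_nonneg fun j _ => by
        split_ifs <;> linarith)
    rw [hprod]
    exact Real.exp_le_exp.mpr (mul_le_mul_of_nonpos_left (Finset.mem_filter.mp hw).2.le hlog.le)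
  have h2 : ((1 : ℝ) + θ) ^ m = Real.exp (m * Real.log (1 + θ)) := by
    rw [Real.exp_nat_mul, Real.exp_log (by linarith)]
  rw [← le_div_iff₀ (Real.exp_pos _), h2, ← Real.exp_sub] at h1
  refine h1.trans (le_of_eq ?_)
  congr 1
  ring

/-- If a set of sequences of tokens has probability `exp (-s)`, then a pair of its elements that
differ by a rotation of a random set of positions of positive density has probability at least
`exp (-C s)`; the constants depend on the order of the rotation only. -/
theorem exists_rotation {L : ℕ} (hL : 2 ≤ L) : ∃ τ C : ℝ, 0 < τ ∧ τ ≤ 1 ∧ 1 ≤ C ∧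
    ∀ {Ω : Type} [Fintype Ω] {n : ℕ} (ν : Ω → ℝ) (_ : ν ∈ stdSimplex ℝ Ω) (σ : Equiv.Perm Ω)
      (_ : ∀ a, ν (σ a) = ν a) (_ : σ ^ L = 1) (f : (Fin n → Ω) → ℝ)
      (_ : ∀ e, f e = 0 ∨ f e = 1) (s : ℝ) (_ : 1 ≤ s) (_ : Real.exp (-s) ≤ mean ν f),
      ∃ q, τ ≤ q ∧ q ≤ 1 ∧ Real.exp (-(C * s)) ≤
        mean (ber q) (fun T => mean ν (fun e => f e * f (rotate σ T e))) := by
  have hL0 : (0 : ℝ) < (L : ℝ) - 1 := by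
    have : (2 : ℝ) ≤ L := by exact_mod_cast hL
    linarith
  set ρ : ℝ := L / ((L : ℝ) - 1) with hρ
  have hρ1 : ρ = 1 + 1 / ((L : ℝ) - 1) := by
    rw [hρ]; field_simp; ring
  have hLi : 1 / ((L : ℝ) - 1) ≤ 1 := by
    rw [div_le_one hL0]
    have : (2 : ℝ) ≤ L := by exact_mod_cast hL
    linarith
  have hLi0 : 0 < 1 / ((L : ℝ) - 1) := by positivity
  set θ : ℝ := 1 / ((L : ℝ) - 1) / 2 with hθ
  have hθ0 : 0 < θ := by positivity
  have hθ1 : θ < 1 := by rw [hθ]; linarith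
  have hlogθ : 0 < -Real.log θ := neg_pos.mpr (Real.log_neg hθ0 hθ1)
  set d : ℝ := Real.log ρ - Real.log (1 + θ) with hd
  have hd0 : 0 < d := sub_pos.mpr (Real.log_lt_log (by linarith) (by rw [hρ1, hθ]; linarith))
  set τ : ℝ := min 1 (d / (2 * -Real.log θ)) with hτ
  have hτ0 : 0 < τ := lt_min one_pos (by positivity)
  set lc : ℝ := Real.log (1 + θ) + τ * -Real.log θ with hlc
  set g : ℝ := Real.log ρ - lc with hg
  have hτd : τ * -Real.log θ ≤ d / 2 := by
    calc τ * -Real.log θ ≤ d / (2 * -Real.log θ) * -Real.log θ :=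
          mul_le_mul_of_nonneg_right (min_le_right _ _) hlogθ.le
      _ = d / 2 := by rw [div_mul_eq_mul_div, mul_div_mul_right _ _ hlogθ.ne']
  have hg0 : 0 < g := by rw [hg, hlc]; linarith
  have hlc0 : 0 ≤ lc := add_nonneg (Real.log_nonneg (by linarith)) (by positivity)
  have hC : 0 < 3 / g := by positivity
  refine ⟨τ, 3 / g + 1, hτ0, min_le_left _ _, by linarith, ?_⟩
  intro Ω _ n ν hν σ hσ hσL f hf s hs hmean
  -- the sum of the pair probabilities over the `0`-`1`-vectors is at least
  -- `exp (-2 s) * (L / (L - 1)) ^ m`, which for `m` blocks, `m` proportional to `s`, is more than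
  -- what the vectors with few ones can contribute
  set m : ℕ := ⌈(2 * s + 1) / g⌉₊ with hm
  have hm1 : (2 * s + 1) / g ≤ m := Nat.le_ceil _
  have hmg : 2 * s + 1 ≤ m * g := (div_le_iff₀ hg0).mp hm1
  have hm0 : 0 < m := by
    rw [hm, Nat.ceil_pos]; positivity
  have hmR : (0 : ℝ) < m := by exact_mod_cast hm0
  have hmC : (m : ℝ) ≤ (3 / g + 1) * s := by
    calc (m : ℝ) ≤ (2 * s + 1) / g + 1 := (Nat.ceil_lt_add_one (by positivity)).le
      _ ≤ (2 * s + s) / g + s := by gcongr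
      _ = (3 / g + 1) * s := by ring
  set G : (Fin m → Bool) → ℝ := fun w =>
    mean (ber (ones w / m)) (fun T => mean ν (fun e => f e * f (rotate σ T e))) with hG
  have hf01 : ∀ e, 0 ≤ f e ∧ f e ≤ 1 := fun e => by rcases hf e with h | h <;> simp [h]
  have hq : ∀ w : Fin m → Bool, 0 ≤ ones w / m ∧ ones w / m ≤ 1 := fun w =>
    ⟨div_nonneg (ones_nonneg w) hmR.le, (div_le_one hmR).mpr (ones_le w)⟩
  have hG1 : ∀ w, G w ≤ 1 := by
    intro w
    have hb := ber_mem (hq w).1 (hq w).2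
    rw [← mean_const (n := n) hb.2 1]
    refine mean_mono hb.1 fun T => ?_
    rw [← mean_const (n := n) hν.2 1]
    exact mean_mono hν.1 fun e => mul_le_one₀ (hf01 _).2 (hf01 _).1 (hf01 _).2
  have hsum : Real.exp (-(2 * s) + m * Real.log ρ) ≤ ∑ w, G w := by
    have huni : ∑ _j : Fin m, 1 / (m : ℝ) = 1 := by simp [hmR.ne']
    have h1 : ∀ b : Fin n → Fin m, Real.exp (-(2 * s) + m * Real.log ρ) ≤
        ∑ w : Fin m → Bool, mean ν (fun e => f e * f (rotate σ (w ∘ b) e)) := by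
      intro b
      have h2 := sq_mean_le_rotate hν σ hσ hL hσL hf b
      have hLm : (0 : ℝ) < ((L : ℝ) - 1) ^ m := by positivity
      have h3 : Real.exp (m * Real.log ρ) = (L : ℝ) ^ m / ((L : ℝ) - 1) ^ m := by
        rw [Real.exp_nat_mul, Real.exp_log (by rw [hρ1]; linarith), hρ, div_pow]
      rw [Real.exp_add, h3, ← mul_div_assoc, div_le_iff₀ hLm, mul_comm (Finset.sum _ _)]
      refine le_trans ?_ h2
      gcongr
      rw [show -(2 * s) = -s + -s by ring, Real.exp_add, sq]
      exact mul_le_mul hmean hmean (Real.exp_pos _).le ((Real.exp_pos _).le.trans hmean)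
    calc Real.exp (-(2 * s) + m * Real.log ρ)
        = mean (fun _ : Fin m => 1 / (m : ℝ))
            (fun _ : Fin n → Fin m => Real.exp (-(2 * s) + m * Real.log ρ)) :=
          (mean_const huni _).symm
      _ ≤ mean (fun _ : Fin m => 1 / (m : ℝ)) (fun b : Fin n → Fin m =>
            ∑ w : Fin m → Bool, mean ν (fun e => f e * f (rotate σ (w ∘ b) e))) :=
          mean_mono (fun _ => by positivity) h1
      _ = ∑ w, G w := by
          rw [mean_sum]
          exact Finset.sum_congr rfl fun w _ =>
            mean_block hm0 w fun T => mean ν (fun e => f e * f (rotate σ T e))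
  by_contra! hcon
  have hlow := card_few_ones_le (m := m) (τ := τ) hθ0 hθ1
  have hsplit := Finset.sum_filter_add_sum_filter_not (Finset.univ : Finset (Fin m → Bool))
    (fun w => ones w < τ * m) G
  have h1 : ∑ w ∈ Finset.univ.filter (fun w : Fin m → Bool => ones w < τ * m), G w ≤
      Real.exp (m * lc) := by
    refine le_trans (Finset.sum_le_sum fun w _ => hG1 w) ?_
    rw [Finset.sum_const, nsmul_eq_mul, mul_one]
    exact hlow
  have h2 : ∑ w ∈ Finset.univ.filter (fun w : Fin m → Bool => ¬ ones w < τ * m), G w ≤ 1 := by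
    have hexp : Real.exp (-((3 / g + 1) * s)) ≤ (1 / 2 : ℝ) ^ m := by
      calc Real.exp (-((3 / g + 1) * s)) ≤ Real.exp (m * -1) := by
            apply Real.exp_le_exp.mpr; linarith
        _ = Real.exp (-1) ^ m := Real.exp_nat_mul _ _
        _ ≤ (1 / 2 : ℝ) ^ m := by
            gcongr
            rw [Real.exp_neg, inv_eq_one_div]
            exact one_div_le_one_div_of_le two_pos (by linarith [Real.add_one_le_exp (1 : ℝ)])
    calc _ ≤ ∑ w ∈ Finset.univ.filter (fun w : Fin m → Bool => ¬ ones w < τ * m),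
            (1 / 2 : ℝ) ^ m := by
          refine Finset.sum_le_sum fun w hw => ?_
          have hw' := not_lt.mp (Finset.mem_filter.mp hw).2
          exact ((hcon (ones w / m) ((le_div_iff₀ hmR).mpr hw') (hq w).2).le).trans hexp
      _ ≤ ∑ w : Fin m → Bool, (1 / 2 : ℝ) ^ m :=
          Finset.sum_le_sum_of_subset_of_nonneg (Finset.filter_subset _ _)
            fun _ _ _ => by positivity
      _ = 1 := by
          simp
  have h3 : Real.exp (m * lc + 1) ≤ Real.exp (-(2 * s) + m * Real.log ρ) := by
    apply Real.exp_le_exp.mpr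
    have : (m : ℝ) * Real.log ρ = m * g + m * lc := by rw [hg]; ring
    linarith
  have h4 : 1 ≤ Real.exp (m * lc) := Real.one_le_exp (by positivity)
  have h5 : 2 < Real.exp 1 := by
    have := Real.exp_one_gt_d9; linarith
  rw [Real.exp_add] at h3
  nlinarith

end Step

/-! ### From one coupling to another -/

section Coupling

variable {A B : Type*} [Fintype A] [Fintype B] {n : ℕ}

lemma mean_prod (p : A → ℝ) (q : B → ℝ) (h : (Fin n → A) → (Fin n → B) → ℝ) :
    mean p (fun u => mean q (fun v => h u v)) =
      mean (fun w : A × B => p w.1 * q w.2) (fun w => h (fun i => (w i).1) (fun i => (w i).2)) := by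
  simp only [mean, Finset.mul_sum]
  rw [sum_pair (F := fun u v => (∏ i, p (u i)) * ((∏ i, q (v i)) * h u v))]
  refine Finset.sum_congr rfl fun w _ => ?_
  rw [Finset.prod_mul_distrib, mul_assoc]

/-- The mixture `(1 - p) P + p π`. -/
def mix (p : ℝ) (P π : A → ℝ) (a : A) : ℝ := (1 - p) * P a + p * π a

lemma mix_mem {p : ℝ} (h0 : 0 ≤ p) (h1 : p ≤ 1) {P π : A → ℝ} (hP : P ∈ stdSimplex ℝ A)
    (hπ : π ∈ stdSimplex ℝ A) : mix p P π ∈ stdSimplex ℝ A :=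
  convex_stdSimplex ℝ A hP hπ (sub_nonneg.mpr h1) h0 (by ring)

lemma prob_map [DecidableEq B] (F : A → B) (p : A → ℝ) (G : Set (Fin n → B)) :
    mean p (fun w => G.indicator 1 (F ∘ w)) =
      prob (fun b => ∑ a, if F a = b then p a else 0) G := mean_map F p _

/-- The rotation of the tokens that have not been rotated yet; the flag `true` marks the others. -/
def flagRotation (σ : Equiv.Perm A) : Equiv.Perm (A × Bool) where
  toFun x := (if x.2 then x.1 else σ x.1, x.2)
  invFun x := (if x.2 then x.1 else σ.symm x.1, x.2)
  left_inv := by rintro ⟨a, _ | _⟩ <;> simp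
  right_inv := by rintro ⟨a, _ | _⟩ <;> simp

/-- The set of sequences of pairs whose components lie in `S` and `T`. -/
def rect {U V : Type*} (S : Set (Fin n → U)) (T : Set (Fin n → V)) : Set (Fin n → U × V) :=
  {w | (fun i => (w i).1) ∈ S ∧ (fun i => (w i).2) ∈ T}

variable {U V : Type*} [Fintype U] [Fintype V]

/-- A rectangle that is not too unlikely under `(1 - p) P + p π` is not too unlikely under some
`(1 - p') P + p' π` that is closer to `π` by a constant factor. -/
theorem exists_mix_step {P π : U × V → ℝ} (hP : P ∈ stdSimplex ℝ (U × V))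
    (hex : Exchangeable P π) : ∃ τ C : ℝ, 0 < τ ∧ τ ≤ 1 ∧ 1 ≤ C ∧
      ∀ {n : ℕ} (S : Set (Fin n → U)) (T : Set (Fin n → V)) (p s : ℝ), 0 ≤ p → p ≤ 1 → 1 ≤ s →
        Real.exp (-s) ≤ prob (mix p P π) (rect S T) →
        ∃ p', 0 ≤ p' ∧ p' ≤ 1 ∧ 1 - p' ≤ (1 - p) * (1 - τ) ∧
          Real.exp (-(C * s)) ≤ prob (mix p' P π) (rect S T) := by
  classical
  obtain ⟨k, ν, φ, ψ, σ, hν0, hνσ, hPν, hπν⟩ := hex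
  -- a common multiple of the orders of all permutations of flagged tokens, and at least two
  set L := 2 * Fintype.card (Equiv.Perm (Fin k × Bool)) with hL
  have hL2 : 2 ≤ L := by
    have : 0 < Fintype.card (Equiv.Perm (Fin k × Bool)) := Fintype.card_pos
    omega
  obtain ⟨τ, C, hτ0, hτ1, hC, hrot⟩ := exists_rotation hL2
  refine ⟨τ, C, hτ0, hτ1, hC, ?_⟩
  intro n S T p s hp0 hp1 hs hprob
  have hνsum : ∑ e, ν e = 1 := by
    rw [← hP.2, hPν]
    simp only [pairLaw]
    rw [Finset.sum_comm]
    simp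
  set ν' : Fin k × Bool → ℝ := fun x => ν x.1 * ber p x.2 with hν'
  have hber := ber_mem hp0 hp1
  have hν'mem : ν' ∈ stdSimplex ℝ (Fin k × Bool) := by
    refine ⟨fun x => mul_nonneg (hν0 _) (hber.1 _), ?_⟩
    rw [Fintype.sum_prod_type]
    simp only [hν', ← Finset.mul_sum, hber.2, mul_one, hνsum]
  set σ' := flagRotation σ with hσ'
  have hσ'ν : ∀ x, ν' (σ' x) = ν' x := by
    rintro ⟨e, _ | _⟩ <;> simp [hν', hσ', flagRotation, hνσ]
  have hσ'L : σ' ^ L = 1 := by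
    rw [hL, mul_comm, pow_mul, pow_card_eq_one, one_pow]
  let F : Fin k × Bool → U × V := fun x => (φ x.1, ψ (if x.2 then σ x.1 else x.1))
  let f : (Fin n → Fin k × Bool) → ℝ := fun x => (rect S T).indicator 1 (F ∘ x)
  have hf : ∀ x, f x = 0 ∨ f x = 1 := fun x => by
    by_cases h : F ∘ x ∈ rect S T <;> simp [f, h]
  have hlaw : (fun w => ∑ x, if F x = w then ν' x else 0) = mix p P π := by
    funext w
    rw [Fintype.sum_prod_type, mix, hPν, hπν]
    simp only [pairLaw, Finset.mul_sum, ← Finset.sum_add_distrib]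
    refine Finset.sum_congr rfl fun e _ => ?_
    rw [Fintype.sum_bool]
    simp only [F, hν', ber]
    by_cases h1 : (φ e, ψ (σ e)) = w <;> by_cases h2 : (φ e, ψ e) = w <;>
      simp [h1, h2] <;> ring
  have hmean : Real.exp (-s) ≤ mean ν' f := by
    rw [prob_map, hlaw]; exact hprob
  obtain ⟨q, hqτ, hq1, hq⟩ := hrot ν' hν'mem σ' hσ'ν hσ'L f hf s hs hmean
  have hq0 : 0 ≤ q := hτ0.le.trans hqτ
  have hbq := ber_mem hq0 hq1
  set p' := p + (1 - p) * q with hp'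
  refine ⟨p', by nlinarith, by nlinarith, by nlinarith, hq.trans ?_⟩
  -- the `U`-letters before and the `V`-letters after the rotation
  let F2 : Bool × (Fin k × Bool) → U × V :=
    fun y => (φ y.2.1, ψ (if y.2.2 || y.1 then σ y.2.1 else y.2.1))
  have hle : ∀ (b : Fin n → Bool) (x : Fin n → Fin k × Bool), f x * f (rotate σ' b x) ≤
      (rect S T).indicator 1 (F2 ∘ fun i => (b i, x i)) := by
    intro b x
    by_cases h1 : F ∘ x ∈ rect S T
    · by_cases h2 : F ∘ rotate σ' b x ∈ rect S T
      · have h3 : (F2 ∘ fun i => (b i, x i)) ∈ rect S T := by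
          refine ⟨h1.1, ?_⟩
          convert h2.2 using 2 with i
          simp only [F2, F, rotate, Function.comp, hσ', flagRotation]
          cases hb : b i <;> cases hx : (x i).2 <;> simp [hx]
        simp [f, h1, h2, h3]
      · rw [show f (rotate σ' b x) = 0 by simp [f, h2], mul_zero]
        exact Set.indicator_nonneg (fun _ _ => zero_le_one) _
    · rw [show f x = 0 by simp [f, h1], zero_mul]
      exact Set.indicator_nonneg (fun _ _ => zero_le_one) _
  have hlaw2 : (fun w => ∑ y, if F2 y = w then ber q y.1 * ν' y.2 else 0) = mix p' P π := by
    funext w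
    rw [Fintype.sum_prod_type, Finset.sum_comm, Fintype.sum_prod_type, mix, hPν, hπν]
    simp only [pairLaw, Finset.mul_sum, ← Finset.sum_add_distrib]
    refine Finset.sum_congr rfl fun e _ => ?_
    simp only [Fintype.sum_bool, F2, hν', ber]
    by_cases h1 : (φ e, ψ (σ e)) = w <;> by_cases h2 : (φ e, ψ e) = w <;>
      simp [h1, h2] <;> ring
  calc _ ≤ mean (ber q) (fun b : Fin n → Bool => mean ν' (fun x =>
          (rect S T).indicator 1 (F2 ∘ fun i => (b i, x i)))) :=
        mean_mono hbq.1 fun b => mean_mono hν'mem.1 fun x => hle b x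
    _ = _ := by
        rw [mean_prod (h := fun b x => (rect S T).indicator 1 (F2 ∘ fun i => (b i, x i))),
          ← hlaw2, ← prob_map]

/-- If `P` and `π` have the same marginals, a rectangle of subexponential probability under `P` has
subexponential probability under couplings that are arbitrarily close to `π`. -/
theorem exists_mix_near {P π : U × V → ℝ} (hP : P ∈ stdSimplex ℝ (U × V))
    (hex : Exchangeable P π) {η : ℝ} (hη : 0 < η) : ∃ C : ℝ, 1 ≤ C ∧
      ∀ {n : ℕ} (S : Set (Fin n → U)) (T : Set (Fin n → V)) (s : ℝ), 1 ≤ s →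
        Real.exp (-s) ≤ prob P (rect S T) →
        ∃ p, 0 ≤ p ∧ p ≤ 1 ∧ 1 - p ≤ η ∧ Real.exp (-(C * s)) ≤ prob (mix p P π) (rect S T) := by
  obtain ⟨τ, C, hτ0, hτ1, hC, hstep⟩ := exists_mix_step hP hex
  obtain ⟨k, hk⟩ := exists_pow_lt_of_lt_one hη (by linarith : 1 - τ < 1)
  have hiter : ∀ k : ℕ, ∀ {n : ℕ} (S : Set (Fin n → U)) (T : Set (Fin n → V)) (s : ℝ), 1 ≤ s →
        Real.exp (-s) ≤ prob P (rect S T) →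
        ∃ p, 0 ≤ p ∧ p ≤ 1 ∧ 1 - p ≤ (1 - τ) ^ k ∧
          Real.exp (-(C ^ k * s)) ≤ prob (mix p P π) (rect S T) := by
    intro k
    induction k with
    | zero =>
      intro n S T s hs h
      refine ⟨0, le_rfl, zero_le_one, by simp, ?_⟩
      have : mix 0 P π = P := by funext w; simp [mix]
      rw [this, pow_zero, one_mul]
      exact h
    | succ k ih =>
      intro n S T s hs h
      obtain ⟨p, hp0, hp1, hpk, hp⟩ := ih S T s hs h
      obtain ⟨p', hp0', hp1', hpk', hp'⟩ := hstep S T p (C ^ k * s) hp0 hp1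
        (by nlinarith [one_le_pow₀ hC (n := k)]) hp
      refine ⟨p', hp0', hp1', hpk'.trans ?_, ?_⟩
      · rw [pow_succ]
        exact mul_le_mul_of_nonneg_right hpk (by linarith)
      · rw [pow_succ, mul_comm (C ^ k), mul_assoc]
        exact hp'
  refine ⟨C ^ k, one_le_pow₀ hC, fun S T s hs h => ?_⟩
  obtain ⟨p, hp0, hp1, hpk, hp⟩ := hiter k S T s hs h
  exact ⟨p, hp0, hp1, hpk.trans hk.le, hp⟩

end Coupling

/-! ### Change of measure and the converse for rectangles -/

section KL

variable {A : Type*} [Fintype A]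

/-- The real-valued divergence `∑ p log p - ∑ p log q`. It is continuous in `p`, and it agrees with
`klDiv p q` when `p` is dominated by `q`. -/
noncomputable def klReal (p q : A → ℝ) : ℝ :=
  ∑ a, (p a * Real.log (p a) - p a * Real.log (q a))

lemma continuous_klReal (q : A → ℝ) : Continuous fun p : A → ℝ => klReal p q := by
  unfold klReal
  refine continuous_finsetSum _ fun a _ => ?_
  have h : Continuous fun p : A → ℝ => p a := continuous_apply a
  exact (Real.continuous_mul_log.comp h).sub (h.mul continuous_const)

lemma klReal_eq {p q : A → ℝ} (h : ∀ a, q a = 0 → p a = 0) :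
    klReal p q = ∑ a, p a * Real.log (p a / q a) := by
  refine Finset.sum_congr rfl fun a _ => ?_
  by_cases hp : p a = 0
  · simp [hp]
  · rw [Real.log_div hp (fun hq => hp (h a hq))]
    ring

lemma klDiv_eq {p q : A → ℝ} (h : ∀ a, q a = 0 → p a = 0) :
    klDiv p q = ENNReal.ofReal (klReal p q) := by
  rw [klDiv, if_pos h, klReal_eq h]

lemma dominated_of_klDiv_ne_top {p q : A → ℝ} (h : klDiv p q ≠ ⊤) : ∀ a, q a = 0 → p a = 0 := by
  by_contra hc
  exact h (by rw [klDiv, if_neg hc])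

lemma klReal_lt_of_klDiv_lt {p q : A → ℝ} {e : ℝ} (h : klDiv p q < ENNReal.ofReal e) :
    (∀ a, q a = 0 → p a = 0) ∧ klReal p q < e := by
  have h0 := dominated_of_klDiv_ne_top (lt_top_of_lt h).ne
  rw [klDiv_eq h0] at h
  exact ⟨h0, (ENNReal.ofReal_lt_ofReal_iff'.mp h).1⟩

/-- Change of measure: an event that has probability `exp (-o(n))` under `R^n` has probability at
least `exp (-n (D(R‖Q) + δ))` under `Q^n`, since by Markov's inequality the log-likelihood ratio
exceeds `n (D(R‖Q) + δ / 2)` with exponentially small probability only. -/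
theorem exists_change_of_measure {R Q : A → ℝ} (hR : R ∈ stdSimplex ℝ A)
    (hQ : ∀ a, 0 ≤ Q a) (hRQ : ∀ a, Q a = 0 → R a = 0) {δ : ℝ} (hδ : 0 < δ) :
    ∃ η : ℝ, 0 < η ∧ ∃ n₀ : ℕ, ∀ n ≥ n₀, ∀ G : Set (Fin n → A),
      Real.exp (-(η * n)) ≤ prob R G → Real.exp (-(n * (klReal R Q + δ))) ≤ prob Q G := by
  set D := klReal R Q with hD
  set l : A → ℝ := fun a => Real.log (R a / Q a) with hl
  -- the moment generating function of the log-likelihood ratio, tilted by its threshold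
  set F : ℝ → ℝ := fun s => ∑ a, R a * Real.exp (s * (l a - (D + δ / 2))) with hF
  have hF0 : F 0 = 1 := by simp [hF, hR.2]
  have hF' : HasDerivAt F (-(δ / 2)) 0 := by
    have h1 : HasDerivAt F (∑ a, R a * (l a - (D + δ / 2))) 0 := by
      refine HasDerivAt.fun_sum fun a _ => ?_
      have h2 : HasDerivAt (fun s : ℝ => s * (l a - (D + δ / 2))) (l a - (D + δ / 2)) 0 := by
        simpa using (hasDerivAt_id (0 : ℝ)).mul_const (l a - (D + δ / 2))
      simpa using (h2.exp).const_mul (R a)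
    convert h1 using 1
    simp only [mul_sub, Finset.sum_sub_distrib, ← Finset.sum_mul, hR.2]
    rw [← klReal_eq hRQ, ← hD]
    ring
  obtain ⟨s, hs0, hs⟩ : ∃ s, 0 < s ∧ F s < 1 := by
    have h1 := (hasDerivAt_iff_tendsto_slope_zero.mp hF').eventually_lt_const
      (show -(δ / 2) < 0 by linarith)
    have h2 : ∀ᶠ t in 𝓝[>] (0 : ℝ), t⁻¹ • (F (0 + t) - F 0) < 0 :=
      h1.filter_mono (nhdsWithin_mono _ fun t ht => ne_of_gt ht)
    obtain ⟨t, ht, ht0⟩ := (h2.and self_mem_nhdsWithin).exists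
    refine ⟨t, ht0, ?_⟩
    rw [zero_add, hF0, smul_eq_mul] at ht
    have h3 : (0 : ℝ) < t⁻¹ := inv_pos.mpr ht0
    nlinarith
  have hFpos : 0 < F s := by
    obtain ⟨a, ha⟩ := exists_pos_of_sum_pos (f := R) (by rw [hR.2]; exact one_pos)
    exact Finset.sum_pos' (fun a _ => mul_nonneg (hR.1 a) (Real.exp_pos _).le)
      ⟨a, Finset.mem_univ a, mul_pos ha (Real.exp_pos _)⟩
  set γ := -Real.log (F s) with hγ
  have hγ0 : 0 < γ := neg_pos.mpr (Real.log_neg hFpos hs)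
  set η := min (γ / 2) (δ / 4) with hη
  have hη0 : 0 < η := lt_min (by positivity) (by positivity)
  refine ⟨η, hη0, ⌈Real.log 2 / η⌉₊, fun n hn G hG => ?_⟩
  have hn' : Real.log 2 ≤ η * n := by
    have := Nat.ceil_le.mp hn
    rwa [div_le_iff₀' hη0] at this
  have hpt : ∀ w : Fin n → A, ∏ i, R (w i) ≤ Real.exp (n * (D + δ / 2)) * ∏ i, Q (w i) +
      ∏ i, R (w i) * Real.exp (s * (l (w i) - (D + δ / 2))) := by
    intro w
    have hQw : 0 ≤ ∏ i, Q (w i) := Finset.prod_nonneg fun i _ => hQ _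
    have hRw : 0 ≤ ∏ i, R (w i) := Finset.prod_nonneg fun i _ => hR.1 _
    have hsum : ∑ i, s * (l (w i) - (D + δ / 2)) = s * (∑ i, l (w i) - n * (D + δ / 2)) := by
      rw [← Finset.mul_sum, Finset.sum_sub_distrib, Finset.sum_const, Finset.card_univ,
        Fintype.card_fin, nsmul_eq_mul]
    rw [Finset.prod_mul_distrib, ← Real.exp_sum, hsum]
    by_cases hz : ∏ i, R (w i) = 0
    · rw [hz, zero_mul, add_zero]; positivity
    have hzi : ∀ i, 0 < R (w i) := fun i =>
      lt_of_le_of_ne (hR.1 _) fun h => hz (Finset.prod_eq_zero (Finset.mem_univ i) h.symm)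
    have hqi : ∀ i, 0 < Q (w i) := fun i =>
      lt_of_le_of_ne (hQ _) fun h => (hzi i).ne' (hRQ _ h.symm)
    rcases le_total (∑ i, l (w i)) (n * (D + δ / 2)) with h | h
    · have h1 : ∏ i, R (w i) = Real.exp (∑ i, l (w i)) * ∏ i, Q (w i) := by
        rw [Real.exp_sum, ← Finset.prod_mul_distrib]
        refine Finset.prod_congr rfl fun i _ => ?_
        rw [hl, Real.exp_log (div_pos (hzi i) (hqi i)), div_mul_cancel₀ _ (hqi i).ne']
      calc ∏ i, R (w i) ≤ Real.exp (n * (D + δ / 2)) * ∏ i, Q (w i) := by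
            rw [h1]
            exact mul_le_mul_of_nonneg_right (Real.exp_le_exp.mpr h) hQw
        _ ≤ _ := le_add_of_nonneg_right (by positivity)
    · have h1 : 1 ≤ Real.exp (s * (∑ i, l (w i) - n * (D + δ / 2))) :=
        Real.one_le_exp (mul_nonneg hs0.le (sub_nonneg.mpr h))
      calc ∏ i, R (w i) ≤ (∏ i, R (w i)) * Real.exp (s * (∑ i, l (w i) - n * (D + δ / 2))) :=
            le_mul_of_one_le_right hRw h1
        _ ≤ _ := le_add_of_nonneg_left (by positivity)
  have hmain : prob R G ≤ Real.exp (n * (D + δ / 2)) * prob Q G + Real.exp (-(γ * n)) := by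
    calc prob R G ≤ ∑ w, (Real.exp (n * (D + δ / 2)) * (∏ i, Q (w i)) * G.indicator 1 w +
          ∏ i, R (w i) * Real.exp (s * (l (w i) - (D + δ / 2)))) := by
          refine Finset.sum_le_sum fun w _ => ?_
          by_cases hw : w ∈ G
          · simpa [hw] using hpt w
          · simp only [hw, not_false_eq_true, Set.indicator_of_notMem, mul_zero, zero_add]
            exact Finset.prod_nonneg fun i _ => mul_nonneg (hR.1 _) (Real.exp_pos _).le
      _ = Real.exp (n * (D + δ / 2)) * prob Q G + F s ^ n := by
          rw [Finset.sum_add_distrib,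
            sum_prod_pow (fun a => R a * Real.exp (s * (l a - (D + δ / 2))))]
          simp only [prob, mean, Finset.mul_sum, mul_assoc, hF]
      _ = _ := by
          rw [show -(γ * n) = n * Real.log (F s) by rw [hγ]; ring,
            Real.exp_nat_mul (Real.log (F s)), Real.exp_log hFpos]
  have hhalf : Real.exp (-(η * n)) / 2 = Real.exp (-(η * n) - Real.log 2) := by
    rw [Real.exp_sub, Real.exp_log two_pos]
  have h2 : Real.exp (-(γ * n)) ≤ Real.exp (-(η * n)) / 2 := by
    rw [hhalf]
    apply Real.exp_le_exp.mpr
    have : 2 * η ≤ γ := by have := min_le_left (γ / 2) (δ / 4); linarith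
    have : 2 * η * n ≤ γ * n := mul_le_mul_of_nonneg_right this (Nat.cast_nonneg n)
    linarith
  have h3 : Real.exp (-(η * n)) / 2 ≤ Real.exp (n * (D + δ / 2)) * prob Q G := by linarith
  have h4 : Real.exp (-(n * (D + δ))) * Real.exp (n * (D + δ / 2)) ≤ Real.exp (-(η * n)) / 2 := by
    rw [hhalf, ← Real.exp_add]
    apply Real.exp_le_exp.mpr
    have : 4 * η ≤ δ := by have := min_le_right (γ / 2) (δ / 4); linarith
    have : 4 * η * n ≤ δ * n := mul_le_mul_of_nonneg_right this (Nat.cast_nonneg n)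
    linarith
  have h5 := h4.trans h3
  rw [mul_comm] at h5
  exact le_of_mul_le_mul_left h5 (Real.exp_pos _)

end KL

section Core

variable {U V : Type*}

lemma fstMarg_mix [Fintype V] (p : ℝ) (P π : U × V → ℝ) :
    fstMarg (mix p P π) = mix p (fstMarg P) (fstMarg π) := by
  funext u
  simp [fstMarg, mix, Finset.sum_add_distrib, Finset.mul_sum]

lemma sndMarg_mix [Fintype U] (p : ℝ) (P π : U × V → ℝ) :
    sndMarg (mix p P π) = mix p (sndMarg P) (sndMarg π) := by
  funext u
  simp [sndMarg, mix, Finset.sum_add_distrib, Finset.mul_sum]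

lemma mix_self {A : Type*} (p : ℝ) (P : A → ℝ) : mix p P P = P := by
  funext a; simp only [mix]; ring

lemma continuous_mix {A : Type*} (P π : A → ℝ) : Continuous fun p => mix p P π := by
  unfold mix
  fun_prop

lemma mix_dominated {A : Type*} {P π Q : A → ℝ} (hP : ∀ a, Q a = 0 → P a = 0)
    (hπ : ∀ a, Q a = 0 → π a = 0) (p : ℝ) : ∀ a, Q a = 0 → mix p P π a = 0 := by
  intro a ha
  simp [mix, hP a ha, hπ a ha]

/-- A small admixture of `P` changes a divergence from `Q` by little. -/
lemma exists_klReal_mix_lt {A : Type*} [Fintype A] {π P Q : A → ℝ} {e : ℝ}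
    (h : klReal π Q < e) : ∃ t, 0 < t ∧ t < 1 ∧ klReal (mix t π P) Q < e := by
  have hc : Continuous fun t => klReal (mix t π P) Q :=
    (continuous_klReal Q).comp (continuous_mix π P)
  have h0 : mix 0 π P = π := by funext a; simp [mix]
  have h1 : ∀ᶠ t in 𝓝 (0 : ℝ), klReal (mix t π P) Q < e :=
    hc.continuousAt.eventually_lt_const (by simpa only [h0] using h)
  obtain ⟨t, ⟨ht1, ht2⟩, ht0⟩ := (((h1.and (eventually_lt_nhds one_pos)).filter_mono
    (nhdsWithin_le_nhds (s := Set.Ioi 0))).and self_mem_nhdsWithin).exists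
  exact ⟨t, ht0, ht2, ht1⟩

/-- Zero-rate converse: a rectangle of probability `exp (-o(n))` under `P^n` has probability at
least `exp (-n (E₁ + o(1)))` under `Q^n`. -/
theorem exists_rect_converse [Fintype U] [Fintype V] {P Q : U × V → ℝ}
    (hP : P ∈ stdSimplex ℝ (U × V)) (hQ : ∀ w, 0 ≤ Q w) (hPQ : ∀ w, Q w = 0 → P w = 0) {e : ℝ}
    (he : E1 P Q < ENNReal.ofReal e) : ∃ η : ℝ, 0 < η ∧ ∃ n₀ : ℕ, ∀ n ≥ n₀,
      ∀ (S : Set (Fin n → U)) (T : Set (Fin n → V)),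
        Real.exp (-(η * n)) ≤ prob P (rect S T) → Real.exp (-(n * e)) ≤ prob Q (rect S T) := by
  simp only [E1, iInf_lt_iff] at he
  obtain ⟨π₀, ⟨hπ₀, h1, h2⟩, hlt⟩ := he
  obtain ⟨hπ₀Q, hlt⟩ := klReal_lt_of_klDiv_lt hlt
  obtain ⟨t, ht0, ht1, ht⟩ := exists_klReal_mix_lt (P := P) hlt
  -- an admixture of `P` makes `P` bounded by a multiple of `π`
  set π := mix t π₀ P with hπdef
  have hπ : π ∈ stdSimplex ℝ (U × V) := mix_mem ht0.le ht1.le hπ₀ hP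
  have hex : Exchangeable P π := by
    refine exchangeable_of_marginals P π hP.1 hπ.1 ?_ ?_
    · rw [hπdef, fstMarg_mix, h1, mix_self]
    · rw [hπdef, sndMarg_mix, h2, mix_self]
  have hPπ : ∀ w, P w ≤ 1 / t * π w := by
    intro w
    have h3 : t * P w ≤ π w := le_add_of_nonneg_left (mul_nonneg (by linarith) (hπ₀.1 w))
    rw [one_div, inv_mul_eq_div, le_div_iff₀ ht0]
    linarith
  obtain ⟨η', hη', n₁, hcm⟩ := exists_change_of_measure hπ hQ (mix_dominated hπ₀Q hPQ t)
    (sub_pos.mpr ht)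
  obtain ⟨C, hC, hnear⟩ := exists_mix_near hP hex (η := t * η' / 2) (by positivity)
  have hC0 : 0 < C := by linarith
  refine ⟨η' / (2 * C), by positivity, max n₁ ⌈2 * C / η'⌉₊, fun n hn S T hST => ?_⟩
  have hs : 1 ≤ η' / (2 * C) * n := by
    have := Nat.ceil_le.mp ((le_max_right _ _).trans hn)
    rw [div_le_iff₀ hη'] at this
    rw [div_mul_eq_mul_div, le_div_iff₀ (by positivity)]
    linarith
  obtain ⟨p, hp0, hp1, hp, hprob⟩ := hnear S T _ hs hST
  have hdom : ∀ w, mix p P π w ≤ Real.exp (η' / 2) * π w := by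
    intro w
    have h3 : mix p P π w ≤ (1 + η' / 2) * π w := by
      have h4 : (1 - p) * P w ≤ (t * η' / 2) * (1 / t * π w) :=
        mul_le_mul hp (hPπ w) (hP.1 w) (by positivity)
      have h5 : (t * η' / 2) * (1 / t * π w) = η' / 2 * π w := by field_simp
      have h6 : p * π w ≤ π w := mul_le_of_le_one_left (hπ.1 w) hp1
      simp only [mix]
      linarith
    refine h3.trans (mul_le_mul_of_nonneg_right ?_ (hπ.1 w))
    linarith [Real.add_one_le_exp (η' / 2)]
  have hle := mean_le_of_le_mul (n := n) (h := (rect S T).indicator 1)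
    (mix_mem hp0 hp1 hP hπ).1 hdom fun _ => Set.indicator_nonneg (fun _ _ => zero_le_one) _
  have hπprob : Real.exp (-(η' * n)) ≤ prob π (rect S T) := by
    have h3 := hprob.trans hle
    rw [← Real.exp_nat_mul] at h3
    have h4 : Real.exp (-(η' * n)) * Real.exp (n * (η' / 2)) =
        Real.exp (-(C * (η' / (2 * C) * n))) := by
      rw [← Real.exp_add]
      congr 1
      field_simp
      ring
    rw [← h4, mul_comm] at h3
    exact le_of_mul_le_mul_left h3 (Real.exp_pos _)
  have := hcm n ((le_max_left _ _).trans hn) _ hπprob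
  rwa [add_sub_cancel] at this

end Core

/-! ### Types and concentration -/

section Types

variable {A : Type*} [Fintype A] {n : ℕ}

lemma sum_sq_sqrt_sub_le {p q : A → ℝ} (hp : p ∈ stdSimplex ℝ A) (hq : q ∈ stdSimplex ℝ A)
    (h : ∀ a, q a = 0 → p a = 0) :
    ∑ a, (√(p a) - √(q a)) ^ 2 ≤ klReal p q := by
  have h1 : ∑ a, (√(p a) - √(q a)) ^ 2 = ∑ a, (2 * p a - 2 * (√(p a) * √(q a))) := by
    have h2 : ∑ a, (√(p a) - √(q a)) ^ 2 = ∑ a, (p a + q a - 2 * (√(p a) * √(q a))) :=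
      Finset.sum_congr rfl fun a _ => by
        rw [sub_sq, Real.sq_sqrt (hp.1 a), Real.sq_sqrt (hq.1 a)]; ring
    rw [h2, Finset.sum_sub_distrib, Finset.sum_sub_distrib, Finset.sum_add_distrib, hp.2, hq.2,
      ← Finset.mul_sum, ← Finset.mul_sum, hp.2]
    ring
  rw [h1]
  refine Finset.sum_le_sum fun a _ => ?_
  rcases (hp.1 a).eq_or_lt with h0 | h0
  · simp [← h0]
  have hq0 : 0 < q a := lt_of_le_of_ne (hq.1 a) fun hq0 => h0.ne' (h a hq0.symm)
  have hsp : 0 < √(p a) := Real.sqrt_pos.mpr h0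
  have hsq : 0 < √(q a) := Real.sqrt_pos.mpr hq0
  have h3 : Real.log (√(q a) / √(p a)) ≤ √(q a) / √(p a) - 1 :=
    Real.log_le_sub_one_of_pos (by positivity)
  rw [Real.log_div hsq.ne' hsp.ne', Real.log_sqrt hq0.le, Real.log_sqrt h0.le] at h3
  have h4 : p a * (√(q a) / √(p a)) = √(p a) * √(q a) := by
    nth_rewrite 1 [← Real.mul_self_sqrt h0.le]
    field_simp
  nlinarith [mul_le_mul_of_nonneg_left h3 h0.le]

lemma klReal_nonneg {p q : A → ℝ} (hp : p ∈ stdSimplex ℝ A) (hq : q ∈ stdSimplex ℝ A)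
    (h : ∀ a, q a = 0 → p a = 0) : 0 ≤ klReal p q :=
  (Finset.sum_nonneg fun _ _ => sq_nonneg _).trans (sum_sq_sqrt_sub_le hp hq h)

/-- Pinsker's inequality with a weaker constant, by way of the Hellinger distance. -/
lemma sq_sum_abs_sub_le {p q : A → ℝ} (hp : p ∈ stdSimplex ℝ A) (hq : q ∈ stdSimplex ℝ A)
    (h : ∀ a, q a = 0 → p a = 0) : (∑ a, |p a - q a|) ^ 2 ≤ 4 * klReal p q := by
  have h1 : ∀ a, |p a - q a| = |√(p a) - √(q a)| * (√(p a) + √(q a)) := by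
    intro a
    rw [← abs_of_nonneg (add_nonneg (Real.sqrt_nonneg (p a)) (Real.sqrt_nonneg (q a))), ← abs_mul]
    congr 1
    nlinarith [Real.mul_self_sqrt (hp.1 a), Real.mul_self_sqrt (hq.1 a)]
  have h2 : ∑ a, (√(p a) + √(q a)) ^ 2 ≤ 4 := by
    calc ∑ a, (√(p a) + √(q a)) ^ 2 ≤ ∑ a, (2 * p a + 2 * q a) :=
          Finset.sum_le_sum fun a _ => by
            nlinarith [Real.mul_self_sqrt (hp.1 a), Real.mul_self_sqrt (hq.1 a),
              sq_nonneg (√(p a) - √(q a))]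
      _ = 4 := by
          rw [Finset.sum_add_distrib, ← Finset.mul_sum, ← Finset.mul_sum, hp.2, hq.2]; norm_num
  calc (∑ a, |p a - q a|) ^ 2 = (∑ a, |√(p a) - √(q a)| * (√(p a) + √(q a))) ^ 2 := by
        simp only [h1]
    _ ≤ (∑ a, |√(p a) - √(q a)| ^ 2) * ∑ a, (√(p a) + √(q a)) ^ 2 :=
        Finset.sum_mul_sq_le_sq_mul_sq _ _ _
    _ ≤ klReal p q * 4 := by
        simp only [sq_abs]
        exact mul_le_mul (sum_sq_sqrt_sub_le hp hq h) h2
          (Finset.sum_nonneg fun _ _ => sq_nonneg _) (klReal_nonneg hp hq h)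
    _ = 4 * klReal p q := mul_comm _ _

lemma le_klDiv_of_lt_abs_sub {p q : A → ℝ} (hp : p ∈ stdSimplex ℝ A) (hq : q ∈ stdSimplex ℝ A)
    {μ : ℝ} (hμ : 0 ≤ μ) {a : A} (ha : μ < |p a - q a|) :
    ENNReal.ofReal (μ ^ 2 / 4) ≤ klDiv p q := by
  by_cases h : ∀ a, q a = 0 → p a = 0
  · rw [klDiv_eq h]
    apply ENNReal.ofReal_le_ofReal
    have h1 := sq_sum_abs_sub_le hp hq h
    have h2 : μ ≤ ∑ a, |p a - q a| := ha.le.trans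
      (Finset.single_le_sum (f := fun a => |p a - q a|) (fun _ _ => abs_nonneg _)
        (Finset.mem_univ a))
    have h3 : μ ^ 2 ≤ (∑ a, |p a - q a|) ^ 2 := by gcongr
    linarith
  · rw [klDiv, if_neg h]
    exact le_top

/-- The type (empirical law) of a sequence. -/
noncomputable def typ (w : Fin n → A) (a : A) : ℝ :=
  open Classical in ((Finset.univ.filter fun i => w i = a).card : ℝ) / n

lemma sum_comp_eq (hn : n ≠ 0) (w : Fin n → A) (h : A → ℝ) :
    ∑ i, h (w i) = n * ∑ a, typ w a * h a := by
  classical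
  have hn' : (n : ℝ) ≠ 0 := by exact_mod_cast hn
  rw [← Finset.sum_fiberwise Finset.univ w, Finset.mul_sum]
  refine Finset.sum_congr rfl fun a _ => ?_
  rw [Finset.sum_congr rfl (g := fun _ => h a) fun i hi => by rw [(Finset.mem_filter.mp hi).2],
    Finset.sum_const, nsmul_eq_mul, typ, ← mul_assoc, mul_div_cancel₀ _ hn']

lemma typ_mem (hn : n ≠ 0) (w : Fin n → A) : typ w ∈ stdSimplex ℝ A := by
  refine ⟨fun a => by unfold typ; positivity, ?_⟩
  have h := sum_comp_eq hn w fun _ => 1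
  have hn' : (n : ℝ) ≠ 0 := by exact_mod_cast hn
  simp only [Finset.sum_const, Finset.card_univ, Fintype.card_fin, nsmul_eq_mul, mul_one] at h
  exact (mul_eq_left₀ hn').mp h.symm

omit [Fintype A] in
lemma typ_ne_zero (hn : n ≠ 0) (w : Fin n → A) (i : Fin n) : typ w (w i) ≠ 0 := by
  classical
  have hn' : (n : ℝ) ≠ 0 := by exact_mod_cast hn
  refine div_ne_zero (Nat.cast_ne_zero.mpr (Finset.card_ne_zero.mpr ⟨i, by simp⟩)) hn'

omit [Fintype A] in
lemma exists_of_typ_ne_zero {w : Fin n → A} {a : A} (h : typ w a ≠ 0) : ∃ i, w i = a := by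
  classical
  by_contra! hc
  exact h (by simp [typ, hc])

/-- There are at most `(n + 1) ^ |A|` types, and each type class has probability at most one under
its own type. -/
lemma sum_prod_typ_le (hn : n ≠ 0) :
    ∑ w : Fin n → A, ∏ i, typ w (w i) ≤ ((n : ℝ) + 1) ^ Fintype.card A := by
  classical
  let cnt : (Fin n → A) → (A → Fin (n + 1)) := fun w a =>
    ⟨(Finset.univ.filter fun i => w i = a).card, Nat.lt_succ_of_le
      ((Finset.card_le_univ _).trans (Fintype.card_fin n).le)⟩
  have htyp : ∀ w w', cnt w = cnt w' → typ w = typ w' := by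
    intro w w' h
    funext a
    have := congrArg Fin.val (congrFun h a)
    simp only [cnt] at this
    simp only [typ]
    congr 2
  rw [← Finset.sum_fiberwise Finset.univ cnt]
  calc ∑ c, ∑ w with cnt w = c, ∏ i, typ w (w i) ≤ ∑ _c : A → Fin (n + 1), (1 : ℝ) := by
        refine Finset.sum_le_sum fun c _ => ?_
        by_cases hc : ∃ w0, cnt w0 = c
        · obtain ⟨w0, rfl⟩ := hc
          calc ∑ w with cnt w = cnt w0, ∏ i, typ w (w i)
              = ∑ w with cnt w = cnt w0, ∏ i, typ w0 (w i) :=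
                Finset.sum_congr rfl fun w hw => by rw [htyp w w0 (Finset.mem_filter.mp hw).2]
            _ ≤ ∑ w : Fin n → A, ∏ i, typ w0 (w i) :=
                Finset.sum_le_sum_of_subset_of_nonneg (Finset.filter_subset _ _)
                  fun w _ _ => Finset.prod_nonneg fun i _ => (typ_mem hn w0).1 _
            _ = 1 := sum_prod_eq_one (typ_mem hn w0).2
        · push Not at hc
          rw [Finset.filter_false_of_mem fun w _ => hc w]
          simp
    _ = ((n : ℝ) + 1) ^ Fintype.card A := by
        simp

/-- The upper bound of Sanov's theorem. -/
theorem prob_le_of_le_klDiv (hn : n ≠ 0) {q : A → ℝ} (hq : q ∈ stdSimplex ℝ A)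
    {G : Set (Fin n → A)} {e : ℝ} (h : ∀ w ∈ G, ENNReal.ofReal e ≤ klDiv (typ w) q) :
    prob q G ≤ ((n : ℝ) + 1) ^ Fintype.card A * Real.exp (-(n * e)) := by
  calc prob q G ≤ ∑ w : Fin n → A, Real.exp (-(n * e)) * ∏ i, typ w (w i) := by
        refine Finset.sum_le_sum fun w _ => ?_
        have h0 : 0 ≤ Real.exp (-(n * e)) * ∏ i, typ w (w i) :=
          mul_nonneg (Real.exp_pos _).le (Finset.prod_nonneg fun i _ => (typ_mem hn w).1 _)
        by_cases hw : w ∈ G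
        swap
        · simpa [hw] using h0
        simp only [hw, Set.indicator_of_mem, Pi.one_apply, mul_one]
        by_cases hz : ∏ i, q (w i) = 0
        · rw [hz]; exact h0
        have hqi : ∀ i, 0 < q (w i) := fun i =>
          lt_of_le_of_ne (hq.1 _) fun h => hz (Finset.prod_eq_zero (Finset.mem_univ i) h.symm)
        have hti : ∀ i, 0 < typ w (w i) := fun i =>
          lt_of_le_of_ne ((typ_mem hn w).1 _) (typ_ne_zero hn w i).symm
        have hdom : ∀ a, q a = 0 → typ w a = 0 := by
          intro a ha
          by_contra hc
          obtain ⟨i, rfl⟩ := exists_of_typ_ne_zero hc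
          exact (hqi i).ne' ha
        have he := h w hw
        rw [klDiv_eq hdom, ENNReal.ofReal_le_ofReal_iff (klReal_nonneg (typ_mem hn w) hq hdom)]
          at he
        have h1 : ∏ i, q (w i) = Real.exp (-(n * klReal (typ w) q)) * ∏ i, typ w (w i) := by
          have e1 : ∏ i, q (w i) = Real.exp (∑ i, Real.log (q (w i))) := by
            rw [Real.exp_sum]
            exact Finset.prod_congr rfl fun i _ => (Real.exp_log (hqi i)).symm
          have e2 : ∏ i, typ w (w i) = Real.exp (∑ i, Real.log (typ w (w i))) := by
            rw [Real.exp_sum]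
            exact Finset.prod_congr rfl fun i _ => (Real.exp_log (hti i)).symm
          rw [e1, e2, ← Real.exp_add, sum_comp_eq hn w fun a => Real.log (q a),
            sum_comp_eq hn w fun a => Real.log (typ w a), klReal, Finset.sum_sub_distrib]
          congr 1
          ring
        rw [h1]
        refine mul_le_mul_of_nonneg_right (Real.exp_le_exp.mpr ?_)
          (Finset.prod_nonneg fun i _ => (hti i).le)
        have : (n : ℝ) * e ≤ n * klReal (typ w) q :=
          mul_le_mul_of_nonneg_left he (Nat.cast_nonneg n)
        linarith
    _ ≤ _ := by
        rw [← Finset.mul_sum, mul_comm]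
        exact mul_le_mul_of_nonneg_right (sum_prod_typ_le hn) (Real.exp_pos _).le

/-- The set of weights that are dominated by `q` and differ from `q` by at most `μ` at each
letter. -/
def near (q : A → ℝ) (μ : ℝ) : Set (A → ℝ) :=
  {p | (∀ a, |p a - q a| ≤ μ) ∧ ∀ a, q a = 0 → p a = 0}

lemma prob_typ_notMem_near_le (hn : n ≠ 0) {q : A → ℝ} (hq : q ∈ stdSimplex ℝ A) {μ : ℝ}
    (hμ : 0 ≤ μ) : prob q {w : Fin n → A | typ w ∉ near q μ} ≤
      ((n : ℝ) + 1) ^ Fintype.card A * Real.exp (-(n * (μ ^ 2 / 4))) := by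
  refine prob_le_of_le_klDiv hn hq fun w hw => ?_
  by_cases hdom : ∀ a, q a = 0 → typ w a = 0
  · have : ¬ ∀ a, |typ w a - q a| ≤ μ := fun h => hw ⟨h, hdom⟩
    push Not at this
    obtain ⟨a, ha⟩ := this
    exact le_klDiv_of_lt_abs_sub (typ_mem hn w) hq hμ ha
  · rw [klDiv, if_neg hdom]
    exact le_top

omit [Fintype A] in
lemma typ_fst {B : Type*} [Fintype B] (w : Fin n → A × B) :
    typ (fun i => (w i).1) = fstMarg (typ w) := by
  classical
  funext a
  simp only [typ, fstMarg, ← Finset.sum_div]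
  congr 1
  rw [← Nat.cast_sum]
  congr 1
  rw [← Finset.card_biUnion]
  · congr 1
    ext i
    simp [Prod.ext_iff]
  · intro b _ b' _ hne
    rw [Function.onFun, Finset.disjoint_left]
    intro i hi hi'
    simp only [Finset.mem_filter] at hi hi'
    exact hne (Prod.ext_iff.mp (hi.2.symm.trans hi'.2)).2

omit [Fintype A] in
lemma typ_snd {B : Type*} [Fintype B] (w : Fin n → B × A) :
    typ (fun i => (w i).2) = sndMarg (typ w) := by
  classical
  funext a
  simp only [typ, sndMarg, ← Finset.sum_div]
  congr 1
  rw [← Nat.cast_sum]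
  congr 1
  rw [← Finset.card_biUnion]
  · congr 1
    ext i
    simp [Prod.ext_iff]
  · intro b _ b' _ hne
    rw [Function.onFun, Finset.disjoint_left]
    intro i hi hi'
    simp only [Finset.mem_filter] at hi hi'
    exact hne (Prod.ext_iff.mp (hi.2.symm.trans hi'.2)).1

end Types

/-! ### Covert codes use few nonzero inputs -/

section Converse

lemma sum_prod_mul_apply {A : Type*} [Fintype A] {n : ℕ} {p : Fin n → A → ℝ}
    (hp : ∀ i, ∑ a, p i a = 1) (g : A → ℝ) (j : Fin n) :
    ∑ w : Fin n → A, (∏ i, p i (w i)) * g (w j) = ∑ a, p j a * g a := by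
  classical
  have h1 : ∀ w : Fin n → A, (∏ i, p i (w i)) * g (w j) =
      ∏ i, p i (w i) * (if i = j then g (w i) else 1) := by
    intro w
    rw [Finset.prod_mul_distrib]
    simp
  simp only [h1]
  rw [← Fintype.piFinset_univ,
    ← Finset.prod_univ_sum (fun _ => Finset.univ) fun i a => p i a * (if i = j then g a else 1),
    Finset.prod_eq_single j]
  · simp
  · intro i _ hij
    simp [hij, hp]
  · simp

lemma sum_prod_channel_eq_one {A : Type*} [Fintype A] {n : ℕ} {p : Fin n → A → ℝ}
    (hp : ∀ i, ∑ a, p i a = 1) : ∑ w : Fin n → A, ∏ i, p i (w i) = 1 := by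
  classical
  rw [← Fintype.piFinset_univ, ← Finset.prod_univ_sum]
  simp [hp]

variable {U V X Y Z : Type*} [Fintype U] [Fintype V] [Fintype X] [Fintype Y] [Fintype Z] [Zero X]

omit [Fintype X] [Zero X] in
lemma chanY_mem {Γ : X → Y × Z → ℝ} (hΓ : ∀ x, Γ x ∈ stdSimplex ℝ (Y × Z)) (x : X) :
    chanY Γ x ∈ stdSimplex ℝ Y := fstMarg_mem (hΓ x)

omit [Fintype X] [Zero X] in
lemma chanZ_mem {Γ : X → Y × Z → ℝ} (hΓ : ∀ x, Γ x ∈ stdSimplex ℝ (Y × Z)) (x : X) :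
    chanZ Γ x ∈ stdSimplex ℝ Z := sndMarg_mem (hΓ x)

omit [Zero X] in
/-- The expected empirical frequency of an output letter, for a given input word. -/
lemma sum_prod_mul_typ {n : ℕ} (hn : n ≠ 0) {W : X → Z → ℝ} (hW : ∀ x, W x ∈ stdSimplex ℝ Z)
    (x : Fin n → X) (a : Z) :
    ∑ z : Fin n → Z, (∏ i, W (x i) (z i)) * typ z a = ∑ b, typ x b * W b a := by
  classical
  have hn' : (n : ℝ) ≠ 0 := by exact_mod_cast hn
  have h1 : ∀ z : Fin n → Z, (n : ℝ) * typ z a = ∑ j, if z j = a then 1 else 0 := by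
    intro z
    rw [sum_comp_eq hn z fun b => if b = a then 1 else 0]
    simp
  refine mul_left_cancel₀ hn' ?_
  rw [← sum_comp_eq hn x fun b => W b a, Finset.mul_sum]
  calc ∑ z : Fin n → Z, n * ((∏ i, W (x i) (z i)) * typ z a)
      = ∑ z : Fin n → Z, ∑ j, (∏ i, W (x i) (z i)) * (if z j = a then 1 else 0) :=
        Finset.sum_congr rfl fun z _ => by rw [← Finset.mul_sum, ← h1]; ring
    _ = ∑ j, ∑ b, W (x j) b * (if b = a then 1 else 0) := by
        rw [Finset.sum_comm]
        exact Finset.sum_congr rfl fun j _ =>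
          sum_prod_mul_apply (p := fun i => W (x i)) (fun i => (hW _).2)
            (fun b => if b = a then 1 else 0) j
    _ = ∑ j, W (x j) a := by simp

/-- The expected type of the channel input under the null hypothesis. -/
noncomputable def avgType (P : U × V → ℝ) {n K : ℕ} (c : Code U V X Y n K) (x : X) : ℝ :=
  (1 / (K : ℝ)) * ∑ s, mean (fstMarg P) fun u => typ (c.enc u s) x

omit [Fintype Y] [Zero X] in
lemma avgType_mem {P : U × V → ℝ} (hP : P ∈ stdSimplex ℝ (U × V)) {n K : ℕ} (hn : n ≠ 0)
    (hK : 0 < K) (c : Code U V X Y n K) : avgType P c ∈ stdSimplex ℝ X := by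
  have hK' : (K : ℝ) ≠ 0 := by exact_mod_cast hK.ne'
  refine ⟨fun x => mul_nonneg (by positivity) (Finset.sum_nonneg fun s _ =>
    mean_nonneg (fstMarg_mem hP).1 fun u => (typ_mem hn _).1 _), ?_⟩
  simp only [avgType]
  rw [← Finset.mul_sum, Finset.sum_comm]
  have : ∀ s, ∑ x, mean (fstMarg P) (fun u => typ (c.enc u s) x) = 1 := by
    intro s
    rw [← mean_sum]
    simp only [(typ_mem hn _).2]
    exact mean_const (fstMarg_mem hP).2 1
  simp [this, hK']

omit [Fintype X] [Zero X] in
lemma wardenLaw_mem {P : U × V → ℝ} (hP : P ∈ stdSimplex ℝ (U × V)) {Γ : X → Y × Z → ℝ}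
    (hΓ : ∀ x, Γ x ∈ stdSimplex ℝ (Y × Z)) {n K : ℕ} (hK : 0 < K) (c : Code U V X Y n K) :
    wardenLaw P Γ c ∈ stdSimplex ℝ (Fin n → Z) := by
  have hK' : (K : ℝ) ≠ 0 := by exact_mod_cast hK.ne'
  refine ⟨fun z => mul_nonneg (by positivity) (Finset.sum_nonneg fun s _ =>
    Finset.sum_nonneg fun u _ => mul_nonneg (Finset.prod_nonneg fun i _ => (fstMarg_mem hP).1 _)
      (Finset.prod_nonneg fun i _ => (chanZ_mem hΓ _).1 _)), ?_⟩
  simp only [wardenLaw]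
  rw [← Finset.mul_sum, Finset.sum_comm]
  have : ∀ s, ∑ z : Fin n → Z, ∑ u : Fin n → U, (∏ i, fstMarg P (u i)) *
      ∏ i, chanZ Γ (c.enc u s i) (z i) = 1 := by
    intro s
    rw [Finset.sum_comm]
    simp only [← Finset.mul_sum]
    rw [← mean_const (n := n) (fstMarg_mem hP).2 1]
    exact Finset.sum_congr rfl fun u _ => by
      rw [sum_prod_channel_eq_one (p := fun i => chanZ Γ (c.enc u s i))
        fun i => (chanZ_mem hΓ _).2]
  simp [this, hK']

omit [Zero X] in
/-- The warden's expected empirical frequencies are the outputs of the expected input type. -/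
lemma sum_wardenLaw_mul_typ {P : U × V → ℝ} {Γ : X → Y × Z → ℝ}
    (hΓ : ∀ x, Γ x ∈ stdSimplex ℝ (Y × Z)) {n K : ℕ} (hn : n ≠ 0) (c : Code U V X Y n K) (a : Z) :
    ∑ z, wardenLaw P Γ c z * typ z a = ∑ x, avgType P c x * chanZ Γ x a := by
  have h1 : ∀ z : Fin n → Z, wardenLaw P Γ c z * typ z a = (1 / (K : ℝ)) * ∑ s,
      ∑ u, (∏ i, fstMarg P (u i)) * ((∏ i, chanZ Γ (c.enc u s i) (z i)) * typ z a) := by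
    intro z
    simp only [wardenLaw, mul_assoc, Finset.sum_mul]
  have h2 : ∀ x, avgType P c x * chanZ Γ x a = (1 / (K : ℝ)) * ∑ s,
      ∑ u, (∏ i, fstMarg P (u i)) * (typ (c.enc u s) x * chanZ Γ x a) := by
    intro x
    simp only [avgType, mean, mul_assoc, Finset.sum_mul]
  simp only [h1, h2, ← Finset.mul_sum]
  rw [Finset.sum_comm]
  nth_rewrite 2 [Finset.sum_comm]
  congr 1
  refine Finset.sum_congr rfl fun s _ => ?_
  rw [Finset.sum_comm]
  nth_rewrite 2 [Finset.sum_comm]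
  refine Finset.sum_congr rfl fun u _ => ?_
  rw [← Finset.mul_sum, ← Finset.mul_sum, sum_prod_mul_typ hn (chanZ_mem hΓ)]

lemma typ_zero {n : ℕ} (hn : n ≠ 0) (h : X → ℝ) : ∑ x, typ (0 : Fin n → X) x * h x = h 0 := by
  have hn' : (n : ℝ) ≠ 0 := by exact_mod_cast hn
  refine mul_left_cancel₀ hn' ?_
  rw [← sum_comp_eq hn (0 : Fin n → X) h]
  simp

/-- A covert code has an expected input type that the warden's channel maps near `Γ_{Z|X}(·|0)`:
empirical frequencies are bounded test functions, so that their means are controlled by the total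
variation distance and hence by the divergence. -/
lemma abs_avgType_output_sub_le {P : U × V → ℝ} (hP : P ∈ stdSimplex ℝ (U × V))
    {Γ : X → Y × Z → ℝ} (hΓ : ∀ x, Γ x ∈ stdSimplex ℝ (Y × Z)) {n K : ℕ} (hn : n ≠ 0)
    (hK : 0 < K) (c : Code U V X Y n K) {δ : ℝ} (hδ : 0 < δ)
    (hd : wardenDiv P Γ c < ENNReal.ofReal (δ ^ 2 / 4)) (a : Z) :
    |∑ x, avgType P c x * chanZ Γ x a - chanZ Γ 0 a| ≤ δ := by
  set q : (Fin n → Z) → ℝ := fun z => ∏ i, chanZ Γ 0 (z i) with hq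
  have hqmem : q ∈ stdSimplex ℝ (Fin n → Z) :=
    ⟨fun z => Finset.prod_nonneg fun i _ => (chanZ_mem hΓ _).1 _,
      sum_prod_eq_one (chanZ_mem hΓ 0).2⟩
  have hw := wardenLaw_mem hP hΓ hK c
  obtain ⟨hdom, hlt⟩ := klReal_lt_of_klDiv_lt hd
  have h1 := sq_sum_abs_sub_le hw hqmem hdom
  have h2 : ∑ z, |wardenLaw P Γ c z - q z| ≤ δ := by
    refine abs_le_of_sq_le_sq' (by linarith) hδ.le |>.2
  have h3 : chanZ Γ 0 a = ∑ z, q z * typ z a := by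
    rw [← typ_zero (X := X) hn fun x => chanZ Γ x a, ← sum_prod_mul_typ hn (chanZ_mem hΓ)]
    rfl
  rw [h3, ← sum_wardenLaw_mul_typ hΓ hn, ← Finset.sum_sub_distrib]
  refine (Finset.abs_sum_le_sum_abs _ _).trans (le_trans (Finset.sum_le_sum fun z _ => ?_) h2)
  rw [← sub_mul, abs_mul, abs_of_nonneg ((typ_mem hn z).1 a)]
  exact mul_le_of_le_one_right (abs_nonneg _)
    ((Finset.single_le_sum (fun b _ => (typ_mem hn z).1 b) (Finset.mem_univ a)).trans
      (typ_mem hn z).2.le)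

/-- If no mixture of the nonzero inputs simulates the input `0`, then an input law whose output is
close to that of the input `0` is concentrated at `0`, by compactness: the part of an input law
outside of `0` would, after normalization, be such a mixture if its output were equal. -/
lemma exists_concentration {W : X → Z → ℝ}
    (hsim : ∀ ψ ∈ stdSimplex ℝ X, ψ 0 = 0 → (fun z => ∑ x, ψ x * W x z) ≠ W 0)
    {η : ℝ} (hη : 0 < η) : ∃ δ, 0 < δ ∧ ∀ t ∈ stdSimplex ℝ X,
      (∀ a, |∑ x, t x * W x a - W 0 a| ≤ δ) → 1 - t 0 < η := by
  classical
  set S : Set (X → ℝ) := stdSimplex ℝ X ∩ {t | η ≤ 1 - t 0} with hS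
  have hScomp : IsCompact S := (isCompact_stdSimplex ℝ X).inter_right
    (isClosed_le continuous_const (continuous_const.sub (continuous_apply 0)))
  set G : (X → ℝ) → ℝ := fun t => ∑ a, |∑ x, t x * W x a - W 0 a| with hG
  have hGc : Continuous G := by
    refine continuous_finsetSum _ fun a _ => ?_
    refine Continuous.abs (Continuous.sub ?_ continuous_const)
    exact continuous_finsetSum _ fun x _ => (continuous_apply x).mul continuous_const
  have hpos : ∀ t ∈ S, 0 < G t := by
    rintro t ⟨ht, ht0⟩
    refine lt_of_le_of_ne (Finset.sum_nonneg fun _ _ => abs_nonneg _) fun h0 => ?_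
    have h1 : ∀ a, ∑ x, t x * W x a = W 0 a := by
      intro a
      have := (Finset.sum_eq_zero_iff_of_nonneg fun a _ => abs_nonneg _).mp h0.symm a
        (Finset.mem_univ a)
      exact sub_eq_zero.mp (abs_eq_zero.mp this)
    have hlt : 0 < 1 - t 0 := hη.trans_le ht0
    have hsplit : ∀ h : X → ℝ, ∑ x, (if x = 0 then 0 else t x / (1 - t 0)) * h x =
        (∑ x, t x * h x - t 0 * h 0) / (1 - t 0) := by
      intro h
      have : ∑ x, t x * h x - t 0 * h 0 = ∑ x, if x = 0 then 0 else t x * h x := by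
        rw [sub_eq_iff_eq_add, ← Finset.sum_erase_add _ _ (Finset.mem_univ (0 : X))]
        congr 1
        rw [← Finset.sum_erase_add _ _ (Finset.mem_univ (0 : X))]
        simp only [if_true, add_zero]
        exact Finset.sum_congr rfl fun x hx => by rw [if_neg (Finset.ne_of_mem_erase hx)]
      rw [this, Finset.sum_div]
      exact Finset.sum_congr rfl fun x _ => by split_ifs <;> ring
    refine hsim (fun x => if x = 0 then 0 else t x / (1 - t 0)) ⟨fun x => ?_, ?_⟩ (by simp) ?_
    · dsimp only
      split_ifs
      · exact le_rfl
      · exact div_nonneg (ht.1 x) hlt.le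
    · have := hsplit fun _ => 1
      simp only [mul_one, ht.2] at this
      rw [this, div_self hlt.ne']
    · funext z
      rw [hsplit fun x => W x z, h1, div_eq_iff hlt.ne']
      ring
  rcases S.eq_empty_or_nonempty with hemp | hne
  · refine ⟨1, one_pos, fun t ht _ => ?_⟩
    by_contra hc
    have : t ∈ S := ⟨ht, not_lt.mp hc⟩
    rw [hemp] at this
    exact this
  · obtain ⟨t0, ht0, hmin⟩ := hScomp.exists_isMinOn hne hGc.continuousOn
    have hc := hpos t0 ht0
    refine ⟨G t0 / (Fintype.card Z + 1), by positivity, fun t ht hle => ?_⟩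
    by_contra hcon
    have h1 : G t0 ≤ G t := hmin (show t ∈ S from ⟨ht, not_lt.mp hcon⟩)
    have h2 : G t ≤ Fintype.card Z * (G t0 / (Fintype.card Z + 1)) := by
      calc G t ≤ ∑ a : Z, G t0 / (Fintype.card Z + 1) := Finset.sum_le_sum fun a _ => hle a
        _ = _ := by simp
    have h3 : (Fintype.card Z : ℝ) * (G t0 / (Fintype.card Z + 1)) < G t0 := by
      rw [mul_div_assoc', div_lt_iff₀ (by positivity)]
      nlinarith
    linarith

/-- There are subexponentially many input words with a small fraction of nonzero symbols, by Markov's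
inequality for `θ` to the power of the number of nonzero symbols. -/
lemma exists_card_light_le (X : Type*) [Fintype X] [Zero X] {ζ : ℝ} (hζ : 0 < ζ) :
    ∃ η, 0 < η ∧ ∀ n : ℕ, n ≠ 0 →
    ((open Classical in Finset.univ.filter fun x : Fin n → X => 1 - typ x 0 ≤ η).card : ℝ) ≤
      Real.exp (n * ζ) := by
  classical
  set k : ℝ := (Fintype.card X : ℝ) with hk
  have hk0 : 0 ≤ k := Nat.cast_nonneg _
  set θ : ℝ := min (1 / 2) (ζ / (2 * (k + 1))) with hθ
  have hθ0 : 0 < θ := lt_min (by norm_num) (by positivity)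
  have hθ1 : θ < 1 := lt_of_le_of_lt (min_le_left _ _) (by norm_num)
  have hθk : k * θ ≤ ζ / 2 := by
    calc k * θ ≤ (k + 1) * (ζ / (2 * (k + 1))) :=
          mul_le_mul (by linarith) (min_le_right _ _) hθ0.le (by linarith)
      _ = ζ / 2 := by field_simp
  have hlog : 0 < -Real.log θ := neg_pos.mpr (Real.log_neg hθ0 hθ1)
  refine ⟨ζ / (2 * -Real.log θ), by positivity, fun n hn => ?_⟩
  set η := ζ / (2 * -Real.log θ) with hη
  have hηθ : η * -Real.log θ = ζ / 2 := by
    rw [hη, div_mul_eq_mul_div, mul_div_mul_right _ _ hlog.ne']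
  have hn' : (0 : ℝ) < n := by exact_mod_cast Nat.pos_of_ne_zero hn
  have hprod : ∀ x : Fin n → X, ∏ i, (if x i = 0 then 1 else θ) =
      Real.exp (n * (1 - typ x 0) * Real.log θ) := by
    intro x
    have h1 : ∏ i, (if x i = 0 then 1 else θ) =
        Real.exp (∑ i, if x i = 0 then 0 else Real.log θ) := by
      rw [Real.exp_sum]
      exact Finset.prod_congr rfl fun i _ => by split_ifs <;> simp [Real.exp_log hθ0]
    rw [h1, sum_comp_eq hn x fun b => if b = 0 then 0 else Real.log θ, mul_assoc]
    congr 2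
    have h2 : ∀ b : X, typ x b * (if b = 0 then 0 else Real.log θ) =
        typ x b * Real.log θ - if b = 0 then typ x b * Real.log θ else 0 := by
      intro b; split_ifs <;> simp
    simp only [h2, Finset.sum_sub_distrib, ← Finset.sum_mul, (typ_mem hn x).2]
    simp
    ring
  have hsum : ∑ x : Fin n → X, ∏ i, (if x i = 0 then 1 else θ) ≤ Real.exp (n * (k * θ)) := by
    rw [sum_prod_pow (A := X) (fun b => if b = 0 then 1 else θ), Real.exp_nat_mul]
    refine pow_le_pow_left₀ (Finset.sum_nonneg fun b _ => by split_ifs <;> linarith) ?_ n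
    calc ∑ b : X, (if b = 0 then 1 else θ) ≤ ∑ b : X, ((if b = 0 then 1 else 0) + θ) :=
          Finset.sum_le_sum fun b _ => by split_ifs <;> linarith
      _ = k * θ + 1 := by
          rw [Finset.sum_add_distrib]; simp [hk, add_comm]
      _ ≤ Real.exp (k * θ) := Real.add_one_le_exp _
  have h1 : ((Finset.univ.filter fun x : Fin n → X => 1 - typ x 0 ≤ η).card : ℝ) *
      Real.exp (n * η * Real.log θ) ≤ Real.exp (n * (k * θ)) := by
    refine le_trans ?_ hsum
    rw [← nsmul_eq_mul, ← Finset.sum_const]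
    refine (Finset.sum_le_sum fun x hx => ?_).trans (Finset.sum_le_sum_of_subset_of_nonneg
      (Finset.filter_subset _ _) fun x _ _ => Finset.prod_nonneg fun i _ => by
        split_ifs <;> linarith)
    rw [hprod]
    apply Real.exp_le_exp.mpr
    have := (Finset.mem_filter.mp hx).2
    exact mul_le_mul_of_nonpos_right (mul_le_mul_of_nonneg_left this hn'.le) (by linarith)
  rw [← le_div_iff₀ (Real.exp_pos _), ← Real.exp_sub] at h1
  refine h1.trans (Real.exp_le_exp.mpr ?_)
  have : (n : ℝ) * (k * θ) - n * η * Real.log θ = n * (k * θ + η * -Real.log θ) := by ring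
  rw [this, hηθ]
  exact mul_le_mul_of_nonneg_left (by linarith) hn'.le

end Converse

/-! ### The upper bound on the exponent -/

section ConverseBound

variable {U V X Y Z : Type*} [Fintype U] [Fintype V] [Fintype X] [Fintype Y] [Fintype Z] [Zero X]

/-- The source words that are encoded as `x`. -/
def encFiber {n K : ℕ} (c : Code U V X Y n K) (s : Fin K) (x : Fin n → X) : Set (Fin n → U) :=
  {u | c.enc u s = x}

/-- The side information words for which `j` is declared. -/
def decFiber {n K : ℕ} (c : Code U V X Y n K) (s : Fin K) (y : Fin n → Y) (j : Fin 2) :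
    Set (Fin n → V) := {v | c.dec v y s = j}

omit [Zero X] in
/-- For a fixed key, input word and output word, `j` is declared on a rectangle. -/
lemma guessProb_eq (W : U × V → ℝ) (Γ : X → Y × Z → ℝ) {n K : ℕ} (c : Code U V X Y n K)
    (j : Fin 2) : guessProb W Γ c j = (1 / (K : ℝ)) * ∑ s, ∑ x : Fin n → X, ∑ y : Fin n → Y,
      (∏ i, chanY Γ (x i) (y i)) * prob W (rect (encFiber c s x) (decFiber c s y j)) := by
  classical
  rw [guessProb]
  congr 1
  refine Finset.sum_congr rfl fun s _ => ?_
  have h1 : ∀ x : Fin n → X, ∀ y : Fin n → Y,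
      prob W (rect (encFiber c s x) (decFiber c s y j)) =
      ∑ u : Fin n → U, if c.enc u s = x then
        ∑ v : Fin n → V, (∏ i, W (u i, v i)) * (if c.dec v y s = j then 1 else 0) else 0 := by
    intro x y
    rw [prob, mean, ← sum_pair (F := fun u v => (∏ i, W (u i, v i)) *
      (rect (encFiber c s x) (decFiber c s y j)).indicator 1 (fun i => (u i, v i)))]
    refine Finset.sum_congr rfl fun u _ => ?_
    split_ifs with hu
    · refine Finset.sum_congr rfl fun v _ => ?_
      congr 1
      simp [rect, encFiber, decFiber, hu, Set.indicator_apply]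
    · refine Finset.sum_eq_zero fun v _ => ?_
      simp [rect, encFiber, hu]
  have h2 : ∀ x : Fin n → X, ∑ y : Fin n → Y, (∏ i, chanY Γ (x i) (y i)) *
      ∑ u : Fin n → U, (if c.enc u s = x then
        ∑ v : Fin n → V, (∏ i, W (u i, v i)) * (if c.dec v y s = j then 1 else 0) else 0) =
      ∑ u : Fin n → U, if c.enc u s = x then ∑ y : Fin n → Y, (∏ i, chanY Γ (c.enc u s i) (y i)) *
        ∑ v : Fin n → V, (∏ i, W (u i, v i)) * (if c.dec v y s = j then 1 else 0) else 0 := by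
    intro x
    refine (Finset.sum_congr rfl fun y _ => Finset.mul_sum _ _ _).trans ?_
    rw [Finset.sum_comm]
    refine Finset.sum_congr rfl fun u _ => ?_
    split_ifs with hu
    · rw [hu]
    · simp
  simp_rw [h1, h2]
  refine Eq.trans ?_ Finset.sum_comm
  refine Finset.sum_congr rfl fun u _ => ?_
  simp only [Finset.sum_ite_eq, Finset.mem_univ, if_true, Finset.mul_sum]
  rw [Finset.sum_comm]
  exact Finset.sum_congr rfl fun v _ => Finset.sum_congr rfl fun y _ => by ring

omit [Zero X] [Fintype X] in
lemma guessProb_add {W : U × V → ℝ} (hW : W ∈ stdSimplex ℝ (U × V)) {Γ : X → Y × Z → ℝ}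
    (hΓ : ∀ x, Γ x ∈ stdSimplex ℝ (Y × Z)) {n K : ℕ} (hK : 0 < K) (c : Code U V X Y n K) :
    guessProb W Γ c 0 + guessProb W Γ c 1 = 1 := by
  have hK' : (K : ℝ) ≠ 0 := by exact_mod_cast hK.ne'
  rw [guessProb, guessProb, ← mul_add]
  simp only [← Finset.sum_add_distrib, ← mul_add]
  have h1 : ∀ s (u : Fin n → U) (v : Fin n → V), ∑ y : Fin n → Y,
      (∏ i, chanY Γ (c.enc u s i) (y i)) *
      ((if c.dec v y s = 0 then 1 else 0) + (if c.dec v y s = 1 then 1 else 0)) = 1 := by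
    intro s u v
    refine Eq.trans (Finset.sum_congr rfl fun y _ => ?_) (sum_prod_channel_eq_one
      (p := fun i => chanY Γ (c.enc u s i)) fun i => (chanY_mem hΓ _).2)
    have : c.dec v y s = 0 ∨ c.dec v y s = 1 := by
      generalize c.dec v y s = d
      fin_cases d <;> simp
    rcases this with h | h <;> simp [h]
  simp only [h1, mul_one]
  rw [Finset.sum_congr rfl fun s _ => (sum_pair (n := n) (F := fun u v => ∏ i, W (u i, v i))).trans
    (sum_prod_eq_one hW.2)]
  simp [hK']

omit [Zero X] [Fintype X] in
lemma guessProb_nonneg {W : U × V → ℝ} (hW : ∀ w, 0 ≤ W w) {Γ : X → Y × Z → ℝ}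
    (hΓ : ∀ x, Γ x ∈ stdSimplex ℝ (Y × Z)) {n K : ℕ} (c : Code U V X Y n K) (j : Fin 2) :
    0 ≤ guessProb W Γ c j :=
  mul_nonneg (by positivity) (Finset.sum_nonneg fun s _ => Finset.sum_nonneg fun u _ =>
    Finset.sum_nonneg fun v _ => mul_nonneg (Finset.prod_nonneg fun i _ => hW _)
      (Finset.sum_nonneg fun y _ => mul_nonneg
        (Finset.prod_nonneg fun i _ => (chanY_mem hΓ _).1 _) (by split_ifs <;> simp)))

omit [Zero X] [Fintype X] in
lemma guessProb_le_one {W : U × V → ℝ} (hW : W ∈ stdSimplex ℝ (U × V)) {Γ : X → Y × Z → ℝ}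
    (hΓ : ∀ x, Γ x ∈ stdSimplex ℝ (Y × Z)) {n K : ℕ} (hK : 0 < K) (c : Code U V X Y n K)
    (j : Fin 2) : guessProb W Γ c j ≤ 1 := by
  have h := guessProb_add hW hΓ hK c
  have h0 := guessProb_nonneg hW.1 hΓ c 0
  have h1 := guessProb_nonneg hW.1 hΓ c 1
  have : j = 0 ∨ j = 1 := by fin_cases j <;> simp
  rcases this with rfl | rfl <;> linarith

/-- Comparison of the acceptance probabilities under the two hypotheses. Rectangles of input words
that are not light are unlikely because the code is covert, those of probability below `ρ` under
`P` are harmless because there are few light words, and the others are compared one by one. -/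
lemma guessProb_zero_le {P Q : U × V → ℝ} (hP : P ∈ stdSimplex ℝ (U × V)) (hQ : ∀ w, 0 ≤ Q w)
    {Γ : X → Y × Z → ℝ} (hΓ : ∀ x, Γ x ∈ stdSimplex ℝ (Y × Z)) {n K : ℕ} (hn : n ≠ 0)
    (hK : 0 < K) (c : Code U V X Y n K) {η ρ E N : ℝ} (hη : 0 < η) (hρ : 0 ≤ ρ) (hE : 0 < E)
    (hN : ((open Classical in Finset.univ.filter fun x : Fin n → X => 1 - typ x 0 ≤ η).card : ℝ)
      ≤ N)
    (hrect : ∀ (S : Set (Fin n → U)) (T : Set (Fin n → V)),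
      ρ ≤ prob P (rect S T) → 1 ≤ E * prob Q (rect S T)) :
    guessProb P Γ c 0 ≤ (1 - avgType P c 0) / η + N * ρ + E * guessProb Q Γ c 0 := by
  classical
  have hK' : (K : ℝ) ≠ 0 := by exact_mod_cast hK.ne'
  set a : (Fin n → X) → (Fin n → Y) → ℝ := fun x y => ∏ i, chanY Γ (x i) (y i) with ha
  have ha0 : ∀ x y, 0 ≤ a x y := fun x y => Finset.prod_nonneg fun i _ => (chanY_mem hΓ _).1 _
  have ha1 : ∀ x, ∑ y, a x y = 1 := fun x =>
    sum_prod_channel_eq_one (p := fun i => chanY Γ (x i)) fun i => (chanY_mem hΓ _).2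
  have hle : ∀ s x y, prob P (rect (encFiber c s x) (decFiber c s y 0)) ≤
      (1 - typ x 0) / η * prob (fstMarg P) (encFiber c s x) +
      (if 1 - typ x 0 ≤ η then ρ else 0) +
      E * prob Q (rect (encFiber c s x) (decFiber c s y 0)) := by
    intro s x y
    set R := rect (encFiber c s x) (decFiber c s y 0) with hR
    have hPU : prob P R ≤ prob (fstMarg P) (encFiber c s x) := by
      rw [prob, prob, ← mean_fst P]
      refine mean_mono hP.1 fun w => ?_
      by_cases hw : (fun i => (w i).1) ∈ encFiber c s x
      · simp only [hw, Set.indicator_of_mem, Pi.one_apply]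
        exact Set.indicator_le_self' (fun _ _ => zero_le_one) w
      · have : w ∉ R := fun h => hw h.1
        simp [hw, this]
    have hP0 : 0 ≤ prob P R := prob_nonneg hP.1 _
    have hQ0 : 0 ≤ E * prob Q R := mul_nonneg hE.le (prob_nonneg hQ _)
    have ht : 0 ≤ 1 - typ x 0 := sub_nonneg.mpr
      ((Finset.single_le_sum (fun b _ => (typ_mem hn x).1 b) (Finset.mem_univ 0)).trans
        (typ_mem hn x).2.le)
    have hU0 : 0 ≤ (1 - typ x 0) / η * prob (fstMarg P) (encFiber c s x) :=
      mul_nonneg (div_nonneg ht hη.le) (prob_nonneg (fstMarg_mem hP).1 _)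
    split_ifs with hx
    · rcases le_or_gt ρ (prob P R) with h | h
      · have h1 := hrect _ _ h
        have h2 : prob P R ≤ 1 := prob_le_one hP _
        linarith
      · linarith
    · have h1 : 1 ≤ (1 - typ x 0) / η := by
        rw [le_div_iff₀ hη]; linarith
      have h2 := mul_le_mul_of_nonneg_right h1 (prob_nonneg (fstMarg_mem hP).1 (encFiber c s x))
      linarith
  have h1 : ∀ s, ∑ x, (1 - typ x 0) / η * prob (fstMarg P) (encFiber c s x) =
      (1 - mean (fstMarg P) fun u => typ (c.enc u s) 0) / η := by
    intro s
    have e1 : ∀ x : Fin n → X, (1 - typ x 0) / η * prob (fstMarg P) (encFiber c s x) =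
        mean (fstMarg P) fun u => (1 - typ x 0) / η * (encFiber c s x).indicator 1 u :=
      fun x => (mean_mul_left _ _ _).symm
    simp only [e1]
    rw [← mean_sum]
    have e2 : ∀ u : Fin n → U, ∑ x, (1 - typ x 0) / η * (encFiber c s x).indicator 1 u =
        1 / η + (-1 / η) * typ (c.enc u s) 0 := by
      intro u
      rw [Finset.sum_eq_single (c.enc u s)]
      · simp [encFiber]; ring
      · intro x _ hx
        have : u ∉ encFiber c s x := fun h => hx h.symm
        simp [this]
      · simp
    simp only [e2]
    rw [mean_add (h := fun _ => 1 / η), mean_const (fstMarg_mem hP).2, mean_mul_left]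
    ring
  rw [guessProb_eq]
  calc (1 / (K : ℝ)) * ∑ s, ∑ x : Fin n → X, ∑ y : Fin n → Y,
        a x y * prob P (rect (encFiber c s x) (decFiber c s y 0))
      ≤ (1 / (K : ℝ)) * ∑ s, ∑ x : Fin n → X, ∑ y : Fin n → Y,
        a x y * ((1 - typ x 0) / η * prob (fstMarg P) (encFiber c s x) +
          (if 1 - typ x 0 ≤ η then ρ else 0) +
          E * prob Q (rect (encFiber c s x) (decFiber c s y 0))) := by
        gcongr with s _ x _ y _
        · exact ha0 x y
        · exact hle s x y
    _ = (1 - avgType P c 0) / η + (∑ x : Fin n → X, if 1 - typ x 0 ≤ η then ρ else 0) +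
          E * guessProb Q Γ c 0 := by
        simp only [mul_add, Finset.sum_add_distrib, ← Finset.sum_mul, ha1, one_mul, h1]
        congr 1
        · congr 1
          · rw [avgType, ← Finset.sum_div, Finset.sum_sub_distrib]
            simp
            field_simp
          · simp [hK']
        · rw [guessProb_eq]
          simp only [Finset.mul_sum]
          refine Finset.sum_congr rfl fun s _ => Finset.sum_congr rfl fun x _ =>
            Finset.sum_congr rfl fun y _ => by ring
    _ ≤ _ := by
        gcongr
        rw [← Finset.sum_filter, Finset.sum_const, nsmul_eq_mul]
        exact mul_le_mul_of_nonneg_right hN hρ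

/-- The converse: the exponent of a covert sequence of codes whose type-I error stays away from one
is at most `E₁`. -/
theorem exponent_le_E1 {P Q : U × V → ℝ} (hP : P ∈ stdSimplex ℝ (U × V))
    (hQ : ∀ w, 0 ≤ Q w) (hPQ : ∀ w, Q w = 0 → P w = 0)
    {Γ : X → Y × Z → ℝ} (hΓ : ∀ x, Γ x ∈ stdSimplex ℝ (Y × Z))
    (hsim : ∀ ψ ∈ stdSimplex ℝ X, ψ 0 = 0 →
      (fun z => ∑ x, ψ x * chanZ Γ x z) ≠ chanZ Γ 0)
    {κ : ℕ → ℕ} (hκ : ∀ n, 0 < κ n) {ε : ℝ} (hε1 : ε < 1)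
    {c : (n : ℕ) → Code U V X Y n (κ n)} {θ : ℝ≥0∞} (hc : Achieves P Q Γ ε c θ) :
    θ ≤ E1 P Q := by
  obtain ⟨hcov, herr, hexp⟩ := hc
  refine le_of_forall_gt fun E hE => ?_
  obtain ⟨e', he'0, hEe', he'E⟩ := ENNReal.lt_iff_exists_real_btwn.mp hE
  refine lt_of_le_of_lt ?_ he'E
  obtain ⟨e, he0, hEe, hee'⟩ := ENNReal.lt_iff_exists_real_btwn.mp hEe'
  have hlt : e < e' := (ENNReal.ofReal_lt_ofReal_iff'.mp hee').1
  obtain ⟨ζ, hζ, n₀, hrect⟩ := exists_rect_converse hP hQ hPQ hEe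
  obtain ⟨η, hη, hcard⟩ := exists_card_light_le X (half_pos hζ)
  -- the probability with which the null hypothesis is accepted is eventually at least `4 b`
  set b : ℝ := (1 - ε) / 8 with hb
  have hb0 : 0 < b := by rw [hb]; linarith
  obtain ⟨δ, hδ, hconc⟩ := exists_concentration hsim (mul_pos hη hb0)
  have hI : ∀ᶠ n in atTop, typeI P Γ (c n) < 1 - 4 * b :=
    eventually_lt_of_limsup_lt (lt_of_le_of_lt herr (by rw [hb]; linarith))
      (isBoundedUnder_of ⟨1, fun n => guessProb_le_one hP hΓ (hκ n) (c n) 1⟩)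
  have hcov' : ∀ᶠ n in atTop, wardenDiv P Γ (c n) < ENNReal.ofReal (δ ^ 2 / 4) :=
    hcov.eventually_lt_const (by simpa using by positivity)
  have hexp0 : Tendsto (fun n : ℕ => Real.exp (-(ζ / 2) * n)) atTop (𝓝 0) :=
    Real.tendsto_exp_atBot.comp (tendsto_natCast_atTop_atTop.const_mul_atTop_of_neg (by linarith))
  have hsmall : ∀ᶠ n : ℕ in atTop, Real.exp (-(ζ / 2) * n) < b :=
    hexp0.eventually_lt_const hb0
  have hlog : ∀ᶠ n : ℕ in atTop, -Real.log b ≤ n * (e' - e) :=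
    (tendsto_natCast_atTop_atTop.atTop_mul_const (sub_pos.mpr hlt)).eventually_ge_atTop _
  have hrate : ∀ᶠ n in atTop, decayRate n (typeII Q Γ (c n)) ≤ (e' : EReal) := by
    filter_upwards [hI, hcov', hsmall, hlog, eventually_ge_atTop n₀, eventually_ne_atTop 0]
      with n h1 h2 h3 h4 h5 hn
    have hav := hconc _ (avgType_mem hP hn (hκ n) (c n))
      (abs_avgType_output_sub_le hP hΓ hn (hκ n) (c n) hδ h2)
    have hmain := guessProb_zero_le hP hQ hΓ hn (hκ n) (c n) hη (Real.exp_pos (-(ζ * n))).le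
      (Real.exp_pos (n * e)) (hcard n hn) (fun S T hST => by
        have := hrect n h5 S T hST
        rwa [Real.exp_neg, inv_le_iff_one_le_mul₀' (Real.exp_pos _)] at this)
    rw [← Real.exp_add, show (n : ℝ) * (ζ / 2) + -(ζ * n) = -(ζ / 2) * n by ring] at hmain
    have hadd := guessProb_add hP hΓ (hκ n) (c n)
    have h6 : (1 - avgType P (c n) 0) / η ≤ b := by
      rw [div_le_iff₀ hη]; linarith
    have h7 : b ≤ Real.exp (n * e) * typeII Q Γ (c n) := by
      rw [typeI] at h1
      rw [typeII]
      linarith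
    have hβ : 0 < typeII Q Γ (c n) := by
      by_contra hneg
      have := mul_nonpos_of_nonneg_of_nonpos (Real.exp_pos (n * e)).le (not_lt.mp hneg)
      linarith
    rw [decayRate, if_neg hβ.ne']
    norm_cast
    have h8 := Real.log_le_log hb0 h7
    rw [Real.log_mul (Real.exp_pos _).ne' hβ.ne', Real.log_exp] at h8
    have hn' : (0 : ℝ) < n := by exact_mod_cast Nat.pos_of_ne_zero hn
    rw [neg_mul, one_div, inv_mul_eq_div, ← neg_div, div_le_iff₀ hn']
    linarith
  have h := hexp.trans (liminf_le_of_frequently_le' hrate.frequently)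
  have : ((ENNReal.ofReal e' : ℝ≥0∞) : EReal) = (e' : EReal) := by
    rw [EReal.coe_ennreal_ofReal, max_eq_left he'0]
  rw [← this] at h
  exact EReal.coe_ennreal_le_coe_ennreal_iff.mp h

end ConverseBound

/-! ### Semicontinuity of the exponents -/

section Exponents

variable {A : Type*} [Fintype A]

/-- Lower semicontinuity of the divergence in its first argument. -/
lemma klDiv_le_of_tendsto {q : A → ℝ} {p : ℕ → A → ℝ} {p₀ : A → ℝ}
    (hp : Tendsto p atTop (𝓝 p₀)) {e : ℝ} (h : ∀ k, klDiv (p k) q ≤ ENNReal.ofReal e) :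
    klDiv p₀ q ≤ ENNReal.ofReal e := by
  have hdom : ∀ k a, q a = 0 → p k a = 0 := fun k =>
    dominated_of_klDiv_ne_top (ne_top_of_le_ne_top ENNReal.ofReal_ne_top (h k))
  have hdom0 : ∀ a, q a = 0 → p₀ a = 0 := by
    intro a ha
    have h1 : Tendsto (fun k => p k a) atTop (𝓝 (p₀ a)) := (tendsto_pi_nhds.mp hp) a
    simp only [hdom _ a ha] at h1
    exact (tendsto_nhds_unique h1 tendsto_const_nhds)
  rw [klDiv_eq hdom0]
  have h2 : Tendsto (fun k => ENNReal.ofReal (klReal (p k) q)) atTop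
      (𝓝 (ENNReal.ofReal (klReal p₀ q))) :=
    ENNReal.tendsto_ofReal (((continuous_klReal q).tendsto p₀).comp hp)
  refine le_of_tendsto' h2 fun k => ?_
  rw [← klDiv_eq (hdom k)]
  exact h k

/-- If a lower bound on the divergence fails on each of a sequence of constraint sets, there is a
convergent sequence of laws that violate it. -/
lemma exists_tendsto_of_klDiv_lt {q : A → ℝ} {C : ℝ → Set (A → ℝ)} {e : ℝ}
    (h : ¬ ∃ μ : ℝ, 0 < μ ∧ ∀ p ∈ stdSimplex ℝ A, p ∈ C μ → ENNReal.ofReal e ≤ klDiv p q) :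
    ∃ (p : ℕ → A → ℝ) (μ : ℕ → ℝ) (p₀ : A → ℝ), (∀ k, p k ∈ stdSimplex ℝ A) ∧
      (∀ k, p k ∈ C (μ k)) ∧ (∀ k, klDiv (p k) q ≤ ENNReal.ofReal e) ∧
      Tendsto μ atTop (𝓝 0) ∧ p₀ ∈ stdSimplex ℝ A ∧ Tendsto p atTop (𝓝 p₀) := by
  push Not at h
  choose p hp hpC hlt using fun k : ℕ => h (1 / ((k : ℝ) + 1)) (by positivity)
  obtain ⟨p₀, hp₀, φ, hφ, hlim⟩ := (isCompact_stdSimplex ℝ A).tendsto_subseq hp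
  exact ⟨p ∘ φ, fun k => 1 / ((φ k : ℝ) + 1), p₀, fun k => hp _, fun k => hpC _,
    fun k => (hlt _).le, tendsto_one_div_add_atTop_nhds_zero_nat.comp hφ.tendsto_atTop, hp₀, hlim⟩

omit [Fintype A] in
lemma eq_of_tendsto_near {q : A → ℝ} {p : ℕ → A → ℝ} {p₀ : A → ℝ} {μ : ℕ → ℝ}
    (hp : Tendsto p atTop (𝓝 p₀)) (hμ : Tendsto μ atTop (𝓝 0)) (h : ∀ k, p k ∈ near q (μ k)) :
    p₀ = q := by
  funext a
  have h1 : Tendsto (fun k => |p k a - q a|) atTop (𝓝 |p₀ a - q a|) :=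
    (((tendsto_pi_nhds.mp hp) a).sub_const _).abs
  have h2 : |p₀ a - q a| ≤ 0 := le_of_tendsto_of_tendsto' h1 hμ fun k => (h k).1 a
  exact sub_eq_zero.mp (abs_nonpos_iff.mp h2)

lemma exists_near_klDiv {p q : A → ℝ} {e : ℝ} (he : ENNReal.ofReal e < klDiv q p) :
    ∃ μ : ℝ, 0 < μ ∧ ∀ p' ∈ stdSimplex ℝ A, p' ∈ near q μ → ENNReal.ofReal e ≤ klDiv p' p := by
  by_contra hcon
  obtain ⟨r, μ, r₀, hr, hrC, hle, hμ, hr₀, hlim⟩ := exists_tendsto_of_klDiv_lt hcon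
  have := klDiv_le_of_tendsto hlim hle
  rw [eq_of_tendsto_near hlim hμ hrC] at this
  exact absurd he (not_lt.mpr this)

variable {U V : Type*} [Fintype U] [Fintype V]

omit [Fintype U] in
lemma continuous_fstMarg : Continuous fun p : U × V → ℝ => fstMarg p :=
  continuous_pi fun _ => continuous_finsetSum _ fun _ _ => continuous_apply _

omit [Fintype V] in
lemma continuous_sndMarg : Continuous fun p : U × V → ℝ => sndMarg p :=
  continuous_pi fun _ => continuous_finsetSum _ fun _ _ => continuous_apply _

lemma exists_near_E1 {P Q : U × V → ℝ} {e : ℝ} (he : ENNReal.ofReal e < E1 P Q) :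
    ∃ μ : ℝ, 0 < μ ∧ ∀ π ∈ stdSimplex ℝ (U × V),
      π ∈ {π | fstMarg π ∈ near (fstMarg P) μ ∧ sndMarg π ∈ near (sndMarg P) μ} →
      ENNReal.ofReal e ≤ klDiv π Q := by
  by_contra hcon
  obtain ⟨r, μ, r₀, hr, hrC, hle, hμ, hr₀, hlim⟩ := exists_tendsto_of_klDiv_lt
    (C := fun μ => {π | fstMarg π ∈ near (fstMarg P) μ ∧ sndMarg π ∈ near (sndMarg P) μ}) hcon
  have h1 := eq_of_tendsto_near ((continuous_fstMarg.tendsto r₀).comp hlim) hμ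
    fun k => (hrC k).1
  have h2 := eq_of_tendsto_near ((continuous_sndMarg.tendsto r₀).comp hlim) hμ
    fun k => (hrC k).2
  have h3 : E1 P Q ≤ klDiv r₀ Q := iInf₂_le r₀ ⟨hr₀, h1, h2⟩
  exact absurd he (not_lt.mpr (h3.trans (klDiv_le_of_tendsto hlim hle)))

lemma klReal_self (q : A → ℝ) : klReal q q = 0 := by simp [klReal]

lemma klReal_mix_self_le {p q : A → ℝ} (hp : p ∈ stdSimplex ℝ A) (hq : q ∈ stdSimplex ℝ A)
    {t : ℝ} (h0 : 0 ≤ t) (h1 : t ≤ 1) : klReal (mix t p q) q ≤ (1 - t) * klReal p q := by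
  have h2 : ∀ a, mix t p q a * Real.log (mix t p q a) - mix t p q a * Real.log (q a) ≤
      (1 - t) * (p a * Real.log (p a) - p a * Real.log (q a)) +
        t * (q a * Real.log (q a) - q a * Real.log (q a)) := by
    intro a
    have := Real.convexOn_mul_log.2 (hp.1 a) (hq.1 a) (sub_nonneg.mpr h1) h0 (by ring)
    simp only [smul_eq_mul] at this
    simp only [mix]
    linarith
  calc klReal (mix t p q) q ≤ ∑ a, ((1 - t) * (p a * Real.log (p a) - p a * Real.log (q a)) +
        t * (q a * Real.log (q a) - q a * Real.log (q a))) := Finset.sum_le_sum fun a _ => h2 a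
    _ = (1 - t) * klReal p q := by
        rw [Finset.sum_add_distrib, ← Finset.mul_sum, ← Finset.mul_sum]
        simp [klReal]

/-- A real number strictly between the divergence and an extended bound. -/
lemma exists_klReal_lt_lt {p q : A → ℝ} {b : ℝ≥0∞} (h : klDiv p q < b) :
    (∀ a, q a = 0 → p a = 0) ∧ ∃ r, klReal p q < r ∧ ENNReal.ofReal r < b := by
  obtain ⟨r, -, h1, h2⟩ := ENNReal.lt_iff_exists_real_btwn.mp h
  obtain ⟨h3, h4⟩ := klReal_lt_of_klDiv_lt h1
  exact ⟨h3, r, h4, h2⟩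

variable {X Y Z : Type*} [Fintype X] [Fintype Y] [Fintype Z] [Zero X]

/-- The divergence from `P_U` from which on a law belongs to `barP`; truncated subtraction turns
the terms without condition into zero. -/
noncomputable def barPThreshold (Γ : X → Y × Z → ℝ) (x₁ : X) : ℝ≥0∞ :=
  ⨆ πz ∈ stdSimplex ℝ Z, (klDiv πz (chanZ Γ 0) - (3 / 2) * klDiv πz (chanZ Γ x₁))

omit [Fintype U] [Fintype X] in
lemma mem_barP_iff [Fintype U] {P : U × V → ℝ} {Γ : X → Y × Z → ℝ} {x₁ : X} {πU : U → ℝ} :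
    πU ∈ barP P Γ x₁ ↔
      πU ∈ stdSimplex ℝ U ∧ barPThreshold Γ x₁ ≤ klDiv πU (fstMarg P) := by
  simp only [barP, barPThreshold, Set.mem_ofPred_eq, iSup_le_iff, tsub_le_iff_right]

omit [Fintype X] in
lemma barPThreshold_lt_top {Γ : X → Y × Z → ℝ} {x₁ : X}
    (hdom : ∀ z, chanZ Γ 0 z = 0 → chanZ Γ x₁ z = 0) : barPThreshold Γ x₁ < ⊤ := by
  refine lt_of_le_of_lt (iSup₂_le fun πz hπz => ?_)
    (ENNReal.ofReal_lt_top (r := ∑ z, |Real.log (chanZ Γ 0 z)|))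
  by_cases h : ∀ z, chanZ Γ 0 z = 0 → πz z = 0
  · refine tsub_le_self.trans ?_
    rw [klDiv_eq h]
    refine ENNReal.ofReal_le_ofReal (Finset.sum_le_sum fun z _ => ?_)
    have h0 := hπz.1 z
    have h1 : πz z ≤ 1 :=
      (Finset.single_le_sum (fun z _ => hπz.1 z) (Finset.mem_univ z)).trans hπz.2.le
    have h2 : πz z * Real.log (πz z) ≤ 0 := Real.mul_log_nonpos h0 h1
    have h3 : -(πz z * Real.log (chanZ Γ 0 z)) ≤ |Real.log (chanZ Γ 0 z)| := by
      rw [← mul_neg]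
      calc πz z * -Real.log (chanZ Γ 0 z) ≤ πz z * |Real.log (chanZ Γ 0 z)| :=
            mul_le_mul_of_nonneg_left (neg_le_abs _) h0
        _ ≤ 1 * |Real.log (chanZ Γ 0 z)| := mul_le_mul_of_nonneg_right h1 (abs_nonneg _)
        _ = _ := one_mul _
    linarith
  · have h' : ¬ ∀ z, chanZ Γ x₁ z = 0 → πz z = 0 := fun hc => h fun z hz => hc z (hdom z hz)
    have h1 : (3 / 2 : ℝ≥0∞) * klDiv πz (chanZ Γ x₁) = ⊤ := by
      rw [klDiv, if_neg h']
      exact ENNReal.mul_top (by norm_num)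
    rw [h1]
    simp

omit [Fintype X] in
lemma klDiv_le_barPThreshold {Γ : X → Y × Z → ℝ} (hΓ : ∀ x, Γ x ∈ stdSimplex ℝ (Y × Z)) (x₁ : X) :
    klDiv (chanZ Γ x₁) (chanZ Γ 0) ≤ barPThreshold Γ x₁ := by
  refine le_trans ?_ (le_iSup₂ (chanZ Γ x₁) (chanZ_mem hΓ x₁))
  rw [klDiv_eq (p := chanZ Γ x₁) (q := chanZ Γ x₁) fun _ h => h, klReal_self]
  simp

omit [Fintype X] in
lemma exists_near_E2 {P Q : U × V → ℝ} (hP : P ∈ stdSimplex ℝ (U × V))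
    (hPQ : ∀ w, Q w = 0 → P w = 0) {Γ : X → Y × Z → ℝ} {x₁ : X}
    (hpos : 0 < barPThreshold Γ x₁) (htop : barPThreshold Γ x₁ < ⊤) {e : ℝ}
    (he : ENNReal.ofReal e < E2 P Q Γ x₁) :
    ∃ μ : ℝ, 0 < μ ∧ ∀ π ∈ stdSimplex ℝ (U × V),
      π ∈ {π | fstMarg π ∉ barP P Γ x₁ ∧ sndMarg π ∈ near (sndMarg P) μ} →
      ENNReal.ofReal e ≤ klDiv π Q := by
  by_contra hcon
  obtain ⟨r, μ, r₀, hr, hrC, hle, hμ, hr₀, hlim⟩ := exists_tendsto_of_klDiv_lt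
    (C := fun μ => {π | fstMarg π ∉ barP P Γ x₁ ∧ sndMarg π ∈ near (sndMarg P) μ}) hcon
  have h2 := eq_of_tendsto_near ((continuous_sndMarg.tendsto r₀).comp hlim) hμ
    fun k => (hrC k).2
  have hκ : barPThreshold Γ x₁ = ENNReal.ofReal (barPThreshold Γ x₁).toReal :=
    (ENNReal.ofReal_toReal htop.ne).symm
  have hκ0 : 0 < (barPThreshold Γ x₁).toReal := ENNReal.toReal_pos hpos.ne' htop.ne
  have h3 : klDiv (fstMarg r₀) (fstMarg P) ≤ ENNReal.ofReal (barPThreshold Γ x₁).toReal := by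
    refine klDiv_le_of_tendsto ((continuous_fstMarg.tendsto r₀).comp hlim) fun k => ?_
    rw [← hκ]
    by_contra hc
    exact (hrC k).1 (mem_barP_iff.mpr ⟨fstMarg_mem (hr k), (not_le.mp hc).le⟩)
  have hPU := fstMarg_mem hP
  have hdomU := dominated_of_klDiv_ne_top (ne_top_of_le_ne_top ENNReal.ofReal_ne_top h3)
  rw [klDiv_eq hdomU, ENNReal.ofReal_le_ofReal_iff hκ0.le] at h3
  obtain ⟨hdom, s, hs, hsE⟩ := exists_klReal_lt_lt ((klDiv_le_of_tendsto hlim hle).trans_lt he)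
  obtain ⟨t, ht0, ht1, ht⟩ := exists_klReal_mix_lt (P := P) hs
  -- mixing with `P` makes the constraint strict
  have hmem : fstMarg (mix t r₀ P) ∉ barP P Γ x₁ := by
    rw [mem_barP_iff, fstMarg_mix]
    rintro ⟨-, hge⟩
    rw [klDiv_eq (mix_dominated hdomU (fun _ h => h) t), hκ] at hge
    have h4 := klReal_mix_self_le (fstMarg_mem hr₀) hPU ht0.le ht1.le
    have h5 : (1 - t) * klReal (fstMarg r₀) (fstMarg P) < (barPThreshold Γ x₁).toReal := by
      calc _ ≤ (1 - t) * (barPThreshold Γ x₁).toReal :=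
            mul_le_mul_of_nonneg_left h3 (by linarith)
        _ < _ := by nlinarith
    exact absurd hge (not_le.mpr ((ENNReal.ofReal_lt_ofReal_iff hκ0).mpr (by linarith)))
  have h6 : E2 P Q Γ x₁ ≤ klDiv (mix t r₀ P) Q :=
    iInf₂_le _ ⟨mix_mem ht0.le ht1.le hr₀ hP, by
      rw [sndMarg_mix, show sndMarg r₀ = sndMarg P from h2, mix_self], hmem⟩
  rw [klDiv_eq (mix_dominated hdom hPQ t)] at h6
  exact absurd hsE (not_lt.mpr (h6.trans (ENNReal.ofReal_le_ofReal ht.le)))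

/-- The infimum in the exponent `E₃`. -/
noncomputable def E3Source (P Q : U × V → ℝ) (Γ : X → Y × Z → ℝ) (x₁ : X) : ℝ≥0∞ :=
  ⨅ π ∈ {π : U × V → ℝ | π ∈ stdSimplex ℝ (U × V) ∧
    sndMarg π = sndMarg P ∧ fstMarg π ∈ barP P Γ x₁}, klDiv π Q

omit [Fintype X] in
/-- The constraint of `E₃` is not closed where types escape from the support of `P_U`: there, a
small amount of mass is moved out of the support of `P_U`, which makes the divergence infinite. -/
lemma exists_near_E3Source {P Q : U × V → ℝ} (hP : P ∈ stdSimplex ℝ (U × V))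
    (hPQ : ∀ w, Q w = 0 → P w = 0) {Γ : X → Y × Z → ℝ} {x₁ : X} {e : ℝ}
    (he : ENNReal.ofReal e < E3Source P Q Γ x₁) :
    ∃ μ : ℝ, 0 < μ ∧ ∀ π ∈ stdSimplex ℝ (U × V),
      π ∈ {π | fstMarg π ∈ barP P Γ x₁ ∧ sndMarg π ∈ near (sndMarg P) μ} →
      ENNReal.ofReal e ≤ klDiv π Q := by
  classical
  by_contra hcon
  obtain ⟨r, μ, r₀, hr, hrC, hle, hμ, hr₀, hlim⟩ := exists_tendsto_of_klDiv_lt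
    (C := fun μ => {π | fstMarg π ∈ barP P Γ x₁ ∧ sndMarg π ∈ near (sndMarg P) μ}) hcon
  have h2 : sndMarg r₀ = sndMarg P :=
    eq_of_tendsto_near ((continuous_sndMarg.tendsto r₀).comp hlim) hμ fun k => (hrC k).2
  have h0 := klDiv_le_of_tendsto hlim hle
  by_cases hcase : ∀ k u, fstMarg P u = 0 → fstMarg (r k) u = 0
  · have hlimU : Tendsto (fun k => fstMarg (r k)) atTop (𝓝 (fstMarg r₀)) :=
      (continuous_fstMarg.tendsto r₀).comp hlim
    have hdomU : ∀ u, fstMarg P u = 0 → fstMarg r₀ u = 0 := by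
      intro u hu
      have h1 : Tendsto (fun k => fstMarg (r k) u) atTop (𝓝 (fstMarg r₀ u)) :=
        (tendsto_pi_nhds.mp hlimU) u
      simp only [hcase _ u hu] at h1
      exact tendsto_nhds_unique h1 tendsto_const_nhds
    have hmem : fstMarg r₀ ∈ barP P Γ x₁ := by
      refine mem_barP_iff.mpr ⟨fstMarg_mem hr₀, ?_⟩
      rw [klDiv_eq hdomU]
      refine ge_of_tendsto' (ENNReal.tendsto_ofReal
        (((continuous_klReal (fstMarg P)).tendsto _).comp hlimU)) fun k => ?_
      rw [Function.comp, ← klDiv_eq (hcase k)]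
      exact (mem_barP_iff.mp (hrC k).1).2
    exact absurd he (not_lt.mpr ((iInf₂_le r₀ ⟨hr₀, h2, hmem⟩).trans h0))
  · push Not at hcase
    obtain ⟨k, u₀, hu₀, hne⟩ := hcase
    have hpos : 0 < fstMarg (r k) u₀ := lt_of_le_of_ne ((fstMarg_mem (hr k)).1 u₀) hne.symm
    obtain ⟨v₀, hv₀⟩ := exists_pos_of_sum_pos hpos
    have hQ0 : Q (u₀, v₀) ≠ 0 := fun h => hv₀.ne' (dominated_of_klDiv_ne_top
      (ne_top_of_le_ne_top ENNReal.ofReal_ne_top (hle k)) _ h)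
    have hPV : 0 < sndMarg P v₀ := by
      refine lt_of_le_of_ne ((sndMarg_mem hP).1 v₀) fun h => ?_
      have h1 : sndMarg (r k) v₀ = 0 := (hrC k).2.2 v₀ h.symm
      have h3 : r k (u₀, v₀) ≤ sndMarg (r k) v₀ := Finset.single_le_sum
        (f := fun u => r k (u, v₀)) (fun u _ => (hr k).1 _) (Finset.mem_univ u₀)
      linarith
    -- `P` with the mass of the column `v₀` moved to `(u₀, v₀)`
    set ρ : U × V → ℝ := fun w =>
      if w.2 = v₀ then (if w.1 = u₀ then sndMarg P v₀ else 0) else P w with hρ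
    have hρV : sndMarg ρ = sndMarg P := by
      funext v
      by_cases hv : v = v₀
      · subst hv
        simp [sndMarg, hρ]
      · simp [sndMarg, hρ, hv]
    have hρmem : ρ ∈ stdSimplex ℝ (U × V) := by
      refine ⟨fun w => ?_, ?_⟩
      · simp only [hρ]
        split_ifs
        · exact hPV.le
        · exact le_rfl
        · exact hP.1 w
      · rw [Fintype.sum_prod_type_right]
        calc ∑ v, ∑ u, ρ (u, v) = ∑ v, sndMarg P v := by rw [← hρV]; rfl
          _ = 1 := (sndMarg_mem hP).2
    have hρQ : ∀ w, Q w = 0 → ρ w = 0 := by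
      rintro ⟨u, v⟩ h
      simp only [hρ]
      split_ifs with h1 h3
      · subst h1; subst h3; exact absurd h hQ0
      · rfl
      · exact hPQ _ h
    obtain ⟨hdom, s, hs, hsE⟩ := exists_klReal_lt_lt (h0.trans_lt he)
    obtain ⟨t, ht0, ht1, ht⟩ := exists_klReal_mix_lt (P := ρ) hs
    have hmix := mix_mem ht0.le ht1.le hr₀ hρmem
    have hmem : fstMarg (mix t r₀ ρ) ∈ barP P Γ x₁ := by
      refine mem_barP_iff.mpr ⟨fstMarg_mem hmix, ?_⟩
      rw [klDiv, if_neg]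
      · exact le_top
      · intro h
        have h1 := h u₀ hu₀
        have h3 : mix t r₀ ρ (u₀, v₀) ≤ fstMarg (mix t r₀ ρ) u₀ := Finset.single_le_sum
          (f := fun v => mix t r₀ ρ (u₀, v)) (fun v _ => hmix.1 _) (Finset.mem_univ v₀)
        have h4 : t * sndMarg P v₀ ≤ mix t r₀ ρ (u₀, v₀) := by
          simp only [mix, hρ, if_true]
          exact le_add_of_nonneg_left (mul_nonneg (by linarith) (hr₀.1 _))
        have h5 := mul_pos ht0 hPV
        linarith
    have h6 : E3Source P Q Γ x₁ ≤ klDiv (mix t r₀ ρ) Q :=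
      iInf₂_le _ ⟨hmix, by rw [sndMarg_mix, h2, hρV, mix_self], hmem⟩
    rw [klDiv_eq (mix_dominated hdom hρQ t)] at h6
    exact absurd hsE (not_lt.mpr (h6.trans (ENNReal.ofReal_le_ofReal ht.le)))

end Exponents

/-! ### Codes with two channel input words -/

section Rates

lemma eventually_pow_mul_exp_le (k : ℕ) {e e' : ℝ} (h : e' < e) :
    ∀ᶠ n : ℕ in atTop, ((n : ℝ) + 1) ^ k * Real.exp (-(n * e)) ≤ Real.exp (-(n * e')) := by
  have h1 := (isLittleO_pow_exp_pos_mul_atTop k (sub_pos.mpr h)).bound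
    (Real.exp_pos (-(e - e')))
  have h2 : Tendsto (fun n : ℕ => (n : ℝ) + 1) atTop atTop :=
    tendsto_atTop_add_const_right _ _ tendsto_natCast_atTop_atTop
  filter_upwards [h2.eventually h1] with n hn
  have h3 : ((n : ℝ) + 1) ^ k ≤ Real.exp (n * (e - e')) := by
    rw [Real.norm_of_nonneg (by positivity), Real.norm_of_nonneg (Real.exp_pos _).le,
      ← Real.exp_add] at hn
    refine hn.trans (Real.exp_le_exp.mpr (by linarith))
  calc _ ≤ Real.exp (n * (e - e')) * Real.exp (-(n * e)) :=
        mul_le_mul_of_nonneg_right h3 (Real.exp_pos _).le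
    _ = _ := by rw [← Real.exp_add]; congr 1; ring

lemma le_liminf_decayRate {θ : ℝ≥0∞} {β : ℕ → ℝ} (h0 : ∀ n, 0 ≤ β n) (h1 : ∀ n, β n ≤ 1)
    (h : ∀ e : ℝ, 0 ≤ e → ENNReal.ofReal e < θ → ∀ᶠ n : ℕ in atTop, β n ≤ Real.exp (-(n * e))) :
    (θ : EReal) ≤ liminf (fun n => decayRate n (β n)) atTop := by
  refine le_of_forall_lt fun c hc => ?_
  obtain ⟨e, hce, he⟩ := EReal.lt_iff_exists_real_btwn.mp hc
  refine hce.trans_le (le_liminf_of_le (by isBoundedDefault) ?_)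
  have key : ∀ᶠ n : ℕ in atTop, β n ≤ Real.exp (-(n * e)) := by
    rcases le_or_gt 0 e with h2 | h2
    · refine h e h2 (EReal.coe_ennreal_lt_coe_ennreal_iff.mp ?_)
      rwa [EReal.coe_ennreal_ofReal, max_eq_left h2]
    · refine Eventually.of_forall fun n => (h1 n).trans (Real.one_le_exp ?_)
      have := mul_nonneg (Nat.cast_nonneg (α := ℝ) n) (neg_nonneg.mpr h2.le)
      linarith
  filter_upwards [key, eventually_gt_atTop 0] with n hn hn0
  rw [decayRate]
  split_ifs with hβ
  · exact le_top
  have hpos : 0 < β n := lt_of_le_of_ne (h0 n) (Ne.symm hβ)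
  have hn' : (0 : ℝ) < n := by exact_mod_cast hn0
  have h3 : Real.log (β n) ≤ -(n * e) := (Real.log_le_iff_le_exp hpos).mpr hn
  refine EReal.coe_le_coe_iff.mpr ?_
  calc e = -(1 / (n : ℝ)) * -(n * e) := by field_simp
    _ ≤ -(1 / (n : ℝ)) * Real.log (β n) :=
        mul_le_mul_of_nonpos_left h3 (neg_nonpos.mpr (by positivity))

/-- A radius around a law outside of which a type falls with probability at most
`exp (-|r n|) / (n + 1) ^ 2`, provided that the alphabet has at most `k - 2` letters. -/
noncomputable def radius (k : ℕ) (r : ℕ → ℝ) (n : ℕ) : ℝ :=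
  √(4 * ((|r n| + k * Real.log ((n : ℝ) + 1)) / n))

lemma tendsto_radius (k : ℕ) {r : ℕ → ℝ} (hr : Tendsto (fun n => r n / (n : ℝ)) atTop (𝓝 0)) :
    Tendsto (radius k r) atTop (𝓝 0) := by
  have h1 : Tendsto (fun n : ℕ => |r n| / n) atTop (𝓝 0) := by
    have := hr.abs
    simpa [abs_div] using this
  have h2 : Tendsto (fun n : ℕ => Real.log ((n : ℝ) + 1) / n) atTop (𝓝 0) := by
    have h3 : Tendsto (fun n : ℕ => Real.log ((n : ℝ) + 1) / ((n : ℝ) + 1)) atTop (𝓝 0) :=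
      (Real.isLittleO_log_id_atTop.tendsto_div_nhds_zero).comp
        (tendsto_atTop_add_const_right _ _ tendsto_natCast_atTop_atTop)
    have h4 : Tendsto (fun n : ℕ => 1 + 1 / (n : ℝ)) atTop (𝓝 (1 + 0)) :=
      tendsto_const_nhds.add tendsto_one_div_atTop_nhds_zero_nat
    have h5 := h3.mul h4
    rw [zero_mul] at h5
    refine h5.congr' ?_
    filter_upwards [eventually_gt_atTop 0] with n hn
    have hn' : (0 : ℝ) < n := by exact_mod_cast hn
    field_simp
  have h6 : Tendsto (fun n : ℕ => 4 * (|r n| / n + k * (Real.log ((n : ℝ) + 1) / n))) atTop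
      (𝓝 (4 * (0 + k * 0))) := (h1.add (h2.const_mul _)).const_mul _
  have h7 := h6.sqrt
  simp only [mul_zero, add_zero, Real.sqrt_zero] at h7
  refine h7.congr fun n => ?_
  rw [radius]
  congr 2
  ring

lemma prob_typ_notMem_near_radius_le {A : Type*} [Fintype A] {n : ℕ} (hn : n ≠ 0) {q : A → ℝ}
    (hq : q ∈ stdSimplex ℝ A) {k : ℕ} (hk : Fintype.card A + 2 ≤ k) (r : ℕ → ℝ) :
    prob q {w : Fin n → A | typ w ∉ near q (radius k r n)} ≤
      Real.exp (-|r n|) / ((n : ℝ) + 1) ^ 2 := by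
  have hn' : (0 : ℝ) < n := by exact_mod_cast Nat.pos_of_ne_zero hn
  have hlog : 0 ≤ Real.log ((n : ℝ) + 1) := Real.log_nonneg (by linarith)
  have h1 : (n : ℝ) * (radius k r n ^ 2 / 4) = |r n| + k * Real.log ((n : ℝ) + 1) := by
    rw [radius, Real.sq_sqrt (by positivity)]
    field_simp
  have h2 := prob_typ_notMem_near_le (μ := radius k r n) hn hq (Real.sqrt_nonneg _)
  refine h2.trans ?_
  have h3 : Real.exp (-(k * Real.log ((n : ℝ) + 1))) = (((n : ℝ) + 1) ^ k)⁻¹ := by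
    rw [Real.exp_neg, mul_comm, Real.exp_mul, Real.exp_log (by positivity), Real.rpow_natCast]
  rw [h1, neg_add, Real.exp_add, h3, le_div_iff₀ (by positivity)]
  calc _ = Real.exp (-|r n|) * (((n : ℝ) + 1) ^ (Fintype.card A + 2) * (((n : ℝ) + 1) ^ k)⁻¹) := by
        ring
    _ ≤ Real.exp (-|r n|) * 1 := by
        refine mul_le_mul_of_nonneg_left ?_ (Real.exp_pos _).le
        rw [← div_eq_mul_inv]
        exact div_le_one_of_le₀ (pow_le_pow_right₀ (by linarith) hk) (by positivity)
    _ = _ := mul_one _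

end Rates

section Achievability

variable {A : Type*} [Fintype A]

lemma klReal_le_of_le_exp_mul {p q : A → ℝ} (hp : p ∈ stdSimplex ℝ A) {c : ℝ}
    (h : ∀ a, p a ≤ Real.exp c * q a) : klReal p q ≤ c := by
  calc klReal p q ≤ ∑ a, p a * c := by
        refine Finset.sum_le_sum fun a _ => ?_
        rcases (hp.1 a).eq_or_lt with h0 | h0
        · simp [← h0]
        have hq : 0 < q a := pos_of_mul_pos_right (h0.trans_le (h a)) (Real.exp_pos c).le
        have := Real.log_le_log h0 (h a)
        rw [Real.log_mul (Real.exp_pos c).ne' hq.ne', Real.log_exp] at this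
        rw [← mul_sub]
        exact mul_le_mul_of_nonneg_left (by linarith) h0.le
    _ = c := by rw [← Finset.sum_mul, hp.2, one_mul]

lemma exists_le_exp_mul {p q : A → ℝ} (hp : ∀ a, 0 ≤ p a) (h : ∀ a, 0 < p a → 0 < q a)
    (hq : ∀ a, 0 ≤ q a) : ∃ M : ℝ, 0 ≤ M ∧ ∀ a, p a ≤ Real.exp M * q a := by
  refine ⟨∑ a, |Real.log (p a / q a)|, Finset.sum_nonneg fun _ _ => abs_nonneg _, fun a => ?_⟩
  rcases (hp a).eq_or_lt with h0 | h0
  · rw [← h0]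
    exact mul_nonneg (Real.exp_pos _).le (hq a)
  have hqa := h a h0
  rw [← div_le_iff₀ hqa, ← Real.log_le_iff_le_exp (by positivity)]
  exact (le_abs_self _).trans (Finset.single_le_sum (f := fun a => |Real.log (p a / q a)|)
    (fun _ _ => abs_nonneg _) (Finset.mem_univ a))

variable {U V X Y Z : Type*} [Fintype U] [Fintype V] [Fintype Y] [Fintype Z] [Zero X]

/-- The code that sends the constant word of the symbol `x₁` as an alarm if the source sequence is
in `bad`, and the zero word otherwise. The null hypothesis is declared if the side information is
in `accV` and the channel output in `accY`. -/
noncomputable def twoWordCode (x₁ : X) {n : ℕ} (K : ℕ) (bad : Set (Fin n → U))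
    (accV : Set (Fin n → V)) (accY : Set (Fin n → Y)) : Code U V X Y n K where
  enc u _ := open Classical in fun _ => if u ∈ bad then x₁ else 0
  dec v y _ := open Classical in if v ∈ accV ∧ y ∈ accY then 0 else 1

omit [Fintype U] [Fintype V] [Fintype Y] in
lemma twoWordCode_keyFree (x₁ : X) {n : ℕ} (K : ℕ) (bad : Set (Fin n → U))
    (accV : Set (Fin n → V)) (accY : Set (Fin n → Y)) :
    (twoWordCode x₁ K bad accV accY).KeyFree := ⟨fun _ _ _ => rfl, fun _ _ _ _ => rfl⟩

variable {x₁ : X} {n K : ℕ} {bad : Set (Fin n → U)} {accV : Set (Fin n → V)}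
  {accY : Set (Fin n → Y)} {Γ : X → Y × Z → ℝ}

open Classical in
lemma guessProb_twoWordCode (hK : 0 < K) (W : U × V → ℝ) (j : Fin 2) :
    guessProb W Γ (twoWordCode x₁ K bad accV accY) j =
      mean W fun w => prob (chanY Γ (if (fun i => (w i).1) ∈ bad then x₁ else 0))
        {y | (if (fun i => (w i).2) ∈ accV ∧ y ∈ accY then (0 : Fin 2) else 1) = j} := by
  have hK' : (K : ℝ) ≠ 0 := by exact_mod_cast hK.ne'
  change (1 / (K : ℝ)) * ∑ _s : Fin K, ∑ u : Fin n → U, ∑ v : Fin n → V, (∏ i, W (u i, v i)) *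
    ∑ y : Fin n → Y, (∏ i, chanY Γ (if u ∈ bad then x₁ else 0) (y i)) *
      (if (if v ∈ accV ∧ y ∈ accY then (0 : Fin 2) else 1) = j then 1 else 0) = _
  rw [Finset.sum_const, Finset.card_univ, Fintype.card_fin, nsmul_eq_mul, ← mul_assoc,
    one_div_mul_cancel hK', one_mul, sum_pair]
  refine Finset.sum_congr rfl fun w _ => congrArg _ (Finset.sum_congr rfl fun y _ => ?_)
  simp only [Set.indicator_apply, Set.mem_ofPred_eq, Pi.one_apply]

lemma typeII_twoWordCode_le (hK : 0 < K) (hΓ : ∀ x, Γ x ∈ stdSimplex ℝ (Y × Z)) {Q : U × V → ℝ}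
    (hQ : ∀ w, 0 ≤ Q w) :
    typeII Q Γ (twoWordCode x₁ K bad accV accY) ≤
      prob Q {w | (fun i => (w i).1) ∉ bad ∧ (fun i => (w i).2) ∈ accV} +
      prob Q {w | (fun i => (w i).1) ∈ bad ∧ (fun i => (w i).2) ∈ accV} *
        prob (chanY Γ x₁) accY := by
  classical
  rw [typeII, guessProb_twoWordCode hK, mul_comm (prob Q _) (prob (chanY Γ x₁) accY), prob.eq_1 Q,
    prob.eq_1 Q, ← mean_mul_left, ← mean_add]
  refine mean_mono hQ fun w => ?_
  by_cases h2 : (fun i => (w i).2) ∈ accV <;> by_cases h1 : (fun i => (w i).1) ∈ bad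
  · simp [h1, h2]
  · simp only [h1, h2, if_false, Set.indicator_apply, Set.mem_ofPred_eq, not_false_eq_true,
      true_and, and_true, if_true, Pi.one_apply, mul_zero, add_zero]
    exact prob_le_one (chanY_mem hΓ 0) _
  · simp [h1, h2, prob, mean]
  · simp [h1, h2, prob, mean]

lemma typeI_twoWordCode_le (hK : 0 < K) (hΓ : ∀ x, Γ x ∈ stdSimplex ℝ (Y × Z)) {P : U × V → ℝ}
    (hP : P ∈ stdSimplex ℝ (U × V)) :
    typeI P Γ (twoWordCode x₁ K bad accV accY) ≤
      prob (fstMarg P) bad + prob (sndMarg P) accVᶜ + prob (chanY Γ 0) accYᶜ := by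
  classical
  rw [typeI, guessProb_twoWordCode hK, prob.eq_1 (fstMarg P), prob.eq_1 (sndMarg P), ← mean_fst,
    ← mean_snd, ← mean_const (n := n) hP.2 (prob (chanY Γ 0) accYᶜ), ← mean_add, ← mean_add]
  refine mean_mono hP.1 fun w => ?_
  have h0 := prob_nonneg (chanY_mem hΓ 0).1 accYᶜ
  by_cases h1 : (fun i => (w i).1) ∈ bad
  · have h3 := prob_le_one (chanY_mem hΓ x₁)
      {y | (if (fun i => (w i).2) ∈ accV ∧ y ∈ accY then (0 : Fin 2) else 1) = 1}
    have h4 : 0 ≤ accVᶜ.indicator (1 : (Fin n → V) → ℝ) (fun i => (w i).2) :=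
      Set.indicator_nonneg (fun _ _ => zero_le_one) _
    simp only [h1, if_true, Set.indicator_of_mem, Pi.one_apply]
    linarith
  by_cases h2 : (fun i => (w i).2) ∈ accV
  · simp only [h1, h2, if_false, true_and]
    simp only [h1, h2, Set.indicator_apply, Set.mem_compl_iff, not_true_eq_false, if_false,
      zero_add]
    refine prob_mono (chanY_mem hΓ 0).1 fun y hy => ?_
    intro hc
    simp [hc] at hy
  · simp only [h1, if_false]
    refine (prob_le_one (chanY_mem hΓ 0) _).trans ?_
    simp only [h1, h2, Set.indicator_apply, Set.mem_compl_iff, not_false_eq_true, if_true,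
      if_false, Pi.one_apply, zero_add]
    linarith

/-- The output of the alarm word is averaged with that of the zero word, so the divergence is at
most the probability of the alarm times the divergence of the alarm word. -/
lemma wardenDiv_twoWordCode_le (hK : 0 < K) (hΓ : ∀ x, Γ x ∈ stdSimplex ℝ (Y × Z))
    {P : U × V → ℝ} (hP : P ∈ stdSimplex ℝ (U × V)) {M : ℝ}
    (hM : ∀ z, chanZ Γ x₁ z ≤ Real.exp M * chanZ Γ 0 z) :
    wardenDiv P Γ (twoWordCode x₁ K bad accV accY) ≤
      ENNReal.ofReal (prob (fstMarg P) bad * (n * M)) := by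
  classical
  have hK' : (K : ℝ) ≠ 0 := by exact_mod_cast hK.ne'
  set q : X → (Fin n → Z) → ℝ := fun x z => ∏ i, chanZ Γ x (z i) with hq
  have hqm : ∀ x, q x ∈ stdSimplex ℝ (Fin n → Z) := fun x =>
    ⟨fun z => Finset.prod_nonneg fun i _ => (chanZ_mem hΓ x).1 _,
      sum_prod_eq_one (chanZ_mem hΓ x).2⟩
  have hPU := fstMarg_mem hP
  set p := prob (fstMarg P) bad with hp
  have hp0 : 0 ≤ p := prob_nonneg hPU.1 bad
  have hp1 : p ≤ 1 := prob_le_one hPU bad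
  have hlaw : wardenLaw P Γ (twoWordCode x₁ K bad accV accY) = mix (1 - p) (q x₁) (q 0) := by
    funext z
    have h1 : ∑ u, (∏ i, fstMarg P (u i)) * ∏ i, chanZ Γ (if u ∈ bad then x₁ else 0) (z i) =
        mean (fstMarg P) fun u => q 0 z + (q x₁ z - q 0 z) * bad.indicator 1 u := by
      refine Finset.sum_congr rfl fun u _ => congrArg _ ?_
      by_cases hu : u ∈ bad <;> simp [hu, hq]
    rw [mean_add, mean_const hPU.2, mean_mul_left] at h1
    simp only [wardenLaw, twoWordCode, h1, Finset.sum_const, Finset.card_univ, Fintype.card_fin,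
      nsmul_eq_mul, mix]
    rw [← mul_assoc, one_div_mul_cancel hK', one_mul]
    change q 0 z + (q x₁ z - q 0 z) * p = _
    ring
  have hle : ∀ z, q x₁ z ≤ Real.exp (n * M) * q 0 z := by
    intro z
    calc q x₁ z ≤ ∏ i, Real.exp M * chanZ Γ 0 (z i) :=
          Finset.prod_le_prod (fun i _ => (chanZ_mem hΓ _).1 _) fun i _ => hM _
      _ = _ := by simp [Finset.prod_mul_distrib, hq, Real.exp_nat_mul]
  have hdom : ∀ z, q 0 z = 0 → q x₁ z = 0 := fun z hz =>
    le_antisymm (by simpa [hz] using hle z) ((hqm x₁).1 z)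
  rw [wardenDiv, hlaw, klDiv_eq (mix_dominated hdom (fun _ h => h) _)]
  refine ENNReal.ofReal_le_ofReal ?_
  calc klReal (mix (1 - p) (q x₁) (q 0)) (q 0) ≤ (1 - (1 - p)) * klReal (q x₁) (q 0) :=
        klReal_mix_self_le (hqm x₁) (hqm 0) (by linarith) (by linarith)
    _ = p * klReal (q x₁) (q 0) := by ring
    _ ≤ p * (n * M) := mul_le_mul_of_nonneg_left (klReal_le_of_le_exp_mul (hqm x₁) hle) hp0

omit [Fintype Y] [Fintype Z] [Zero X] in
lemma le_covertStein {X Y Z : Type*} [Fintype Y] [Fintype Z] [Zero X] {P Q : U × V → ℝ}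
    {Γ : X → Y × Z → ℝ} {κ : ℕ → ℕ} {ε : ℝ}
    {c : (n : ℕ) → Code U V X Y n (κ n)} {θ : ℝ≥0∞} (h : Achieves P Q Γ ε c θ) :
    θ ≤ covertStein P Q Γ κ ε := by
  refine ENNReal.le_of_forall_nnreal_lt fun r hr => ?_
  rcases eq_or_ne r 0 with rfl | h0
  · simp
  · exact le_iSup₂ (f := fun (θ : ℝ≥0) (_ : θ ∈ {θ : ℝ≥0 | 0 < θ ∧ ∃ c : (n : ℕ) →
      Code U V X Y n (κ n), Achieves P Q Γ ε c (θ : ℝ≥0∞)}) => (θ : ℝ≥0∞)) r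
      ⟨pos_iff_ne_zero.mpr h0, c, h.1, h.2.1,
        (EReal.coe_ennreal_le_coe_ennreal_iff.mpr hr.le).trans h.2.2⟩

end Achievability

/-! ### Achievability -/

section Exponents

variable {A : Type*} [Fintype A]

omit [Fintype A] in
lemma near_mono {q : A → ℝ} {μ ν : ℝ} (h : μ ≤ ν) : near q μ ⊆ near q ν :=
  fun _ hp => ⟨fun a => (hp.1 a).trans h, hp.2⟩

lemma prob_forall_ne {p : A → ℝ} (hp : p ∈ stdSimplex ℝ A) (n : ℕ) (a : A) :
    prob p {w : Fin n → A | ∃ i, w i = a}ᶜ = (1 - p a) ^ n := by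
  classical
  have h1 : ∑ b, (if b = a then 0 else p b) = 1 - p a := by
    rw [← hp.2, ← Finset.add_sum_erase _ p (Finset.mem_univ a), add_sub_cancel_left,
      ← Finset.add_sum_erase _ _ (Finset.mem_univ a), if_pos rfl, zero_add]
    exact Finset.sum_congr rfl fun b hb => if_neg (Finset.ne_of_mem_erase hb)
  rw [← h1, ← sum_prod_pow]
  refine Finset.sum_congr rfl fun w _ => ?_
  by_cases hw : ∃ i, w i = a
  · obtain ⟨i, hi⟩ := hw
    rw [Finset.prod_eq_zero (f := fun i => if w i = a then 0 else p (w i)) (Finset.mem_univ i)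
      (if_pos hi),
      Set.indicator_of_notMem (s := {w : Fin n → A | ∃ i, w i = a}ᶜ) (not_not.mpr ⟨i, hi⟩),
      mul_zero]
  · rw [Set.indicator_of_mem (show w ∈ {w : Fin n → A | ∃ i, w i = a}ᶜ from hw), Pi.one_apply,
      mul_one]
    push Not at hw
    exact Finset.prod_congr rfl fun i _ => (if_neg (hw i)).symm

lemma prob_exists_eq_zero {p : A → ℝ} {a : A} (ha : p a = 0) (n : ℕ) :
    prob p {w : Fin n → A | ∃ i, w i = a} = 0 := by
  refine Finset.sum_eq_zero fun w _ => ?_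
  by_cases hw : ∃ i, w i = a
  · obtain ⟨i, hi⟩ := hw
    rw [Finset.prod_eq_zero (Finset.mem_univ i) (by rw [hi, ha]), zero_mul]
  · rw [Set.indicator_of_notMem (s := {w : Fin n → A | ∃ i, w i = a}) hw, mul_zero]

lemma eventually_prob_le {q : A → ℝ} (hq : q ∈ stdSimplex ℝ A) {G : (n : ℕ) → Set (Fin n → A)}
    {e : ℝ} (h : e = 0 ∨ ∀ᶠ n : ℕ in atTop, n ≠ 0 → ∀ w ∈ G n,
      ENNReal.ofReal e ≤ klDiv (typ w) q) :
    ∀ᶠ n : ℕ in atTop, prob q (G n) ≤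
      ((n : ℝ) + 1) ^ Fintype.card A * Real.exp (-(n * e)) := by
  rcases h with rfl | h
  · refine Eventually.of_forall fun n => (prob_le_one hq _).trans ?_
    simp only [mul_zero, neg_zero, Real.exp_zero, mul_one]
    exact one_le_pow₀ (by simp)
  · filter_upwards [h, eventually_ne_atTop 0] with n hn hn0
    exact prob_le_of_le_klDiv hn0 hq (hn hn0)

lemma exists_ofReal_lt_lt {e : ℝ} {θ : ℝ≥0∞} (h : ENNReal.ofReal e < θ) :
    ∃ e', e < e' ∧ ENNReal.ofReal e' < θ := by
  obtain ⟨r, -, h1, h2⟩ := ENNReal.lt_iff_exists_real_btwn.mp h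
  exact ⟨r, lt_of_not_ge fun h3 => absurd h1 (not_lt.mpr (ENNReal.ofReal_le_ofReal h3)), h2⟩

lemma exists_le_add_of_ofReal_lt_add {e : ℝ} {a b : ℝ≥0∞} (h : ENNReal.ofReal e < a + b) :
    ∃ e₁ e₂ : ℝ, (e₁ = 0 ∨ ENNReal.ofReal e₁ < a) ∧ (e₂ = 0 ∨ ENNReal.ofReal e₂ < b) ∧
      e ≤ e₁ + e₂ := by
  rcases eq_or_ne a 0 with rfl | ha
  · exact ⟨0, e, .inl rfl, .inr (by simpa using h), by simp⟩
  rcases eq_or_ne b 0 with rfl | hb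
  · exact ⟨e, 0, .inr (by simpa using h), .inl rfl, by simp⟩
  obtain ⟨a', ha', b', hb', hlt⟩ := ENNReal.exists_lt_add_of_lt_add h ha hb
  have ha'' := (ha'.trans_le le_top).ne
  have hb'' := (hb'.trans_le le_top).ne
  refine ⟨a'.toReal, b'.toReal, .inr (by rwa [ENNReal.ofReal_toReal ha'']),
    .inr (by rwa [ENNReal.ofReal_toReal hb'']), ?_⟩
  rw [← ENNReal.toReal_add ha'' hb'']
  exact (ENNReal.ofReal_le_iff_le_toReal (ENNReal.add_ne_top.mpr ⟨ha'', hb''⟩)).mp hlt.le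

lemma tendsto_one_div_add_one_sq :
    Tendsto (fun n : ℕ => 1 / ((n : ℝ) + 1) ^ 2) atTop (𝓝 0) := by
  have := (tendsto_one_div_add_atTop_nhds_zero_nat (𝕜 := ℝ)).pow 2
  simpa [div_pow] using this

lemma tendsto_exp_neg_mul {a : ℝ} (ha : 0 < a) :
    Tendsto (fun n : ℕ => Real.exp (-(a * n))) atTop (𝓝 0) :=
  Real.tendsto_exp_neg_atTop_nhds_zero.comp
    (tendsto_natCast_atTop_atTop.const_mul_atTop ha)

variable {U V X Y Z : Type*} [Fintype U] [Fintype V] [Fintype Y] [Fintype Z] [Zero X]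

/-- If the output letter `y` tells the zero word from the alarm word without error of the second
kind, an atypical source sequence is reported at no loss of exponent, and the alarm is as rare as a
slowly shrinking radius of typicality permits. -/
theorem exists_achieves_E1 {P Q : U × V → ℝ} (hP : P ∈ stdSimplex ℝ (U × V))
    (hQ : Q ∈ stdSimplex ℝ (U × V)) {Γ : X → Y × Z → ℝ}
    (hΓ : ∀ x, Γ x ∈ stdSimplex ℝ (Y × Z))
    (hsuppZ : ∀ x z, 0 < chanZ Γ x z → 0 < chanZ Γ 0 z) {κ : ℕ → ℕ} (hκ : ∀ n, 0 < κ n)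
    {ε : ℝ} (hε : 0 ≤ ε) {x : X} {y : Y} (hy : 0 < chanY Γ 0 y) (hxy : chanY Γ x y = 0)
    {r : ℕ → ℝ} (hr : Tendsto (fun n => r n / (n : ℝ)) atTop (𝓝 0)) :
    ∃ c : (n : ℕ) → Code U V X Y n (κ n), (∀ n, (c n).KeyFree) ∧
      Achieves P Q Γ ε c (E1 P Q) ∧
      ∀ᶠ n in atTop, wardenDiv P Γ (c n) ≤ ENNReal.ofReal (Real.exp (-(r n))) := by
  have hPU := fstMarg_mem hP
  have hPV := sndMarg_mem hP
  obtain ⟨M, hM0, hM⟩ := exists_le_exp_mul (chanZ_mem hΓ x).1 (hsuppZ x) (chanZ_mem hΓ 0).1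
  set k := Fintype.card U + Fintype.card V + 2 with hk
  set μ := radius k r with hμ
  have hμ0 : Tendsto μ atTop (𝓝 0) := tendsto_radius k hr
  set bad : (n : ℕ) → Set (Fin n → U) := fun n => {u | typ u ∉ near (fstMarg P) (μ n)} with hbad
  set accV : (n : ℕ) → Set (Fin n → V) := fun n => {v | typ v ∈ near (sndMarg P) (μ n)} with haccV
  set accY : (n : ℕ) → Set (Fin n → Y) := fun n => {w | ∃ i, w i = y} with haccY
  set c : (n : ℕ) → Code U V X Y n (κ n) :=
    fun n => twoWordCode x (κ n) (bad n) (accV n) (accY n) with hc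
  have hbadle : ∀ n ≠ 0, prob (fstMarg P) (bad n) ≤ Real.exp (-|r n|) / ((n : ℝ) + 1) ^ 2 :=
    fun n hn => prob_typ_notMem_near_radius_le hn hPU (by omega) r
  have haccle : ∀ n ≠ 0, prob (sndMarg P) (accV n)ᶜ ≤ Real.exp (-|r n|) / ((n : ℝ) + 1) ^ 2 :=
    fun n hn => prob_typ_notMem_near_radius_le hn hPV (by omega) r
  have hexp : ∀ n, Real.exp (-|r n|) ≤ 1 := fun n => Real.exp_le_one_iff.mpr (by simp)
  have hdiv : ∀ n ≠ 0, wardenDiv P Γ (c n) ≤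
      ENNReal.ofReal (Real.exp (-|r n|) * (M / ((n : ℝ) + 1))) := by
    intro n hn
    refine (wardenDiv_twoWordCode_le (hκ n) hΓ hP hM).trans (ENNReal.ofReal_le_ofReal ?_)
    calc prob (fstMarg P) (bad n) * (n * M)
        ≤ Real.exp (-|r n|) / ((n : ℝ) + 1) ^ 2 * (((n : ℝ) + 1) * M) :=
          mul_le_mul (hbadle n hn) (mul_le_mul_of_nonneg_right (by linarith) hM0)
            (by positivity) (by positivity)
      _ = _ := by field_simp
  refine ⟨c, fun n => twoWordCode_keyFree _ _ _ _ _, ⟨?_, ?_, ?_⟩, ?_⟩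
  · have h1 : Tendsto (fun n : ℕ => ENNReal.ofReal (M * (1 / ((n : ℝ) + 1)))) atTop (𝓝 0) := by
      have := ENNReal.tendsto_ofReal
        ((tendsto_one_div_add_atTop_nhds_zero_nat (𝕜 := ℝ)).const_mul M)
      simpa using this
    refine tendsto_of_tendsto_of_tendsto_of_le_of_le' tendsto_const_nhds h1
      (Eventually.of_forall fun _ => zero_le) ?_
    filter_upwards [eventually_ne_atTop 0] with n hn
    refine (hdiv n hn).trans (ENNReal.ofReal_le_ofReal ?_)
    calc _ ≤ 1 * (M / ((n : ℝ) + 1)) := mul_le_mul_of_nonneg_right (hexp n) (by positivity)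
      _ = _ := by ring
  · have hlt : 1 - chanY Γ 0 y < 1 := by linarith
    have hge : 0 ≤ 1 - chanY Γ 0 y := by
      have := Finset.single_le_sum (fun b _ => (chanY_mem hΓ 0).1 b) (Finset.mem_univ y)
      rw [(chanY_mem hΓ 0).2] at this
      linarith
    have h1 := (tendsto_one_div_add_one_sq.add tendsto_one_div_add_one_sq).add
      (tendsto_pow_atTop_nhds_zero_of_lt_one hge hlt)
    simp only [add_zero] at h1
    have h2 : Tendsto (fun n => typeI P Γ (c n)) atTop (𝓝 0) := by
      refine tendsto_of_tendsto_of_tendsto_of_le_of_le' tendsto_const_nhds h1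
        (Eventually.of_forall fun n => guessProb_nonneg hP.1 hΓ _ _) ?_
      filter_upwards [eventually_ne_atTop 0] with n hn
      refine (typeI_twoWordCode_le (hκ n) hΓ hP).trans (add_le_add (add_le_add ?_ ?_) ?_)
      · exact (hbadle n hn).trans (div_le_div_of_nonneg_right (hexp n) (by positivity))
      · exact (haccle n hn).trans (div_le_div_of_nonneg_right (hexp n) (by positivity))
      · exact (prob_forall_ne (chanY_mem hΓ 0) n y).le
    exact h2.limsup_eq.trans_le hε
  · refine le_liminf_decayRate (fun n => guessProb_nonneg hQ.1 hΓ _ _)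
      (fun n => guessProb_le_one hQ hΓ (hκ n) _ _) fun e _ he => ?_
    obtain ⟨e', hee', he'⟩ := exists_ofReal_lt_lt he
    obtain ⟨ν, hν, hnear⟩ := exists_near_E1 he'
    have h1 := eventually_prob_le hQ
      (G := fun n => {w | (fun i => (w i).1) ∉ bad n ∧ (fun i => (w i).2) ∈ accV n}) (e := e')
      (.inr <| by
        filter_upwards [hμ0.eventually_le_const hν] with n hn hn0 w hw
        refine hnear _ (typ_mem hn0 w) ⟨?_, ?_⟩
        · rw [← typ_fst]
          exact near_mono hn (not_not.mp hw.1)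
        · rw [← typ_snd]
          exact near_mono hn hw.2)
    filter_upwards [h1, eventually_pow_mul_exp_le (Fintype.card (U × V)) hee'] with n h2 h3
    refine (typeII_twoWordCode_le (hκ n) hΓ hQ.1).trans ?_
    rw [prob_exists_eq_zero hxy, mul_zero, add_zero]
    exact h2.trans h3
  · have h1 : ∀ᶠ n : ℕ in atTop, M ≤ n := tendsto_natCast_atTop_atTop.eventually_ge_atTop M
    filter_upwards [h1, eventually_ne_atTop 0] with n hn hn0
    refine (hdiv n hn0).trans (ENNReal.ofReal_le_ofReal ?_)
    calc _ ≤ Real.exp (-|r n|) * 1 := by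
          refine mul_le_mul_of_nonneg_left ?_ (Real.exp_pos _).le
          exact div_le_one_of_le₀ (by linarith) (by positivity)
      _ ≤ Real.exp (-(r n)) := by
          rw [mul_one]
          exact Real.exp_le_exp.mpr (neg_le_neg (le_abs_self _))

/-- A source sequence is reported only if its type lies in `barP`, and such types are exponentially
rare because `barP` excludes a divergence ball around `P_U`. An error of the second kind needs
either an unreported source sequence, or a reported one together with a channel output that looks
like the response to the zero word. -/
theorem exists_achieves_min_E2_E3 {P Q : U × V → ℝ} (hP : P ∈ stdSimplex ℝ (U × V))
    (hQ : Q ∈ stdSimplex ℝ (U × V)) (hPQ : ∀ w, Q w = 0 → P w = 0) {Γ : X → Y × Z → ℝ}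
    (hΓ : ∀ x, Γ x ∈ stdSimplex ℝ (Y × Z))
    (hsuppZ : ∀ x z, 0 < chanZ Γ x z → 0 < chanZ Γ 0 z) {κ : ℕ → ℕ} (hκ : ∀ n, 0 < κ n)
    {ε : ℝ} (hε : 0 ≤ ε) {x₁ : X} (hne : chanZ Γ x₁ ≠ chanZ Γ 0) :
    ∃ c : (n : ℕ) → Code U V X Y n (κ n), (∀ n, (c n).KeyFree) ∧
      Achieves P Q Γ ε c (min (E2 P Q Γ x₁) (E3 P Q Γ x₁)) ∧
      ∃ a : ℝ, 0 < a ∧ ∀ᶠ n : ℕ in atTop,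
        wardenDiv P Γ (c n) ≤ ENNReal.ofReal (Real.exp (-(a * n))) := by
  have hPU := fstMarg_mem hP
  have hPV := sndMarg_mem hP
  have hY0 := chanY_mem hΓ (0 : X)
  obtain ⟨M, hM0, hM⟩ := exists_le_exp_mul (chanZ_mem hΓ x₁).1 (hsuppZ x₁) (chanZ_mem hΓ 0).1
  obtain ⟨z, hz⟩ := Function.ne_iff.mp hne
  have hd : 0 < |chanZ Γ x₁ z - chanZ Γ 0 z| := abs_pos.mpr (sub_ne_zero.mpr hz)
  obtain ⟨e₀, he₀, hle₀⟩ : ∃ e₀ : ℝ, 0 < e₀ ∧ ENNReal.ofReal e₀ ≤ barPThreshold Γ x₁ :=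
    ⟨_, by positivity, (le_klDiv_of_lt_abs_sub (chanZ_mem hΓ x₁) (chanZ_mem hΓ 0)
      (half_pos hd).le (half_lt_self hd)).trans (klDiv_le_barPThreshold hΓ x₁)⟩
  have hpos : 0 < barPThreshold Γ x₁ := (ENNReal.ofReal_pos.mpr he₀).trans_le hle₀
  have htop : barPThreshold Γ x₁ < ⊤ := barPThreshold_lt_top fun z h0 =>
    le_antisymm (not_lt.mp fun h => (hsuppZ x₁ z h).ne' h0) ((chanZ_mem hΓ x₁).1 z)
  set k := Fintype.card V + Fintype.card Y + 2 with hk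
  set μ := radius k 0 with hμ
  have hμ0 : Tendsto μ atTop (𝓝 0) := tendsto_radius k (by simp)
  set bad : (n : ℕ) → Set (Fin n → U) := fun n => {u | typ u ∈ barP P Γ x₁} with hbad
  set accV : (n : ℕ) → Set (Fin n → V) := fun n => {v | typ v ∈ near (sndMarg P) (μ n)} with haccV
  set accY : (n : ℕ) → Set (Fin n → Y) := fun n => {w | typ w ∈ near (chanY Γ 0) (μ n)} with haccY
  set c : (n : ℕ) → Code U V X Y n (κ n) :=
    fun n => twoWordCode x₁ (κ n) (bad n) (accV n) (accY n) with hc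
  have haccle : ∀ n ≠ 0, prob (sndMarg P) (accV n)ᶜ ≤ 1 / ((n : ℝ) + 1) ^ 2 := fun n hn =>
    (prob_typ_notMem_near_radius_le hn hPV (k := k) (by omega) 0).trans_eq (by simp)
  have hYle : ∀ n ≠ 0, prob (chanY Γ 0) (accY n)ᶜ ≤ 1 / ((n : ℝ) + 1) ^ 2 := fun n hn =>
    (prob_typ_notMem_near_radius_le hn hY0 (k := k) (by omega) 0).trans_eq (by simp)
  -- the factor `(n + 1) ^ 2` absorbs the divergence `n M` of the alarm word
  have hbadle : ∀ᶠ n : ℕ in atTop,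
      ((n : ℝ) + 1) ^ 2 * prob (fstMarg P) (bad n) ≤ Real.exp (-(e₀ / 2 * n)) := by
    have h1 := eventually_prob_le hPU (G := bad) (e := e₀)
      (.inr (Eventually.of_forall fun n _ u hu => hle₀.trans (mem_barP_iff.mp hu).2))
    filter_upwards [h1, eventually_pow_mul_exp_le (2 + Fintype.card U) (half_lt_self he₀)]
      with n h2 h3
    calc _ ≤ ((n : ℝ) + 1) ^ 2 * (((n : ℝ) + 1) ^ Fintype.card U * Real.exp (-(n * e₀))) :=
          mul_le_mul_of_nonneg_left h2 (by positivity)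
      _ = ((n : ℝ) + 1) ^ (2 + Fintype.card U) * Real.exp (-(n * e₀)) := by ring
      _ ≤ _ := by rwa [mul_comm (e₀ / 2)]
  have hdiv : ∀ᶠ n : ℕ in atTop,
      wardenDiv P Γ (c n) ≤ ENNReal.ofReal (Real.exp (-(e₀ / 2 * n))) := by
    filter_upwards [hbadle, tendsto_natCast_atTop_atTop.eventually_ge_atTop M] with n h1 h2
    refine (wardenDiv_twoWordCode_le (hκ n) hΓ hP hM).trans (ENNReal.ofReal_le_ofReal ?_)
    refine le_trans ?_ h1
    rw [mul_comm]
    refine mul_le_mul_of_nonneg_right ?_ (prob_nonneg hPU.1 _)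
    nlinarith [Nat.cast_nonneg (α := ℝ) n]
  refine ⟨c, fun n => twoWordCode_keyFree _ _ _ _ _, ⟨?_, ?_, ?_⟩, e₀ / 2, half_pos he₀, hdiv⟩
  · have h1 := ENNReal.tendsto_ofReal (tendsto_exp_neg_mul (half_pos he₀))
    rw [ENNReal.ofReal_zero] at h1
    exact tendsto_of_tendsto_of_tendsto_of_le_of_le' tendsto_const_nhds h1
      (Eventually.of_forall fun _ => zero_le) hdiv
  · have h1 := ((tendsto_exp_neg_mul (half_pos he₀)).add tendsto_one_div_add_one_sq).add
      tendsto_one_div_add_one_sq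
    simp only [add_zero] at h1
    have h2 : Tendsto (fun n => typeI P Γ (c n)) atTop (𝓝 0) := by
      refine tendsto_of_tendsto_of_tendsto_of_le_of_le' tendsto_const_nhds h1
        (Eventually.of_forall fun n => guessProb_nonneg hP.1 hΓ _ _) ?_
      filter_upwards [hbadle, eventually_ne_atTop 0] with n h3 hn
      refine (typeI_twoWordCode_le (hκ n) hΓ hP).trans
        (add_le_add (add_le_add ?_ (haccle n hn)) (hYle n hn))
      refine le_trans (le_mul_of_one_le_left (prob_nonneg hPU.1 _) ?_) h3
      exact one_le_pow₀ (by simp)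
    exact h2.limsup_eq.trans_le hε
  · refine le_liminf_decayRate (fun n => guessProb_nonneg hQ.1 hΓ _ _)
      (fun n => guessProb_le_one hQ hΓ (hκ n) _ _) fun e _ he => ?_
    obtain ⟨e', hee', he'⟩ := exists_ofReal_lt_lt he
    obtain ⟨he2, he3⟩ := lt_min_iff.mp he'
    obtain ⟨ν, hν, hnear⟩ := exists_near_E2 hP hPQ hpos htop he2
    have hA := eventually_prob_le hQ
      (G := fun n => {w | (fun i => (w i).1) ∉ bad n ∧ (fun i => (w i).2) ∈ accV n}) (e := e')
      (.inr <| by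
        filter_upwards [hμ0.eventually_le_const hν] with n hn hn0 w hw
        refine hnear _ (typ_mem hn0 w) ⟨?_, ?_⟩
        · rw [← typ_fst]
          exact hw.1
        · rw [← typ_snd]
          exact near_mono hn hw.2)
    obtain ⟨e₁, e₂, h1, h2, hle⟩ := exists_le_add_of_ofReal_lt_add
      (a := E3Source P Q Γ x₁) (b := klDiv (chanY Γ 0) (chanY Γ x₁)) he3
    have hB := eventually_prob_le hQ
      (G := fun n => {w | (fun i => (w i).1) ∈ bad n ∧ (fun i => (w i).2) ∈ accV n}) (e := e₁)
      (h1.imp_right fun h1 => by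
        obtain ⟨ν, hν, hnear⟩ := exists_near_E3Source hP hPQ h1
        filter_upwards [hμ0.eventually_le_const hν] with n hn hn0 w hw
        refine hnear _ (typ_mem hn0 w) ⟨?_, ?_⟩
        · rw [← typ_fst]
          exact hw.1
        · rw [← typ_snd]
          exact near_mono hn hw.2)
    have hC := eventually_prob_le (chanY_mem hΓ x₁) (G := accY) (e := e₂)
      (h2.imp_right fun h2 => by
        obtain ⟨ν, hν, hnear⟩ := exists_near_klDiv h2
        filter_upwards [hμ0.eventually_le_const hν] with n hn hn0 w hw
        exact hnear _ (typ_mem hn0 w) (near_mono hn hw))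
    set s := Fintype.card (U × V)
    set t := Fintype.card Y
    filter_upwards [hA, hB, hC, eventually_pow_mul_exp_le (s + t + 1) hee',
      eventually_ge_atTop 1] with n hA hB hC hfin hn
    have hn1 : (1 : ℝ) ≤ n := by exact_mod_cast hn
    refine ((typeII_twoWordCode_le (hκ n) hΓ hQ.1).trans ?_).trans hfin
    have hBC := mul_le_mul hB hC (prob_nonneg (chanY_mem hΓ x₁).1 _) (by positivity)
    have hexp : Real.exp (-(n * e₁)) * Real.exp (-(n * e₂)) ≤ Real.exp (-(n * e')) := by
      rw [← Real.exp_add]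
      exact Real.exp_le_exp.mpr (by nlinarith)
    have hs : ((n : ℝ) + 1) ^ s ≤ ((n : ℝ) + 1) ^ (s + t) :=
      pow_le_pow_right₀ (by linarith) (Nat.le_add_right s t)
    calc _ ≤ ((n : ℝ) + 1) ^ s * Real.exp (-(n * e')) +
          ((n : ℝ) + 1) ^ s * Real.exp (-(n * e₁)) *
            (((n : ℝ) + 1) ^ t * Real.exp (-(n * e₂))) := add_le_add hA hBC
      _ = ((n : ℝ) + 1) ^ s * Real.exp (-(n * e')) + ((n : ℝ) + 1) ^ (s + t) *
            (Real.exp (-(n * e₁)) * Real.exp (-(n * e₂))) := by ring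
      _ ≤ ((n : ℝ) + 1) ^ (s + t) * Real.exp (-(n * e')) +
            ((n : ℝ) + 1) ^ (s + t) * Real.exp (-(n * e')) :=
          add_le_add (mul_le_mul_of_nonneg_right hs (Real.exp_pos _).le)
            (mul_le_mul_of_nonneg_left hexp (by positivity))
      _ = 2 * (((n : ℝ) + 1) ^ (s + t) * Real.exp (-(n * e'))) := by ring
      _ ≤ ((n : ℝ) + 1) * (((n : ℝ) + 1) ^ (s + t) * Real.exp (-(n * e'))) :=
          mul_le_mul_of_nonneg_right (by linarith) (by positivity)
      _ = _ := by ring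

end Exponents

end CovertDHT

theorem theorem1 {U V X Y Z : Type*}
    [Fintype U] [Fintype V] [Fintype X] [Fintype Y] [Fintype Z] [Zero X]
    (P Q : U × V → ℝ) (hP : P ∈ stdSimplex ℝ (U × V)) (hQ : Q ∈ stdSimplex ℝ (U × V))
    (hPQ : ∀ w, Q w = 0 → P w = 0)
    (Γ : X → Y × Z → ℝ) (hΓ : ∀ x, Γ x ∈ stdSimplex ℝ (Y × Z))
    -- no pmf `ψ` on the nonzero inputs simulates the input `0` at the warden
    (hsim : ∀ ψ ∈ stdSimplex ℝ X, ψ 0 = 0 →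
      (fun z => ∑ x, ψ x * CovertDHT.chanZ Γ x z) ≠ CovertDHT.chanZ Γ 0)
    (hsuppZ : ∀ x z, 0 < CovertDHT.chanZ Γ x z → 0 < CovertDHT.chanZ Γ 0 z)
    (hsuppY : ∀ x y, 0 < CovertDHT.chanY Γ x y → 0 < CovertDHT.chanY Γ 0 y)
    -- arbitrary key sizes
    (κ : ℕ → ℕ) (hκ : ∀ n, 0 < κ n)
    (ε : ℝ) (hε0 : 0 ≤ ε) (hε1 : ε < 1) :
    (CovertDHT.PartiallyConnected Γ →
      CovertDHT.covertStein P Q Γ κ ε = CovertDHT.E1 P Q ∧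
      -- achieved without key, with `d_n` vanishing arbitrarily close to exponentially fast
      ∀ r : ℕ → ℝ, Tendsto (fun n => r n / (n : ℝ)) atTop (𝓝 0) →
        ∃ c : (n : ℕ) → CovertDHT.Code U V X Y n (κ n),
          (∀ n, (c n).KeyFree) ∧
          CovertDHT.Achieves P Q Γ ε c (CovertDHT.E1 P Q) ∧
          ∀ᶠ n in atTop, CovertDHT.wardenDiv P Γ (c n) ≤ ENNReal.ofReal (Real.exp (-(r n)))) ∧
    (¬ CovertDHT.PartiallyConnected Γ → ∀ x₁ : X, x₁ ≠ 0 →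
      min (CovertDHT.E2 P Q Γ x₁) (CovertDHT.E3 P Q Γ x₁) ≤ CovertDHT.covertStein P Q Γ κ ε ∧
      -- achieved without key, with `d_n` vanishing exponentially fast
      ∃ c : (n : ℕ) → CovertDHT.Code U V X Y n (κ n),
        (∀ n, (c n).KeyFree) ∧
        CovertDHT.Achieves P Q Γ ε c
          (min (CovertDHT.E2 P Q Γ x₁) (CovertDHT.E3 P Q Γ x₁)) ∧
        ∃ a : ℝ, 0 < a ∧ ∀ᶠ n : ℕ in atTop,
          CovertDHT.wardenDiv P Γ (c n) ≤ ENNReal.ofReal (Real.exp (-(a * n)))) := by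
  refine ⟨?_, fun _ x₁ hx₁ => ?_⟩
  · rintro ⟨x, -, y, hy, hxy⟩
    have key := fun r hr => CovertDHT.exists_achieves_E1 hP hQ hΓ hsuppZ hκ hε0 hy hxy (r := r) hr
    refine ⟨le_antisymm (iSup₂_le ?_) ?_, key⟩
    · rintro θ ⟨-, c, hc⟩
      exact CovertDHT.exponent_le_E1 hP hQ.1 hPQ hΓ hsim hκ hε1 hc
    · obtain ⟨c, -, hc, -⟩ := key 0 (by simp)
      exact CovertDHT.le_covertStein hc
  · classical
    have hne : CovertDHT.chanZ Γ x₁ ≠ CovertDHT.chanZ Γ 0 := by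
      have h := hsim (Pi.single x₁ 1) (single_mem_stdSimplex ℝ x₁)
        (Pi.single_eq_of_ne hx₁.symm 1)
      simpa [Pi.single_apply] using h
    obtain ⟨c, hkey, hc, ha⟩ :=
      CovertDHT.exists_achieves_min_E2_E3 hP hQ hPQ hΓ hsuppZ hκ hε0 hne
    exact ⟨CovertDHT.le_covertStein hc, c, hkey, hc, ha⟩
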